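/- Let $a,b\ge 1$ be integers and let $w$ be a positive reinforcement weight function on the positive integers. Consider the edge-reinforced random walk with weight $w$ on a graph with exactly two edges, green and red: when $X^e$ denotes the initial value of the edge $e$ plus the number of its past traversals, the walk at a vertex $v$ next traverses an edge $e$ incident to $v$ with probability $w(X^e)/\sum_{f\ni v}w(X^f)$. The initial values are $X^{\rm green}=a$ and $X^{\rm red}=b$, and the clock of the walk starts at time $t_0=a+b$. Let $P^{a,b}$ be its law on the graph with two vertices $0,1$ joined by two parallel edges, and let $\bar P^{a,b}$ be its law on the path with vertices $-1,0,1$ (green edge $\{0,-1\}$, red edge $\{0,1\}$) started at $0$. Let $P$ be either of these laws, and let $$T=\inf\{k\ge t_0:\ \text{there is an edge } e \text{ such that from time } k \text{ on only } e \text{ is traversed}\}$$ be the time of attraction. Call $n$ a possible time if $n\ge a+b$ and, in the case $P=\bar P^{a,b}$, in addition $n\equiv a+b \pmod 2$; only possible times can be values of $T$. Let $\rho>1$ and $\rho'=(\rho-1)/\rho$, let $\alpha\in(0,\infty)$, and let $\epsilon>0$ be fixed. In each part, the upper bound on $P(T=k+1)$ holds for all integers $k$ in the stated range, and the lower bound holds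 for all $k$ in that range for which $k+1$ is a possible time. All constants are finite and positive; they may depend on $a,b$, on the choice of the law, and on the parameters displayed. (a) If $w(k)=k^\rho$ for $k\ge1$, then for all $k\ge 1$ $$\frac{c_1(\rho)}{k^{\rho-\rho'}}\le P(T=k+1)\le\frac{c_2(\rho)}{k^{\rho-\rho'}}.$$ (b) If $\alpha>1$, $w(k)=k^\rho\log^\alpha k$ for $k\ge2$, and $w(1)>0$ is arbitrary, then for all $k\ge2$ $$\frac{c_1(\alpha,\rho,w(1))}{k^{\rho-\rho'}\log^\alpha k}\le P(T=k+1)\le\frac{c_2(\alpha,\rho,w(1))}{k^{\rho-\rho'}\log^\alpha k}.$$ (c) If $0<\alpha<1$ and $w(k)=k\,e^{\log^\alpha k}$ for $k\ge1$, then for all $k\ge2$ $$\frac{c_1}{k(\log k)^{1-\alpha}e^{\log^{\alpha^2}k-\beta\log^{2\alpha^2-\alpha}k}}\le P(T=k+1)\le\frac{c_2(\alpha)}{k(\log k)^{1-\alpha}e^{\log^{\alpha^2}k-(\alpha+\epsilon)\log^{2\alpha^2-\alpha}k}},$$ where $\beta=\alpha$ and $c_1=c_1(\alpha)$ if $\alpha\le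 2/3$, while $\beta=\alpha-\epsilon$ and $c_1=c_1(\alpha,\epsilon)$ if $\alpha>2/3$; the constant $c_2(\alpha)$ does not depend on $\epsilon$. In particular, if $0<\alpha\le1/2$, then $\exp\{-\log^{2\alpha^2-\alpha}k\}$ lies between two positive constants for all $k\ge2$, and for all $k\ge 2$ $$\frac{c_1(\alpha)}{k(\log k)^{1-\alpha}e^{\log^{\alpha^2}k}}\le P(T=k+1)\le\frac{c_2(\alpha)}{k(\log k)^{1-\alpha}e^{\log^{\alpha^2}k}}.$$ (d) If $0<\epsilon\le1$ and $w(k)=e^{k^\epsilon}$, then for all $k\ge1$ $$\frac{c_1(\epsilon)\,k^{1-\epsilon}}{e^{(k-k^*)^\epsilon}}\le P(T=k+1)\le\frac{c_2(\epsilon)\,k^{1-\epsilon}}{e^{(k-k^*)^\epsilon}},\qquad k^*=\frac k2-\frac{1-\epsilon}{\epsilon\,2^{2-\epsilon}}\,k^{1-\epsilon}\log k.$$ (e) If $\alpha>0$ and $w(k)=e^{\alpha k}$, then for all $k\ge1$ $$c_1(\alpha)\,e^{-\alpha k/2}\le P(T=k+1)\le c_2(\alpha)\,e^{-\alpha k/2}.$$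 -/

import Mathlib

open MeasureTheory ProbabilityTheory
open scoped NNReal ENNReal

namespace TwoEdgeWalk

/-- The two edges of the graph. -/
inductive Edge
  | green
  | red
  deriving DecidableEq

/-- The vertices `0` and `1` of the graph made of two parallel edges. -/
inductive ParallelVertex
  | zero
  | one

/-- The vertices `-1`, `0`, `1` of the path with two edges. -/
inductive PathVertex
  | left
  | center
  | right

/-- Two vertices `0`, `1` joined by two parallel edges: every edge leads to the other vertex. -/
def parallelAcross : ParallelVertex → Edge → Option ParallelVertex
  | .zero, _ => some .one
  | .one, _ => some .zero

/-- The path `-1, 0, 1`: the green edge joins `0` and `-1`, the red edge joins `0` and `1`.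
The value is `none` when the edge is not incident to the vertex. -/
def pathAcross : PathVertex → Edge → Option PathVertex
  | .center, .green => some .left
  | .center, .red => some .right
  | .left, .green => some .center
  | .left, .red => none
  | .right, .red => some .center
  | .right, .green => none

/-- The position of the particle and, for each edge `e`, the current weight count `X^e`
(initial value plus number of traversals so far). -/
structure State (V : Type) where
  pos : V
  count : Edge → ℕ

/-- States are discrete: every set of states is measurable. -/
instance (V : Type) : MeasurableSpace (State V) := ⊤

instance (V : Type) : DiscreteMeasurableSpace (State V) := ⟨fun _ => trivial⟩

variable {V : Type}

/-- The particle traverses the edge `e`, whose count goes up by one. -/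
def State.traverse (across : V → Edge → Option V) (s : State V) (e : Edge) : State V where
  pos := (across s.pos e).getD s.pos
  count := Function.update s.count e (s.count e + 1)

/-- The reinforced weight `w (X^e)` of an edge incident to the current position, and `0` for an
edge that is not incident to it. -/
noncomputable def State.weight (across : V → Edge → Option V) (w : ℕ → ℝ) (s : State V)
    (e : Edge) : ℝ≥0 :=
  if (across s.pos e).isSome then (w (s.count e)).toNNReal else 0

/-- The probability that the next edge is the green one: proportional to the reinforced weights of
the edges incident to the current position. -/
noncomputable def State.greenProb (across : V → Edge → Option V) (w : ℕ → ℝ) (s : State V) :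
    ℝ≥0 :=
  s.weight across w .green / (s.weight across w .green + s.weight across w .red)

lemma State.greenProb_le_one (across : V → Edge → Option V) (w : ℕ → ℝ) (s : State V) :
    s.greenProb across w ≤ 1 :=
  div_le_one_of_le₀ le_self_add zero_le

/-- One step of the edge-reinforced random walk. -/
noncomputable def step (across : V → Edge → Option V) (w : ℕ → ℝ) :
    Kernel (State V) (State V) where
  toFun s :=
    (s.greenProb across w : ℝ≥0∞) • Measure.dirac (s.traverse across .green) +
      ((1 - s.greenProb across w : ℝ≥0) : ℝ≥0∞) • Measure.dirac (s.traverse across .red)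
  measurable' := Measurable.of_discrete

instance (across : V → Edge → Option V) (w : ℕ → ℝ) : IsMarkovKernel (step across w) := by
  refine ⟨fun s => ⟨?_⟩⟩
  change ((s.greenProb across w : ℝ≥0∞) • Measure.dirac (s.traverse across .green) +
      ((1 - s.greenProb across w : ℝ≥0) : ℝ≥0∞) • Measure.dirac (s.traverse across .red))
        Set.univ = 1
  simp only [Measure.coe_add, Measure.coe_smul, Pi.add_apply, Pi.smul_apply, measure_univ,
    smul_eq_mul, mul_one]
  rw [← ENNReal.coe_add, add_tsub_cancel_of_le (s.greenProb_le_one across w), ENNReal.coe_one]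

/-- The law of the trajectory of the edge-reinforced random walk with weight function `w` started
in the state `s`; the `n`-th coordinate is the state after `n` steps. -/
noncomputable def law (across : V → Edge → Option V) (w : ℕ → ℝ) (s : State V) :
    Measure (ℕ → State V) :=
  Kernel.traj (X := fun _ => State V)
    (fun n => (step across w).comap (fun h => h ⟨n, Finset.mem_Iic.2 le_rfl⟩)
      (measurable_pi_apply _)) 0 (fun _ => s)

/-- The state at position `v` with counts `a` on the green edge and `b` on the red one. -/
def initial (v : V) (a b : ℕ) : State V where
  pos := v
  count
    | .green => a
    | .red => b

/-- The time of attraction: the first time from which on only one edge is traversed, that is, from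
which on the count of every other edge stays constant.  The clock of the walk starts at `t₀`, so
that the `n`-th coordinate of a trajectory is the state at time `t₀ + n`.  The value is `⊤` if
there is no such time. -/
noncomputable def attractionTime (t₀ : ℕ) (ω : ℕ → State V) : ℕ∞ :=
  sInf {t : ℕ∞ | ∃ n : ℕ, t = ((t₀ + n : ℕ) : ℕ∞) ∧
    ∃ e : Edge, ∀ f : Edge, f ≠ e → ∀ m : ℕ, n ≤ m → (ω m).count f = (ω n).count f}

/-- The two graphs with two edges: two parallel edges, or a path. -/
inductive Graph
  | parallel
  | path

/-- The probability that the time of attraction equals `t`, for the walk with weight function `w`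
and initial counts `a`, `b`, whose clock starts at `a + b`.  On the first graph the law of the walk
is the one written `P^{a,b}`, on the second graph (with initial position `0`) it is the one
written `P̄^{a,b}`. -/
noncomputable def Graph.prob (g : Graph) (w : ℕ → ℝ) (a b t : ℕ) : ℝ :=
  match g with
  | .parallel => (law parallelAcross w (initial .zero a b)).real
      {ω | attractionTime (a + b) ω = (t : ℕ∞)}
  | .path => (law pathAcross w (initial .center a b)).real
      {ω | attractionTime (a + b) ω = (t : ℕ∞)}

/-- The possible values of the time of attraction: not before the initial time `a + b`, and, on the
path, at an even distance from it, because the walk on the path can only change the edge when it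
is at the vertex `0`. -/
def Graph.Possible (g : Graph) (a b t : ℕ) : Prop :=
  a + b ≤ t ∧ (g = .path → t % 2 = (a + b) % 2)

end TwoEdgeWalk

/-! Looked at only when both edges are available, the walk is an urn: after `i` green and `j` red
draws the next draw is green with probability `u i / (u i + v j)`, where `u i = w (a + s * i)`, `v j
= w (b + s * j)`, and `s` is `1` for parallel edges and `2` for the path, on which every crossing is
followed by a forced return. Apart from the value `a + b`, the time of attraction is the end of the
last draw of the losing colour.

The first ingredient is the probability of visiting `(i, j)`. Multiplied by `u i * v j / (u i + v
j)` it becomes a function whose value at `(i + 1, j + 1)` is a weighted average of its values at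
`(i, j + 1)` and `(i + 1, j)`. It therefore lies between its extreme values on the two axes, where
it is explicit and where summability of `1 / w` keeps it away from `0`
(`IsUrn.exists_density_bounds`). Hence visiting `(i, j)` and then drawing green has probability of
order `1 / v j`, and drawing only red afterwards costs a product of factors `v l / (u (i + 1) + v
l)`, comparable to `exp (-c * u (i + 1) * ∑_{l ≥ j} 1 / v l)`.

With `I` the final count of the losing edge and `W = tailSum w`, summation over the states gives
`P(T = k + 1) ≈ ∑_I 1 / w (k + 1 - I) * exp (-c * w I * W (k + 1 - I))`, with different constants
`c` in the two directions and, in the upper bound, an extra term `1 / w ((k + 2) / 2)` for states in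
which the loser is ahead (`exists_prob_le`, `exists_le_prob`).

The exponential cuts the sum off where `w I * W (k + 1 - I)` is of order `1`. If `w` grows
regularly, `w (k + 1 - I)` and `W (k + 1 - I)` may be replaced by `w k` and `W k`, and the sum has
order `N / w k` with `w N * W k ≈ 1` (`exists_prob_le_of_regular`, `exists_le_prob_of_regular`). For
`exp (α * n ^ ε)` the factor `1 / w (k + 1 - I)` grows with `I`, and the sum is carried by a window
of width `k ^ (1 - ε)` at the balance point `loserCount`. What remains is to compute `W` from an
antiderivative (`tailSum_bounds_of_hasDerivAt`), to solve the balance equation up to a bounded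
factor, and to adjust constants for finitely many `k`. -/

/-! ### Urns with reinforcement and the probability of visiting a state. -/

/-- `G n` is the number of green balls drawn in the first `n` draws from an urn in which, after `i`
green and `j` red draws, the next draw is green with probability `u i / (u i + v j)`. -/
structure IsUrn {Ω : Type*} [MeasurableSpace Ω] (μ : Measure Ω) (u v : ℕ → ℝ)
    (G : ℕ → Ω → ℕ) : Prop where
  measurable : ∀ n, Measurable (G n)
  zero : ∀ᵐ ω ∂μ, G 0 ω = 0
  succ : ∀ᵐ ω ∂μ, ∀ n, G (n + 1) ω = G n ω ∨ G (n + 1) ω = G n ω + 1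
  -- The condition on a whole stretch of the path is the Markov property; `x l ≤ l` makes `n - x n`
  -- an honest number of red draws.
  draw : ∀ (x : ℕ → ℕ) (m n : ℕ), m ≤ n → (∀ l ∈ Finset.Icc m n, x l ≤ l) →
    μ.real {ω | (∀ l ∈ Finset.Icc m n, G l ω = x l) ∧ G (n + 1) ω = x n + 1} =
      μ.real {ω | ∀ l ∈ Finset.Icc m n, G l ω = x l} * (u (x n) / (u (x n) + v (n - x n)))

namespace IsUrn

variable {Ω : Type*} [MeasurableSpace Ω] {μ : Measure Ω} {u v : ℕ → ℝ} {G : ℕ → Ω → ℕ}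

lemma ae_le (h : IsUrn μ u v G) : ∀ᵐ ω ∂μ, ∀ n, G n ω ≤ n := by
  filter_upwards [h.zero, h.succ] with ω h0 h1 n
  induction n with
  | zero => omega
  | succ n ih => have := h1 n; omega

lemma measurableSet_path (h : IsUrn μ u v G) (x : ℕ → ℕ) (m n : ℕ) :
    MeasurableSet {ω | ∀ l ∈ Finset.Icc m n, G l ω = x l} := by
  have : {ω | ∀ l ∈ Finset.Icc m n, G l ω = x l} =
      ⋂ l ∈ Finset.Icc m n, G l ⁻¹' {x l} := by
    ext ω; simp
  rw [this]
  exact Finset.measurableSet_biInter _ fun l _ => h.measurable l (measurableSet_singleton _)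

lemma draw_one (h : IsUrn μ u v G) {n i : ℕ} (hi : i ≤ n) :
    μ.real {ω | G n ω = i ∧ G (n + 1) ω = i + 1} =
      μ.real {ω | G n ω = i} * (u i / (u i + v (n - i))) := by
  have := h.draw (fun _ => i) n n le_rfl (by simpa using hi)
  simpa using this

/-- The probability of visiting `(i, j)` divided by its order of magnitude; equivalently, the
density at `0` of the difference of the times at which the two colours reach `i` and `j` in the
continuous-time embedding of the urn. -/
noncomputable def density (μ : Measure Ω) (u v : ℕ → ℝ) (G : ℕ → Ω → ℕ) (i j : ℕ) : ℝ :=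
  μ.real {ω | G (i + j) ω = i} * (u i * v j / (u i + v j))

/-- Together with `swap`, this transfers the estimate on the axis `i = 0` to the axis `j = 0`. -/
lemma density_swap (h : IsUrn μ u v G) (i j : ℕ) :
    density μ v u (fun n ω => n - G n ω) j i = density μ u v G i j := by
  unfold density
  congr 1
  · apply measureReal_congr
    filter_upwards [h.ae_le] with ω hω
    have := hω (i + j)
    refine propext ?_
    change j + i - G (j + i) ω = j ↔ G (i + j) ω = i
    rw [add_comm j i]; omega
  · ring

variable [IsProbabilityMeasure μ]

/-- The probability that the next draw along a given path is red. -/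
lemma stay (h : IsUrn μ u v G) (hu : ∀ n, 0 < u n) (hv : ∀ n, 0 < v n) (x : ℕ → ℕ) (m n : ℕ)
    (hmn : m ≤ n) (hx : ∀ l ∈ Finset.Icc m n, x l ≤ l) :
    μ.real {ω | (∀ l ∈ Finset.Icc m n, G l ω = x l) ∧ G (n + 1) ω = x n} =
      μ.real {ω | ∀ l ∈ Finset.Icc m n, G l ω = x l} *
        (v (n - x n) / (u (x n) + v (n - x n))) := by
  have h1 := h.draw x m n hmn hx
  have hE := h.measurableSet_path x m n
  have h2 := measureReal_inter_add_sdiff (μ := μ)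
    (s := {ω | ∀ l ∈ Finset.Icc m n, G l ω = x l})
    (h.measurable (n + 1) (measurableSet_singleton (x n + 1)))
  have h3 : μ.real ({ω | ∀ l ∈ Finset.Icc m n, G l ω = x l} \ (G (n + 1) ⁻¹' {x n + 1})) =
      μ.real {ω | (∀ l ∈ Finset.Icc m n, G l ω = x l) ∧ G (n + 1) ω = x n} := by
    apply measureReal_congr
    filter_upwards [h.succ] with ω hω
    refine propext ?_
    change ((∀ l ∈ Finset.Icc m n, G l ω = x l) ∧ ¬ (G (n + 1) ω = x n + 1)) ↔ _
    constructor
    · rintro ⟨h4, h5⟩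
      refine ⟨h4, ?_⟩
      have := h4 n (Finset.mem_Icc.2 ⟨hmn, le_rfl⟩)
      rcases hω n with h6 | h6 <;> omega
    · rintro ⟨h4, h5⟩
      exact ⟨h4, by omega⟩
  have h4 : {ω | ∀ l ∈ Finset.Icc m n, G l ω = x l} ∩ (G (n + 1) ⁻¹' {x n + 1}) =
      {ω | (∀ l ∈ Finset.Icc m n, G l ω = x l) ∧ G (n + 1) ω = x n + 1} := rfl
  rw [h3, h4, h1] at h2
  have hs : u (x n) + v (n - x n) ≠ 0 := (add_pos (hu _) (hv _)).ne'
  have h5 : v (n - x n) / (u (x n) + v (n - x n)) = 1 - u (x n) / (u (x n) + v (n - x n)) := by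
    field_simp; ring
  rw [h5]; linarith

/-- Exchanging the two colours. -/
lemma swap (h : IsUrn μ u v G) (hu : ∀ n, 0 < u n) (hv : ∀ n, 0 < v n) :
    IsUrn μ v u (fun n ω => n - G n ω) where
  measurable n := (measurable_of_countable (fun k : ℕ => n - k)).comp (h.measurable n)
  zero := by filter_upwards with ω; simp
  succ := by
    filter_upwards [h.succ, h.ae_le] with ω h1 h2 n
    have := h1 n; have := h2 n; have := h2 (n + 1); omega
  draw x m n hmn hx := by
    have hxn := hx n (Finset.mem_Icc.2 ⟨hmn, le_rfl⟩)
    have h1 := h.stay hu hv (fun l => l - x l) m n hmn (fun l _ => Nat.sub_le _ _)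
    have h2 : μ.real {ω | ∀ l ∈ Finset.Icc m n, l - G l ω = x l} =
        μ.real {ω | ∀ l ∈ Finset.Icc m n, G l ω = l - x l} := by
      apply measureReal_congr
      filter_upwards [h.ae_le] with ω hω
      refine propext ⟨fun h4 l hl => ?_, fun h4 l hl => ?_⟩ <;>
      · have := h4 l hl; have := hω l; have := hx l hl; omega
    have h3 : μ.real {ω | (∀ l ∈ Finset.Icc m n, l - G l ω = x l) ∧
          n + 1 - G (n + 1) ω = x n + 1} =
        μ.real {ω | (∀ l ∈ Finset.Icc m n, G l ω = l - x l) ∧ G (n + 1) ω = n - x n} := by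
      apply measureReal_congr
      filter_upwards [h.ae_le] with ω hω
      refine propext ⟨fun h4 => ⟨fun l hl => ?_, ?_⟩, fun h4 => ⟨fun l hl => ?_, ?_⟩⟩
      · have := h4.1 l hl; have := hω l; have := hx l hl; omega
      · have := h4.2; have := hω (n + 1); omega
      · have := h4.1 l hl; have := hω l; have := hx l hl; omega
      · have := h4.2; have := hω (n + 1); omega
    rw [h2, h3, h1, Nat.sub_sub_self hxn, add_comm]

lemma stay_one (h : IsUrn μ u v G) (hu : ∀ n, 0 < u n) (hv : ∀ n, 0 < v n) {n i : ℕ}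
    (hi : i ≤ n) :
    μ.real {ω | G n ω = i ∧ G (n + 1) ω = i} =
      μ.real {ω | G n ω = i} * (v (n - i) / (u i + v (n - i))) := by
  have := h.stay hu hv (fun _ => i) n n le_rfl (by simpa using hi)
  simpa using this

lemma prob_zero (h : IsUrn μ u v G) : μ.real {ω | G 0 ω = 0} = 1 := by
  rw [measureReal_congr (t := Set.univ)]
  · simp
  · filter_upwards [h.zero] with ω hω
    exact propext ⟨fun _ => trivial, fun _ => hω⟩

lemma prob_succ_zero (h : IsUrn μ u v G) (hu : ∀ n, 0 < u n) (hv : ∀ n, 0 < v n) (n : ℕ) :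
    μ.real {ω | G (n + 1) ω = 0} = μ.real {ω | G n ω = 0} * (v n / (u 0 + v n)) := by
  have := h.stay_one hu hv (Nat.zero_le n)
  rw [Nat.sub_zero] at this
  rw [← this]
  apply measureReal_congr
  filter_upwards [h.succ] with ω hω
  have := hω n
  exact propext ⟨fun h : G (n + 1) ω = 0 => ⟨by omega, h⟩, fun h => h.2⟩

lemma prob_succ_succ (h : IsUrn μ u v G) (n i : ℕ) :
    μ.real {ω | G (n + 1) ω = i + 1} =
      μ.real {ω | G n ω = i ∧ G (n + 1) ω = i + 1} +
        μ.real {ω | G n ω = i + 1 ∧ G (n + 1) ω = i + 1} := by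
  have hm : ∀ a b, MeasurableSet {ω | G n ω = a ∧ G (n + 1) ω = b} := fun a b =>
    (h.measurable n (measurableSet_singleton a)).inter
      (h.measurable (n + 1) (measurableSet_singleton b))
  rw [← measureReal_union _ (hm _ _)]
  · apply measureReal_congr
    filter_upwards [h.succ] with ω hω
    have := hω n
    refine propext ⟨fun h : G (n + 1) ω = i + 1 => ?_, fun h => ?_⟩
    · rcases this with h1 | h1
      · exact Or.inr ⟨by omega, h⟩
      · exact Or.inl ⟨by omega, h⟩
    · rcases h with h | h
      · exact h.2
      · exact h.2
  · rw [Set.disjoint_left]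
    rintro ω ⟨h1, _⟩ ⟨h2, _⟩
    omega

lemma density_zero_zero (h : IsUrn μ u v G) :
    density μ u v G 0 0 = u 0 * (v 0 / (u 0 + v 0)) := by
  simp only [density, add_zero, h.prob_zero]; ring

lemma density_zero_succ (h : IsUrn μ u v G) (hu : ∀ n, 0 < u n) (hv : ∀ n, 0 < v n) (j : ℕ) :
    density μ u v G 0 (j + 1) = density μ u v G 0 j * (v (j + 1) / (u 0 + v (j + 1))) := by
  simp only [density, zero_add]
  rw [h.prob_succ_zero hu hv]
  have := hu 0; have := hv j; have := hv (j + 1)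
  field_simp

/-- The normalising factor is chosen for this identity: `P(i, j) * u i / (u i + v j)` equals the
density divided by `v j`, and the analogous red transition equals it divided by `u i`. The forward
equation thus becomes a convex combination of the two predecessors. -/
lemma density_succ_succ (h : IsUrn μ u v G) (hu : ∀ n, 0 < u n) (hv : ∀ n, 0 < v n) (i j : ℕ) :
    density μ u v G (i + 1) (j + 1) =
      (u (i + 1) * density μ u v G i (j + 1) + v (j + 1) * density μ u v G (i + 1) j) /
        (u (i + 1) + v (j + 1)) := by
  have h1 := h.prob_succ_succ (i + j + 1) i
  rw [h.draw_one (by omega), h.stay_one hu hv (show i + 1 ≤ i + j + 1 by omega),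
    show i + j + 1 - i = j + 1 by omega, show i + j + 1 - (i + 1) = j by omega] at h1
  simp only [density]
  rw [show i + 1 + (j + 1) = i + j + 1 + 1 by ring, show i + (j + 1) = i + j + 1 by ring,
    show i + 1 + j = i + j + 1 by ring, h1]
  have := hu i; have := hv j; have := hv (j + 1); have := hu (i + 1)
  field_simp

lemma density_zero_eq (h : IsUrn μ u v G) (hu : ∀ n, 0 < u n) (hv : ∀ n, 0 < v n) (j : ℕ) :
    density μ u v G 0 j = u 0 * ∏ l ∈ Finset.range (j + 1), v l / (u 0 + v l) := by
  induction j with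
  | zero => simp [h.density_zero_zero]
  | succ j ih =>
    rw [h.density_zero_succ hu hv, ih, Finset.prod_range_succ _ (j + 1)]; ring

end IsUrn

/-- Each factor is `1 / (1 + x / v l)`, and `1 + t ≤ exp t`. -/
lemma exp_le_prod_div {x : ℝ} (hx : 0 ≤ x) {v : ℕ → ℝ} (hv : ∀ n, 0 < v n)
    (hs : Summable fun n => 1 / v n) (M : ℕ) :
    Real.exp (-(x * ∑' l, 1 / v l)) ≤ ∏ l ∈ Finset.range M, v l / (x + v l) := by
  have h1 : ∀ l, Real.exp (-(x * (1 / v l))) ≤ v l / (x + v l) := by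
    intro l
    have hl := hv l
    rw [Real.exp_neg, ← inv_div (x + v l)]
    apply inv_anti₀ (by positivity)
    have := Real.add_one_le_exp (x * (1 / v l))
    have h2 : (x + v l) / v l = x * (1 / v l) + 1 := by field_simp
    rw [h2]; exact this
  calc Real.exp (-(x * ∑' l, 1 / v l))
      ≤ Real.exp (∑ l ∈ Finset.range M, -(x * (1 / v l))) := by
        apply Real.exp_le_exp.2
        rw [Finset.sum_neg_distrib, ← Finset.mul_sum]
        have := hs.sum_le_tsum (Finset.range M) (fun l _ => by have := hv l; positivity)
        have := mul_le_mul_of_nonneg_left this hx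
        linarith
    _ = ∏ l ∈ Finset.range M, Real.exp (-(x * (1 / v l))) := Real.exp_sum _ _
    _ ≤ _ := Finset.prod_le_prod (fun _ _ => (Real.exp_pos _).le) (fun l _ => h1 l)

namespace IsUrn

variable {Ω : Type*} [MeasurableSpace Ω] {μ : Measure Ω} [IsProbabilityMeasure μ]
  {u v : ℕ → ℝ} {G : ℕ → Ω → ℕ}

/-- On the axis the density is `u 0` times a product of red transition probabilities, which
convergence of `∑ 1 / v` keeps away from zero. -/
lemma density_zero_mem (h : IsUrn μ u v G) (hu : ∀ n, 0 < u n) (hv : ∀ n, 0 < v n)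
    (hs : Summable fun n => 1 / v n) (j : ℕ) :
    u 0 * Real.exp (-(u 0 * ∑' l, 1 / v l)) ≤ density μ u v G 0 j ∧
      density μ u v G 0 j ≤ u 0 := by
  rw [h.density_zero_eq hu hv]
  have h0 := hu 0
  constructor
  · exact mul_le_mul_of_nonneg_left (exp_le_prod_div h0.le hv hs _) h0.le
  · apply mul_le_of_le_one_right h0.le
    apply Finset.prod_le_one
    · intro l _; have := hv l; positivity
    · intro l _; have := hv l
      rw [div_le_one (by positivity)]; linarith

/-- The density of visits is bounded from both sides, uniformly in the state. -/
lemma exists_density_bounds (h : IsUrn μ u v G) (hu : ∀ n, 0 < u n) (hv : ∀ n, 0 < v n)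
    (hsu : Summable fun n => 1 / u n) (hsv : Summable fun n => 1 / v n) :
    ∃ c > 0, ∃ C > 0, ∀ i j, c ≤ density μ u v G i j ∧ density μ u v G i j ≤ C := by
  have h1 := h.density_zero_mem hu hv hsv
  have h2 := (h.swap hu hv).density_zero_mem hv hu hsu
  simp only [h.density_swap] at h2
  have hu0 := hu 0; have hv0 := hv 0
  refine ⟨min (u 0 * Real.exp (-(u 0 * ∑' l, 1 / v l))) (v 0 * Real.exp (-(v 0 * ∑' l, 1 / u l))),
    by positivity, max (u 0) (v 0), by positivity, ?_⟩
  intro i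
  -- Maximum principle: bounds that hold on both axes pass to the interior through the averaging
  -- identity.
  induction i with
  | zero => exact fun j => ⟨(min_le_left _ _).trans (h1 j).1, (h1 j).2.trans (le_max_left _ _)⟩
  | succ i ihi =>
    intro j
    induction j with
    | zero =>
      exact ⟨(min_le_right _ _).trans (h2 (i + 1)).1, (h2 (i + 1)).2.trans (le_max_right _ _)⟩
    | succ j ihj =>
      rw [h.density_succ_succ hu hv]
      have h3 := hu (i + 1); have h4 := hv (j + 1)
      obtain ⟨h5, h6⟩ := ihi (j + 1)
      obtain ⟨h7, h8⟩ := ihj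
      constructor
      · rw [le_div_iff₀ (by positivity)]
        have := mul_le_mul_of_nonneg_left h5 h3.le
        have := mul_le_mul_of_nonneg_left h7 h4.le
        linarith
      · rw [div_le_iff₀ (by positivity)]
        have := mul_le_mul_of_nonneg_left h6 h3.le
        have := mul_le_mul_of_nonneg_left h8 h4.le
        linarith

/-! ### The last draw of a colour. -/

/-- After `N` draws there are `i` green ones; the next draw is green, and all later ones red. -/
def lastGreen (G : ℕ → Ω → ℕ) (N i : ℕ) : Set Ω :=
  {ω | G N ω = i ∧ ∀ m, N + 1 ≤ m → G m ω = i + 1}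

/-- Once the path has settled at `i` green draws, each further step multiplies its probability by
that of a red draw. The initial stretch is arbitrary, so that this serves both the last green draw
and the event of no green draw at all. -/
lemma prob_path_const (h : IsUrn μ u v G) (hu : ∀ n, 0 < u n) (hv : ∀ n, 0 < v n) {i j : ℕ}
    (x : ℕ → ℕ) (m N : ℕ) (hm : m ≤ N) (hN : N = i + j) (hx : ∀ l, m ≤ l → l ≤ N → x l ≤ l)
    (hx' : ∀ l, N ≤ l → x l = i) (M : ℕ) :
    μ.real {ω | ∀ l ∈ Finset.Icc m (N + M), G l ω = x l} =
      μ.real {ω | ∀ l ∈ Finset.Icc m N, G l ω = x l} *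
        ∏ l ∈ Finset.range M, v (j + l) / (u i + v (j + l)) := by
  induction M with
  | zero => simp
  | succ M ih =>
    have h1 := h.stay hu hv x m (N + M) (by omega) (by
      intro l hl
      rw [Finset.mem_Icc] at hl
      rcases le_total l N with h2 | h2
      · exact hx l hl.1 h2
      · rw [hx' l h2]; omega)
    rw [ih, hx' (N + M) (by omega), show N + M - i = j + M by omega] at h1
    rw [Finset.prod_range_succ, ← mul_assoc, ← h1]
    congr 1
    ext ω
    simp only [Set.mem_ofPred_eq, Finset.mem_Icc]
    constructor
    · intro h2
      refine ⟨fun l hl => h2 l (by omega), ?_⟩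
      rw [← hx' (N + (M + 1)) (by omega)]
      exact h2 _ (by omega)
    · rintro ⟨h2, h3⟩ l hl
      by_cases h4 : l ≤ N + M
      · exact h2 l ⟨hl.1, h4⟩
      · have : l = N + M + 1 := by omega
        subst this
        rw [h3, hx' _ (by omega)]

/-- The factor `density / v j` is the probability of visiting `(i, j)` and drawing green there; the
product accounts for `M` red draws that follow. -/
lemma prob_lastGreen_approx (h : IsUrn μ u v G) (hu : ∀ n, 0 < u n) (hv : ∀ n, 0 < v n)
    (i j M : ℕ) :
    μ.real {ω | ∀ l ∈ Finset.Icc (i + j) (i + j + 1 + M),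
        G l ω = if l ≤ i + j then i else i + 1} =
      density μ u v G i j / v j * ∏ l ∈ Finset.range M, v (j + l) / (u (i + 1) + v (j + l)) := by
  rw [h.prob_path_const hu hv (i := i + 1) (j := j) (fun l => if l ≤ i + j then i else i + 1)
    (i + j) (i + j + 1) (by omega) (by omega) (by intro l h1 h2; split_ifs <;> omega)
    (by intro l hl; rw [if_neg (by omega)])]
  congr 1
  have h1 := h.draw_one (show i ≤ i + j by omega)
  rw [show i + j - i = j by omega] at h1
  have h2 : {ω | ∀ l ∈ Finset.Icc (i + j) (i + j + 1), G l ω = if l ≤ i + j then i else i + 1} =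
      {ω | G (i + j) ω = i ∧ G (i + j + 1) ω = i + 1} := by
    ext ω
    simp only [Set.mem_ofPred_eq, Finset.mem_Icc]
    constructor
    · intro h3
      have h4 := h3 (i + j) (by omega)
      have h5 := h3 (i + j + 1) (by omega)
      rw [if_pos (by omega)] at h4
      rw [if_neg (by omega)] at h5
      exact ⟨h4, h5⟩
    · rintro ⟨h3, h4⟩ l hl
      split_ifs with h5
      · rw [show l = i + j by omega]; exact h3
      · rw [show l = i + j + 1 by omega]; exact h4
  rw [h2, h1, density]
  have := hv j; have := hu i
  field_simp

/-- `M` stays free: a finite `M` is used when the green count is large, and `M → ∞` otherwise. -/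
lemma prob_lastGreen_le (h : IsUrn μ u v G) (hu : ∀ n, 0 < u n) (hv : ∀ n, 0 < v n)
    (i j M : ℕ) :
    μ.real (lastGreen G (i + j) i) ≤
      density μ u v G i j / v j * ∏ l ∈ Finset.range M, v (j + l) / (u (i + 1) + v (j + l)) := by
  rw [← h.prob_lastGreen_approx hu hv]
  refine measureReal_mono ?_ (measure_ne_top _ _)
  rintro ω ⟨h1, h2⟩ l hl
  rw [Finset.mem_Icc] at hl
  split_ifs with h3
  · rw [show l = i + j by omega]; exact h1
  · exact h2 l (by omega)

/-- Continuity from above along the decreasing events that fix the path up to `N + M`. -/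
lemma le_prob_of_forall_path (h : IsUrn μ u v G) (x : ℕ → ℕ) (m N : ℕ) {c : ℝ}
    (hc : ∀ M, c ≤ μ.real {ω | ∀ l ∈ Finset.Icc m (N + M), G l ω = x l}) :
    c ≤ μ.real {ω | ∀ l, m ≤ l → G l ω = x l} := by
  have h1 : {ω | ∀ l, m ≤ l → G l ω = x l} =
      ⋂ M : ℕ, {ω | ∀ l ∈ Finset.Icc m (N + M), G l ω = x l} := by
    ext ω
    simp only [Set.mem_ofPred_eq, Set.mem_iInter, Finset.mem_Icc]
    exact ⟨fun h1 M l hl => h1 l hl.1, fun h1 l hl => h1 l l ⟨hl, by omega⟩⟩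
  have h2 := tendsto_measure_iInter_atTop (μ := μ)
    (s := fun M => {ω | ∀ l ∈ Finset.Icc m (N + M), G l ω = x l})
    (fun M => (h.measurableSet_path x m (N + M)).nullMeasurableSet)
    (fun M M' hMM ω hω l hl => hω l (by rw [Finset.mem_Icc] at hl ⊢; omega))
    ⟨0, measure_ne_top _ _⟩
  rw [← h1] at h2
  have h3 := (ENNReal.tendsto_toReal (measure_ne_top μ _)).comp h2
  exact ge_of_tendsto' h3 hc

lemma le_prob_lastGreen (h : IsUrn μ u v G) (hu : ∀ n, 0 < u n) (hv : ∀ n, 0 < v n)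
    (hsv : Summable fun n => 1 / v n) (i j : ℕ) :
    density μ u v G i j / v j * Real.exp (-(u (i + 1) * ∑' l, 1 / v (j + l))) ≤
      μ.real (lastGreen G (i + j) i) := by
  have h1 : lastGreen G (i + j) i =
      {ω | ∀ l, i + j ≤ l → G l ω = if l ≤ i + j then i else i + 1} := by
    ext ω
    constructor
    · rintro ⟨h1, h2⟩ l hl
      split_ifs with h3
      · rw [show l = i + j by omega]; exact h1
      · exact h2 l (by omega)
    · intro h1
      refine ⟨by simpa using h1 (i + j) le_rfl, fun m hm => ?_⟩
      rw [h1 m (by omega), if_neg (by omega)]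
  rw [h1]
  apply h.le_prob_of_forall_path _ (i + j) (i + j + 1)
  intro M
  rw [h.prob_lastGreen_approx hu hv]
  apply mul_le_mul_of_nonneg_left
  · exact exp_le_prod_div (hu _).le (fun n => hv (j + n))
      (by simpa only [add_comm] using (summable_nat_add_iff j).2 hsv) M
  · have := hv j; have := hu i
    unfold density
    positivity

/-- Gives positive probability to attraction at the initial time, which the lower bounds need at `k
+ 1 = a + b`. -/
lemma prob_no_green_pos (h : IsUrn μ u v G) (hu : ∀ n, 0 < u n) (hv : ∀ n, 0 < v n)
    (hsv : Summable fun n => 1 / v n) : 0 < μ.real {ω | ∀ l, G l ω = 0} := by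
  have h1 := h.le_prob_of_forall_path (fun _ => 0) 0 0
    (c := Real.exp (-(u 0 * ∑' l, 1 / v l))) (by
      intro M
      have := h.prob_path_const hu hv (i := 0) (j := 0) (fun _ => 0) 0 0 le_rfl rfl
        (by simp) (by simp) M
      rw [this]
      simp only [Finset.Icc_self, Finset.mem_singleton, forall_eq, h.prob_zero, one_mul, zero_add]
      exact exp_le_prod_div (hu _).le hv hsv M)
  simp only [Nat.zero_le, true_imp_iff] at h1
  exact (Real.exp_pos _).trans_le h1

end IsUrn

/-! ### The Markov property of the walk and its almost sure trajectories. -/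

namespace TwoEdgeWalk

variable {V : Type}

instance (across : V → Edge → Option V) (w : ℕ → ℝ) (s : State V) :
    IsProbabilityMeasure (law across w s) := by
  unfold law; infer_instance

lemma law_zero (across : V → Edge → Option V) (w : ℕ → ℝ) (s : State V) :
    ∀ᵐ ω ∂law across w s, ω 0 = s := by
  have h := Kernel.traj_map_frestrictLe_apply (X := fun _ => State V)
    (κ := fun n => (step across w).comap (fun h => h ⟨n, Finset.mem_Iic.2 le_rfl⟩)
      (measurable_pi_apply _)) 0 0 (fun _ => s)
  rw [Kernel.partialTraj_self, Kernel.id_apply] at h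
  have hm : MeasurableSet {h : (_ : Finset.Iic 0) → State V | h ⟨0, by simp⟩ = s} := by
    have hf : Measurable fun h : (_ : Finset.Iic 0) → State V => h ⟨0, by simp⟩ :=
      measurable_pi_apply _
    exact hf (MeasurableSet.of_discrete (s := {s}))
  have h2 : ∀ᵐ h ∂((law across w s).map (Preorder.frestrictLe (π := fun _ => State V) 0)),
      h ⟨0, by simp⟩ = s := by
    unfold law
    rw [h, ae_dirac_iff hm]
  exact ae_of_ae_map (Preorder.measurable_frestrictLe 0).aemeasurable h2

/-- The Markov property of the walk. -/
lemma law_markov (across : V → Edge → Option V) (w : ℕ → ℝ) (s : State V)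
    (S : ℕ → Set (State V)) (n : ℕ) (x : State V) (C : Set (State V)) :
    (law across w s).real {ω | ((∀ l ≤ n, ω l ∈ S l) ∧ ω n = x) ∧ ω (n + 1) ∈ C} =
      (law across w s).real {ω | (∀ l ≤ n, ω l ∈ S l) ∧ ω n = x} *
        (step across w x).real C := by
  have h := Kernel.partialTraj_compProd_eq_map_traj (X := fun _ => State V)
    (κ := fun n => (step across w).comap (fun h => h ⟨n, Finset.mem_Iic.2 le_rfl⟩)
      (measurable_pi_apply _)) (Nat.zero_le n) (x₀ := fun _ => s)
  have h' := Kernel.traj_map_frestrictLe_apply (X := fun _ => State V)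
    (κ := fun n => (step across w).comap (fun h => h ⟨n, Finset.mem_Iic.2 le_rfl⟩)
      (measurable_pi_apply _)) 0 n (fun _ => s)
  set B : Set ((_ : Finset.Iic n) → State V) :=
    {h | (∀ l : Finset.Iic n, h l ∈ S l) ∧ h ⟨n, by simp⟩ = x} with hB
  have hmB : MeasurableSet B := by
    apply MeasurableSet.inter
    · have : {h : (_ : Finset.Iic n) → State V | ∀ l : Finset.Iic n, h l ∈ S l} =
          ⋂ l : Finset.Iic n, (fun h => h l) ⁻¹' (S l) := by ext; simp
      change MeasurableSet {h : (_ : Finset.Iic n) → State V | ∀ l : Finset.Iic n, h l ∈ S l}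
      rw [this]
      exact MeasurableSet.iInter fun l => measurable_pi_apply l MeasurableSet.of_discrete
    · have hf : Measurable fun h : (_ : Finset.Iic n) → State V => h ⟨n, by simp⟩ :=
        measurable_pi_apply _
      exact hf (MeasurableSet.of_discrete (s := {x}))
  have hmC : MeasurableSet C := MeasurableSet.of_discrete
  have e1 : {ω : ℕ → State V | ((∀ l ≤ n, ω l ∈ S l) ∧ ω n = x) ∧ ω (n + 1) ∈ C} =
      (fun ω : ℕ → State V => (Preorder.frestrictLe (π := fun _ => State V) n ω, ω (n + 1))) ⁻¹'
        (B ×ˢ C) := by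
    ext ω; simp [hB]
  have e2 : {ω : ℕ → State V | (∀ l ≤ n, ω l ∈ S l) ∧ ω n = x} =
      (Preorder.frestrictLe (π := fun _ => State V) n) ⁻¹' B := by
    ext ω; simp [hB]
  -- History and next state have the composition product as joint law. On `B` the current state is
  -- `x`, so the integral of the kernel over `B` is that of a constant.
  have key : (law across w s) {ω | ((∀ l ≤ n, ω l ∈ S l) ∧ ω n = x) ∧ ω (n + 1) ∈ C} =
      (law across w s) {ω | (∀ l ≤ n, ω l ∈ S l) ∧ ω n = x} * (step across w x) C := by
    rw [e1, e2, ← Measure.map_apply (by fun_prop) (hmB.prod hmC),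
      ← Measure.map_apply (by fun_prop) hmB]
    unfold law
    rw [← h, h', Measure.compProd_apply_prod hmB hmC]
    have : ∀ y ∈ B, ((step across w).comap (fun h : (_ : Finset.Iic n) → State V =>
        h ⟨n, Finset.mem_Iic.2 le_rfl⟩) (measurable_pi_apply _) y) C = step across w x C := by
      intro y hy
      rw [Kernel.comap_apply, hy.2]
    rw [setLIntegral_congr_fun hmB this, lintegral_const, Measure.restrict_apply_univ, mul_comm]
  unfold Measure.real
  rw [key, ENNReal.toReal_mul]

/-- A trajectory that starts in `s` and crosses an incident edge at every step. -/
def IsTrajectory (across : V → Edge → Option V) (s : State V) (ω : ℕ → State V) : Prop :=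
  ω 0 = s ∧ ∀ n, ∃ e, (across (ω n).pos e).isSome ∧ ω (n + 1) = (ω n).traverse across e

/-- An edge that is not incident has weight `0`, so its Dirac mass carries coefficient `0`.
Positivity of the weight on the incident edge is what rules out the quotient `0 / 0` in `greenProb`.
-/
lemma ae_step (across : V → Edge → Option V) {w : ℕ → ℝ} (hw : ∀ n, 1 ≤ n → 0 < w n)
    (hac : ∀ x, ∃ e, (across x e).isSome) (s : State V) (hs : ∀ e, 1 ≤ s.count e) :
    ∀ᵐ y ∂step across w s, ∃ e, (across s.pos e).isSome ∧ y = s.traverse across e := by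
  have hwt : ∀ e, (across s.pos e).isSome → 0 < s.weight across w e := by
    intro e he
    simp only [State.weight, he, if_true]
    exact Real.toNNReal_pos.2 (hw _ (hs e))
  change ∀ᵐ y ∂((s.greenProb across w : ℝ≥0∞) • Measure.dirac (s.traverse across .green) +
      ((1 - s.greenProb across w : ℝ≥0) : ℝ≥0∞) • Measure.dirac (s.traverse across .red)), _
  rw [ae_add_measure_iff]
  constructor
  · by_cases h : (across s.pos .green).isSome
    · refine Measure.ae_smul_measure ?_ _
      rw [ae_dirac_iff MeasurableSet.of_discrete]
      exact ⟨_, h, rfl⟩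
    · have : s.greenProb across w = 0 := by simp [State.greenProb, State.weight, h]
      simp [this]
  · by_cases h : (across s.pos .red).isSome
    · refine Measure.ae_smul_measure ?_ _
      rw [ae_dirac_iff MeasurableSet.of_discrete]
      exact ⟨_, h, rfl⟩
    · have hg : (across s.pos .green).isSome := by
        obtain ⟨e, he⟩ := hac s.pos
        cases e
        · exact he
        · exact absurd he h
      have h0 : s.weight across w .red = 0 := by simp [State.weight, h]
      have : s.greenProb across w = 1 := by
        rw [State.greenProb, h0, add_zero, div_self (hwt _ hg).ne']
      simp [this]

instance [Countable V] : Countable (State V) := by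
  have : Function.Injective fun s : State V => (s.pos, s.count .green, s.count .red) := by
    rintro ⟨p, c⟩ ⟨p', c'⟩ h
    simp only [Prod.mk.injEq] at h
    obtain ⟨rfl, h1, h2⟩ := h
    congr 1
    funext e
    cases e <;> assumption
  exact this.countable

lemma ae_isTrajectory [Countable V] (across : V → Edge → Option V) {w : ℕ → ℝ} (hw : ∀ n, 1 ≤ n → 0 < w n)
    (hac : ∀ x, ∃ e, (across x e).isSome) (s : State V) (hs : ∀ e, 1 ≤ s.count e) :
    ∀ᵐ ω ∂law across w s, IsTrajectory across s ω := by
  have h1 : ∀ᵐ ω ∂law across w s, ∀ n, (∀ e, 1 ≤ (ω n).count e) →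
      ∃ e, (across (ω n).pos e).isSome ∧ ω (n + 1) = (ω n).traverse across e := by
    rw [ae_all_iff]
    intro n
    -- There are countably many states, so it is enough to discard one null set for each possible
    -- current state.
    have hx : ∀ x : State V, ∀ᵐ ω ∂law across w s, ω n = x → (∀ e, 1 ≤ x.count e) →
        ∃ e, (across x.pos e).isSome ∧ ω (n + 1) = x.traverse across e := by
      intro x
      by_cases hx1 : ∀ e, 1 ≤ x.count e
      · have h2 := law_markov across w s (fun _ => Set.univ) n x
          {y | ¬ ∃ e, (across x.pos e).isSome ∧ y = x.traverse across e}
        have h3 : (step across w x).real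
            {y | ¬ ∃ e, (across x.pos e).isSome ∧ y = x.traverse across e} = 0 := by
          have := ae_step across hw hac x hx1
          rw [ae_iff] at this
          rw [Measure.real, this, ENNReal.toReal_zero]
        rw [h3, mul_zero, measureReal_eq_zero_iff] at h2
        rw [ae_iff]
        refine measure_mono_null ?_ h2
        intro ω hω
        simp only [Set.mem_ofPred_eq, Classical.not_imp] at hω
        exact ⟨⟨fun _ _ => trivial, hω.1⟩, hω.2.2⟩
      · exact Filter.Eventually.of_forall fun ω _ h => absurd h hx1
    filter_upwards [ae_all_iff.2 hx] with ω hω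
    exact hω (ω n) rfl
  filter_upwards [law_zero across w s, h1] with ω h0 h1
  -- Counts never decrease, so the condition under which each step is legitimate persists from the
  -- initial state.
  have h2 : ∀ n e, 1 ≤ (ω n).count e := by
    intro n
    induction n with
    | zero => rw [h0]; exact hs
    | succ n ih =>
      intro e
      obtain ⟨f, -, hf⟩ := h1 n ih
      rw [hf]
      by_cases h : e = f
      · subst h; simp [State.traverse]
      · simp only [State.traverse, Function.update_of_ne h]; exact ih e
  exact ⟨h0, fun n => h1 n (h2 n)⟩

end TwoEdgeWalk

/-! ### Deterministic study of blockwise trajectories and of the time of attraction. -/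

namespace TwoEdgeWalk

/-- The counts `c` grow in blocks of `s` steps, during each of which the same edge is crossed. -/
def IsBlockwise (s : ℕ) (c : ℕ → Edge → ℕ) : Prop :=
  ∀ n, ∃ e, ∀ r ≤ s, c (s * n + r) = Function.update (c (s * n)) e (c (s * n) e + r)

/-- The number of the first `n` blocks in which the edge `e` is crossed. -/
def blocks (s : ℕ) (c : ℕ → Edge → ℕ) (e : Edge) (n : ℕ) : ℕ := (c (s * n) e - c 0 e) / s

/-- From time `n` on, only one edge is crossed. -/
def Absorbed (c : ℕ → Edge → ℕ) (n : ℕ) : Prop := ∃ e, ∀ f, f ≠ e → ∀ m, n ≤ m → c m f = c n f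

/-- With two edges, the only edge other than `e` is the one whose count freezes. -/
lemma absorbed_iff {c : ℕ → Edge → ℕ} {n : ℕ} :
    Absorbed c n ↔ ∃ f, ∀ m, n ≤ m → c m f = c n f := by
  constructor
  · rintro ⟨e, he⟩
    cases e
    · exact ⟨.red, he .red (by decide)⟩
    · exact ⟨.green, he .green (by decide)⟩
  · rintro ⟨f, hf⟩
    cases f
    · refine ⟨.red, fun f hf' => ?_⟩
      cases f
      · exact hf
      · exact absurd rfl hf'
    · refine ⟨.green, fun f hf' => ?_⟩
      cases f
      · exact absurd rfl hf'
      · exact hf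

namespace IsBlockwise

variable {s : ℕ} {c : ℕ → Edge → ℕ}

lemma monotone (h : IsBlockwise s c) (hs : 0 < s) (e : Edge) : Monotone fun n => c n e := by
  refine monotone_nat_of_le_succ fun n => ?_
  obtain ⟨f, hf⟩ := h (n / s)
  have hr := Nat.mod_lt n hs
  have h1 := congrFun (hf (n % s) hr.le) e
  have h2 := congrFun (hf (n % s + 1) hr) e
  rw [Nat.div_add_mod] at h1
  rw [← add_assoc, Nat.div_add_mod] at h2
  rw [h1, h2]
  by_cases hef : e = f
  · subst hef; simp
  · simp [hef]

lemma exists_edge (h : IsBlockwise s c) (n : ℕ) :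
    ∃ e, (∀ r ≤ s, c (s * n + r) e = c (s * n) e + r) ∧
      ∀ f, f ≠ e → ∀ r ≤ s, c (s * n + r) f = c (s * n) f := by
  obtain ⟨e, he⟩ := h n
  refine ⟨e, fun r hr => ?_, fun f hf r hr => ?_⟩
  · rw [he r hr]; simp
  · rw [he r hr]; simp [hf]

/-- Shows that the truncated subtraction and the integer division in `blocks` lose nothing. -/
lemma count_eq (h : IsBlockwise s c) (hs : 0 < s) (e : Edge) (n : ℕ) :
    c (s * n) e = c 0 e + s * blocks s c e n := by
  have : ∃ k, c (s * n) e = c 0 e + s * k := by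
    induction n with
    | zero => exact ⟨0, by simp⟩
    | succ n ih =>
      obtain ⟨k, hk⟩ := ih
      obtain ⟨f, hf1, hf2⟩ := h.exists_edge n
      rw [mul_add, mul_one]
      by_cases hef : e = f
      · subst hef
        exact ⟨k + 1, by rw [hf1 s le_rfl, hk]; ring⟩
      · exact ⟨k, by rw [hf2 e hef s le_rfl, hk]⟩
  obtain ⟨k, hk⟩ := this
  rw [blocks, hk, Nat.add_sub_cancel_left, Nat.mul_div_cancel_left _ hs]

lemma blocks_succ (h : IsBlockwise s c) (hs : 0 < s) (n : ℕ) :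
    ∃ e, (∀ r ≤ s, c (s * n + r) e = c (s * n) e + r) ∧
      (∀ f, f ≠ e → ∀ r ≤ s, c (s * n + r) f = c (s * n) f) ∧
      blocks s c e (n + 1) = blocks s c e n + 1 ∧
      ∀ f, f ≠ e → blocks s c f (n + 1) = blocks s c f n := by
  obtain ⟨e, he1, he2⟩ := h.exists_edge n
  refine ⟨e, he1, he2, ?_, fun f hf => ?_⟩
  · have h1 := he1 s le_rfl
    have h2 := h.count_eq hs e n
    have h3 := h.count_eq hs e (n + 1)
    rw [mul_add, mul_one, h1, h2, add_assoc] at h3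
    have h4 := Nat.add_left_cancel h3
    have h5 : s * (blocks s c e n + 1) = s * blocks s c e (n + 1) := by rw [← h4]; ring
    exact (Nat.eq_of_mul_eq_mul_left hs h5).symm
  · have h1 := he2 f hf s le_rfl
    have h2 := h.count_eq hs f n
    have h3 := h.count_eq hs f (n + 1)
    rw [mul_add, mul_one, h1, h2] at h3
    exact (Nat.eq_of_mul_eq_mul_left hs (Nat.add_left_cancel h3)).symm

lemma blocks_add (h : IsBlockwise s c) (hs : 0 < s) (n : ℕ) :
    blocks s c .green n + blocks s c .red n = n := by
  induction n with
  | zero => simp [blocks]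
  | succ n ih =>
    obtain ⟨e, -, -, h1, h2⟩ := h.blocks_succ hs n
    cases e
    · have := h2 .red (by decide); omega
    · have := h2 .green (by decide); omega

lemma blocks_add_of_ne (h : IsBlockwise s c) (hs : 0 < s) {e f : Edge} (hef : f ≠ e) (n : ℕ) :
    blocks s c e n + blocks s c f n = n := by
  have := h.blocks_add hs n
  cases e <;> cases f <;> first | exact absurd rfl hef | omega

lemma absorbed_of_blocks (h : IsBlockwise s c) (hs : 0 < s) {e : Edge} {N : ℕ}
    (hN : ∀ m, N ≤ m → blocks s c e m = blocks s c e N) : Absorbed c (s * N) := by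
  rw [absorbed_iff]
  refine ⟨e, fun m hm => le_antisymm ?_ (h.monotone hs e hm)⟩
  have h1 : c m e ≤ c (s * m) e := h.monotone hs e (Nat.le_mul_of_pos_left m hs)
  have h2 : N ≤ m := (Nat.le_mul_of_pos_left N hs).trans hm
  rw [h.count_eq hs, hN m h2, ← h.count_eq hs] at h1
  exact h1

/-- Block `N` crosses `e` up to its last step, so the count of `e` is not frozen earlier; block `N +
1` crosses the other edge, so that count is not frozen either. -/
lemma not_absorbed_of_blocks (h : IsBlockwise s c) (hs : 0 < s) {e : Edge} {N : ℕ}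
    (hN : ∀ m, N + 1 ≤ m → blocks s c e m = blocks s c e N + 1) {m : ℕ} (hm : m < s * (N + 1)) :
    ¬ Absorbed c m := by
  rw [absorbed_iff]
  rintro ⟨f, hf⟩
  rw [mul_add, mul_one] at hm
  by_cases hfe : f = e
  · subst hfe
    obtain ⟨e', h1, h2, h3, h4⟩ := h.blocks_succ hs N
    have h5 : f = e' := by
      by_contra h6
      have := h4 f h6
      have := hN (N + 1) le_rfl
      omega
    subst h5
    have h6 := h1 s le_rfl
    have h7 := h1 (s - 1) (Nat.sub_le _ _)
    have h8 := hf (s * N + s) (by omega)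
    have h9 := hf (s * N + (s - 1)) (by omega)
    omega
  · have h1 := h.blocks_add_of_ne hs hfe (N + 1)
    have h2 := h.blocks_add_of_ne hs hfe (N + 2)
    have h3 := hN (N + 1) le_rfl
    have h4 := hN (N + 2) (by omega)
    have h5 := hf (s * (N + 1)) (by rw [mul_add, mul_one]; omega)
    have h6 := hf (s * (N + 2)) (by rw [mul_add]; omega)
    rw [h.count_eq hs] at h5 h6
    rw [← h5] at h6
    have := Nat.eq_of_mul_eq_mul_left hs (Nat.add_left_cancel h6)
    omega

/-- The edge that is frozen from `n + 1` on but not from `n` on is crossed in the step between these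
times. This step must end its block, for otherwise the next step would cross the same edge again. -/
lemma exists_last_block (h : IsBlockwise s c) (hs : 0 < s) {n : ℕ} (hn : Absorbed c (n + 1))
    (hn' : ¬ Absorbed c n) :
    ∃ N, n + 1 = s * (N + 1) ∧ ∃ e, ∀ m, N + 1 ≤ m → blocks s c e m = blocks s c e N + 1 := by
  obtain ⟨f, hf⟩ := absorbed_iff.1 hn
  have h1 : c (n + 1) f ≠ c n f := by
    intro h1
    refine hn' (absorbed_iff.2 ⟨f, fun m hm => ?_⟩)
    rcases Nat.eq_or_lt_of_le hm with h2 | h2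
    · rw [h2]
    · rw [hf m h2, h1]
  have hr := Nat.mod_lt n hs
  have hdm := Nat.div_add_mod n s
  obtain ⟨e, h2, h3, h4, h5⟩ := h.blocks_succ hs (n / s)
  have hfe : f = e := by
    by_contra h6
    have h7 := h3 f h6 (n % s) hr.le
    have h8 := h3 f h6 (n % s + 1) hr
    rw [hdm] at h7
    rw [← add_assoc, hdm] at h8
    omega
  subst hfe
  have hrs : n % s + 1 = s := by
    by_contra h6
    have h7 := h2 (n % s + 1) hr
    have h8 := h2 (n % s + 2) (by omega)
    rw [← add_assoc, hdm] at h7 h8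
    have := hf (n + 2) (by omega)
    omega
  have hn1 : n + 1 = s * (n / s + 1) := by rw [mul_add, mul_one]; omega
  refine ⟨n / s, hn1, f, fun m hm => ?_⟩
  have h6 := hf (s * m) (by rw [hn1]; exact Nat.mul_le_mul_left s hm)
  rw [hn1, h.count_eq hs, h.count_eq hs] at h6
  have := Nat.eq_of_mul_eq_mul_left hs (Nat.add_left_cancel h6)
  omega

end IsBlockwise

variable {V : Type}

lemma attractionTime_eq_iff {t₀ n : ℕ} {ω : ℕ → State V} :
    attractionTime t₀ ω = ((t₀ + n : ℕ) : ℕ∞) ↔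
      Absorbed (fun m => (ω m).count) n ∧ ∀ m < n, ¬ Absorbed (fun m => (ω m).count) m := by
  have hset : attractionTime t₀ ω =
      sInf ((fun m : ℕ => ((t₀ + m : ℕ) : ℕ∞)) '' {m | Absorbed (fun m => (ω m).count) m}) := by
    unfold attractionTime Absorbed
    congr 1
    ext t
    constructor
    · rintro ⟨m, rfl, h⟩; exact ⟨m, h, rfl⟩
    · rintro ⟨m, h, rfl⟩; exact ⟨m, rfl, h⟩
  rw [hset]
  constructor
  · intro h
    have hne : ((fun m : ℕ => ((t₀ + m : ℕ) : ℕ∞)) ''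
        {m | Absorbed (fun m => (ω m).count) m}).Nonempty := by
      by_contra h1
      rw [Set.not_nonempty_iff_eq_empty] at h1
      rw [h1, sInf_empty] at h
      exact ENat.natCast_ne_top _ h.symm
    obtain ⟨m, hm, hm'⟩ := csInf_mem hne
    have hmn : m = n := by
      rw [← hm'] at h
      have h1 : ((t₀ + m : ℕ) : ℕ∞) = ((t₀ + n : ℕ) : ℕ∞) := h
      have h2 : t₀ + m = t₀ + n := by exact_mod_cast h1
      omega
    subst hmn
    refine ⟨hm, fun l hl hl' => ?_⟩
    have h3 := sInf_le (Set.mem_image_of_mem (fun m : ℕ => ((t₀ + m : ℕ) : ℕ∞))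
      (show l ∈ {m | Absorbed (fun m => (ω m).count) m} from hl'))
    rw [h] at h3
    have h4 : t₀ + m ≤ t₀ + l := by exact_mod_cast h3
    omega
  · rintro ⟨h1, h2⟩
    apply le_antisymm
    · exact sInf_le ⟨n, h1, rfl⟩
    · apply le_sInf
      rintro _ ⟨m, hm, rfl⟩
      have : n ≤ m := by
        by_contra h3
        exact h2 m (by omega) hm
      have h4 : t₀ + n ≤ t₀ + m := by omega
      change ((t₀ + n : ℕ) : ℕ∞) ≤ ((t₀ + m : ℕ) : ℕ∞)
      exact_mod_cast h4

lemma le_of_attractionTime_eq {t₀ t : ℕ} {ω : ℕ → State V}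
    (h : attractionTime t₀ ω = (t : ℕ∞)) : t₀ ≤ t := by
  have h1 : (t₀ : ℕ∞) ≤ attractionTime t₀ ω := by
    apply le_sInf
    rintro _ ⟨n, rfl, -⟩
    have : t₀ ≤ t₀ + n := by omega
    exact_mod_cast this
  rw [h] at h1
  exact_mod_cast h1

/-! ### From the walk to an urn. -/

/-- The walk started at `v` crosses edges in blocks of `s` steps, and is at the vertex `pos n`, to
which both edges are incident, at the beginning of the `n`-th block. -/
structure HasStride (across : V → Edge → Option V) (v : V) (s : ℕ) (pos : ℕ → V) : Prop where
  stride_pos : 0 < s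
  exists_incident : ∀ x, ∃ e, (across x e).isSome
  incident : ∀ n e, (across (pos n) e).isSome
  pos_eq : ∀ (a b : ℕ) (ω : ℕ → State V), IsTrajectory across (initial v a b) ω →
    ∀ n, (ω (s * n)).pos = pos n
  isBlockwise : ∀ (a b : ℕ) (ω : ℕ → State V), IsTrajectory across (initial v a b) ω →
    IsBlockwise s fun n => (ω n).count

lemma step_real_green (across : V → Edge → Option V) (w : ℕ → ℝ) (x : State V) :
    (step across w x).real {y | y.count .green = x.count .green + 1} = x.greenProb across w := by
  have hm : MeasurableSet {y : State V | y.count .green = x.count .green + 1} :=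
    MeasurableSet.of_discrete
  change ((x.greenProb across w : ℝ≥0∞) • Measure.dirac (x.traverse across .green) +
      ((1 - x.greenProb across w : ℝ≥0) : ℝ≥0∞) • Measure.dirac (x.traverse across .red)).real _ = _
  rw [Measure.real]
  simp only [Measure.coe_add, Measure.coe_smul, Pi.add_apply, Pi.smul_apply, smul_eq_mul]
  rw [Measure.dirac_apply' _ hm, Measure.dirac_apply' _ hm, Set.indicator_of_mem,
    Set.indicator_of_notMem]
  · simp
  · simp [State.traverse]
  · simp [State.traverse]

/-- The number of green blocks. -/
def greenBlocks (s : ℕ) (n : ℕ) (ω : ℕ → State V) : ℕ := blocks s (fun m => (ω m).count) .green n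

namespace HasStride

variable {across : V → Edge → Option V} {v : V} {s : ℕ} {pos : ℕ → V} {w : ℕ → ℝ} {a b : ℕ}

lemma ae_isTrajectory [Countable V] (h : HasStride across v s pos)
    (hw : ∀ n, 1 ≤ n → 0 < w n) (ha : 1 ≤ a) (hb : 1 ≤ b) :
    ∀ᵐ ω ∂law across w (initial v a b), IsTrajectory across (initial v a b) ω :=
  TwoEdgeWalk.ae_isTrajectory across hw h.exists_incident _ (by rintro (_ | _) <;> assumption)

/-- At the start of a block the number of green blocks determines the whole state, and the first
step of the block decides its colour. The Markov property of the walk is then the drawing rule of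
the urn. -/
lemma isUrn [Countable V] (h : HasStride across v s pos) (hw : ∀ n, 1 ≤ n → 0 < w n)
    (ha : 1 ≤ a) (hb : 1 ≤ b) :
    IsUrn (law across w (initial v a b)) (fun i => w (a + s * i)) (fun j => w (b + s * j))
      (greenBlocks s) where
  measurable n := by
    have h1 : ∀ m, Measurable fun ω : ℕ → State V => (ω m).count .green := fun m =>
      (Measurable.of_discrete (f := fun y : State V => y.count .green)).comp
        (measurable_pi_apply m)
    have h2 : Measurable fun p : ℕ × ℕ => (p.1 - p.2) / s := Measurable.of_discrete
    exact h2.comp ((h1 (s * n)).prodMk (h1 0))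
  zero := by filter_upwards with ω; simp [greenBlocks, blocks]
  succ := by
    filter_upwards [h.ae_isTrajectory hw ha hb] with ω hω n
    obtain ⟨e, -, -, h1, h2⟩ := (h.isBlockwise a b ω hω).blocks_succ h.stride_pos n
    cases e
    · exact Or.inr h1
    · exact Or.inl (h2 .green (by decide))
  draw x m n hmn hx := by
    have hs := h.stride_pos
    have hxn := hx n (Finset.mem_Icc.2 ⟨hmn, le_rfl⟩)
    set z : State V := ⟨pos n, (initial v (a + s * x n) (b + s * (n - x n))).count⟩ with hz
    -- Only the coordinates at times `s * l` with `m ≤ l ≤ n` are constrained; at all other times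
    -- `S` is everything.
    set S : ℕ → Set (State V) := fun L =>
      {y | ∀ l ∈ Finset.Icc m n, s * l = L → (y.count .green - a) / s = x l} with hS
    have key := law_markov across w (initial v a b) S (s * n) z
      {y | y.count .green = z.count .green + 1}
    have hA : ∀ ω, IsTrajectory across (initial v a b) ω →
        (((∀ l ≤ s * n, ω l ∈ S l) ∧ ω (s * n) = z) ↔
          ∀ l ∈ Finset.Icc m n, greenBlocks s l ω = x l) := by
      intro ω hω
      have h0 : ∀ l, greenBlocks s l ω = ((ω (s * l)).count .green - a) / s := by
        intro l; simp only [greenBlocks, blocks, hω.1]; rfl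
      constructor
      · rintro ⟨h1, -⟩ l hl
        rw [h0]
        exact h1 (s * l) (Nat.mul_le_mul_left s (Finset.mem_Icc.1 hl).2) l hl rfl
      · intro h1
        refine ⟨fun L _ l hl hL => ?_, ?_⟩
        · rw [← hL, ← h0]; exact h1 l hl
        · have h2 := h1 n (Finset.mem_Icc.2 ⟨hmn, le_rfl⟩)
          have hB := h.isBlockwise a b ω hω
          have h3 := hB.count_eq hs .green n
          have h4 := hB.count_eq hs .red n
          have h5 := hB.blocks_add hs n
          have h6 := h.pos_eq a b ω hω n
          simp only [hω.1] at h3 h4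
          have h7 : blocks s (fun m => (ω m).count) .green n = x n := h2
          rw [h7] at h3 h5
          rw [show blocks s (fun m => (ω m).count) .red n = n - x n by omega] at h4
          rcases hq : ω (s * n) with ⟨p, q⟩
          rw [hq] at h3 h4 h6
          simp only [hz]
          congr 1
          funext e
          cases e
          · exact h3
          · exact h4
    have e1 : (law across w (initial v a b)).real
        {ω | (∀ l ≤ s * n, ω l ∈ S l) ∧ ω (s * n) = z} =
        (law across w (initial v a b)).real
          {ω | ∀ l ∈ Finset.Icc m n, greenBlocks s l ω = x l} := by
      apply measureReal_congr
      filter_upwards [h.ae_isTrajectory hw ha hb] with ω hω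
      exact propext (hA ω hω)
    have e2 : (law across w (initial v a b)).real
        {ω | ((∀ l ≤ s * n, ω l ∈ S l) ∧ ω (s * n) = z) ∧
          ω (s * n + 1) ∈ {y | y.count .green = z.count .green + 1}} =
        (law across w (initial v a b)).real
          {ω | (∀ l ∈ Finset.Icc m n, greenBlocks s l ω = x l) ∧
            greenBlocks s (n + 1) ω = x n + 1} := by
      apply measureReal_congr
      filter_upwards [h.ae_isTrajectory hw ha hb] with ω hω
      refine propext ?_
      change (((∀ l ≤ s * n, ω l ∈ S l) ∧ ω (s * n) = z) ∧
        (ω (s * n + 1)).count .green = z.count .green + 1) ↔ _ ∧ _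
      rw [← hA ω hω]
      refine and_congr_right fun h1 => ?_
      have h2 : greenBlocks s n ω = x n :=
        (hA ω hω).1 h1 n (Finset.mem_Icc.2 ⟨hmn, le_rfl⟩)
      rw [← h1.2, ← h2]
      obtain ⟨e, h3, h4, h5, h6⟩ := (h.isBlockwise a b ω hω).blocks_succ hs n
      simp only [greenBlocks]
      cases e
      · exact ⟨fun _ => h5, fun _ => h3 1 hs⟩
      · have h7 := h4 .green (by decide) 1 hs
        have h8 := h6 .green (by decide)
        omega
    rw [e1, e2, step_real_green] at key
    rw [key]
    congr 1
    have hp1 := hw (a + s * x n) (by omega)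
    have hp2 := hw (b + s * (n - x n)) (by omega)
    simp only [State.greenProb, State.weight, hz, h.incident, if_true, NNReal.coe_div,
      NNReal.coe_add, initial]
    rw [Real.coe_toNNReal _ hp1.le, Real.coe_toNNReal _ hp2.le]

end HasStride

lemma hasStride_parallel : ∃ pos, HasStride parallelAcross .zero 1 pos := by
  refine ⟨fun n => if n % 2 = 0 then .zero else .one, ⟨one_pos, ?_, ?_, ?_, ?_⟩⟩
  · rintro (_ | _) <;> exact ⟨.green, rfl⟩
  · intro n e
    split_ifs <;> rfl
  · intro a b ω hω n
    rw [one_mul]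
    induction n with
    | zero => rw [hω.1]; rfl
    | succ n ih =>
      obtain ⟨e, -, he⟩ := hω.2 n
      rw [he]
      simp only [State.traverse, ih]
      rcases Nat.mod_two_eq_zero_or_one n with h | h
      · rw [if_pos h, if_neg (by omega)]; rfl
      · rw [if_neg (by omega), if_pos (by omega)]; rfl
  · intro a b ω hω n
    obtain ⟨e, -, he⟩ := hω.2 n
    refine ⟨e, fun r hr => ?_⟩
    rw [one_mul]
    interval_cases r
    · simp
    · simp only [he]; rfl

/-- From either end of the path only the edge just crossed is available, so the crossings of each
edge come in pairs. -/
lemma hasStride_path : ∃ pos, HasStride pathAcross .center 2 pos := by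
  have key : ∀ (a b : ℕ) (ω : ℕ → State PathVertex),
      IsTrajectory pathAcross (initial .center a b) ω → ∀ n, (ω (2 * n)).pos = .center →
      (ω (2 * (n + 1))).pos = .center ∧ ∃ e, ∀ r ≤ 2, (ω (2 * n + r)).count =
        Function.update (ω (2 * n)).count e ((ω (2 * n)).count e + r) := by
    intro a b ω hω n hn
    obtain ⟨e, -, he⟩ := hω.2 (2 * n)
    obtain ⟨f, hf', hf⟩ := hω.2 (2 * n + 1)
    have hfe : f = e ∧ (pathAcross (ω (2 * n + 1)).pos e).getD (ω (2 * n + 1)).pos = .center := by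
      rw [he] at hf' ⊢
      simp only [State.traverse, hn] at hf' ⊢
      cases e <;> cases f <;> simp [pathAcross] at hf' ⊢
    obtain ⟨rfl, h2⟩ := hfe
    refine ⟨?_, f, fun r hr => ?_⟩
    · rw [show 2 * (n + 1) = 2 * n + 1 + 1 by ring, hf]
      exact h2
    · interval_cases r
      · simp
      · rw [he]; rfl
      · rw [show 2 * n + 2 = 2 * n + 1 + 1 by ring, hf, he]
        simp [State.traverse]
  have hpos : ∀ (a b : ℕ) (ω : ℕ → State PathVertex),
      IsTrajectory pathAcross (initial .center a b) ω → ∀ n, (ω (2 * n)).pos = .center := by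
    intro a b ω hω n
    induction n with
    | zero => rw [mul_zero, hω.1]; rfl
    | succ n ih => exact (key a b ω hω n ih).1
  refine ⟨fun _ => .center, ⟨two_pos, ?_, ?_, hpos, fun a b ω hω n =>
    (key a b ω hω n (hpos a b ω hω n)).2⟩⟩
  · rintro (_ | _ | _)
    · exact ⟨.green, rfl⟩
    · exact ⟨.green, rfl⟩
    · exact ⟨.red, rfl⟩
  · rintro n (_ | _) <;> rfl

end TwoEdgeWalk

namespace TwoEdgeWalk

variable {V : Type}

namespace HasStride

variable {across : V → Edge → Option V} {v : V} {s : ℕ} {pos : ℕ → V} {w : ℕ → ℝ} {a b : ℕ}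

/-- A last green draw in round `N` fixes the time of attraction, and different green counts give
disjoint events. The last red draws are dropped: one colour suffices for a lower bound. -/
lemma sum_le_attractionTime [Countable V] (h : HasStride across v s pos)
    (hw : ∀ n, 1 ≤ n → 0 < w n) (ha : 1 ≤ a) (hb : 1 ≤ b) (N : ℕ) :
    ∑ i ∈ Finset.range (N + 1),
        (law across w (initial v a b)).real (IsUrn.lastGreen (greenBlocks s) N i) ≤
      (law across w (initial v a b)).real
        {ω | attractionTime (a + b) ω = ((a + b + s * (N + 1) : ℕ) : ℕ∞)} := by
  have hU := h.isUrn hw ha hb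
  rw [← measureReal_biUnion_finset]
  · unfold Measure.real
    apply ENNReal.toReal_mono (measure_ne_top _ _)
    apply measure_mono_ae
    filter_upwards [h.ae_isTrajectory hw ha hb] with ω hω hω'
    obtain ⟨i, -, hi⟩ := Set.mem_iUnion₂.1 hω'
    have hB := h.isBlockwise a b ω hω
    have h1 : ∀ m, N + 1 ≤ m → greenBlocks s m ω = greenBlocks s N ω + 1 := by
      intro m hm
      rw [hi.2 m hm, hi.1]
    refine attractionTime_eq_iff.2 ⟨?_, fun m hm => hB.not_absorbed_of_blocks h.stride_pos h1 hm⟩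
    refine hB.absorbed_of_blocks h.stride_pos (e := .green) fun m hm => ?_
    exact (h1 m hm).trans (h1 (N + 1) le_rfl).symm
  · intro i _ j _ hij
    rw [Function.onFun, Set.disjoint_left]
    rintro ω ⟨h1, -⟩ ⟨h2, -⟩
    exact hij (h1.symm.trans h2)
  · intro i _
    have : IsUrn.lastGreen (greenBlocks s) N i =
        greenBlocks (V := V) s N ⁻¹' {i} ∩ ⋂ m, ⋂ (_ : N + 1 ≤ m), greenBlocks s m ⁻¹' {i + 1} := by
      ext ω; simp [IsUrn.lastGreen]
    rw [this]
    exact (hU.measurable N (measurableSet_singleton _)).inter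
      (MeasurableSet.iInter fun m => MeasurableSet.iInter fun _ =>
        hU.measurable m (measurableSet_singleton _))

/-- The block that ends at the time of attraction is the last one of its colour; both colours have
to be counted. -/
lemma attractionTime_le_sum [Countable V] (h : HasStride across v s pos)
    (hw : ∀ n, 1 ≤ n → 0 < w n) (ha : 1 ≤ a) (hb : 1 ≤ b) (N : ℕ) :
    (law across w (initial v a b)).real
        {ω | attractionTime (a + b) ω = ((a + b + s * (N + 1) : ℕ) : ℕ∞)} ≤
    ∑ i ∈ Finset.range (N + 1),
        (law across w (initial v a b)).real (IsUrn.lastGreen (greenBlocks s) N i) +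
      ∑ i ∈ Finset.range (N + 1), (law across w (initial v a b)).real
        (IsUrn.lastGreen (fun n ω => n - greenBlocks s n ω) N i) := by
  refine le_trans ?_ (add_le_add (measureReal_biUnion_finset_le _ _)
    (measureReal_biUnion_finset_le _ _))
  refine le_trans ?_ (measureReal_union_le _ _)
  unfold Measure.real
  apply ENNReal.toReal_mono (measure_ne_top _ _)
  apply measure_mono_ae
  filter_upwards [h.ae_isTrajectory hw ha hb] with ω hω hω'
  have hB := h.isBlockwise a b ω hω
  have hs := h.stride_pos
  obtain ⟨h1, h2⟩ := attractionTime_eq_iff.1 hω'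
  obtain ⟨n, hn⟩ : ∃ n, s * (N + 1) = n + 1 :=
    ⟨s * (N + 1) - 1, (Nat.succ_pred_eq_of_pos (Nat.mul_pos hs (Nat.succ_pos N))).symm⟩
  rw [hn] at h1 h2
  obtain ⟨N', hN', e, he⟩ := hB.exists_last_block hs h1 (h2 n (by omega))
  have hNN : N' = N := by
    rw [← hn] at hN'
    have := Nat.eq_of_mul_eq_mul_left hs hN'
    omega
  subst hNN
  have h3 := hB.blocks_add hs
  cases e
  · left
    refine Set.mem_iUnion₂.2 ⟨greenBlocks s N' ω, ?_, rfl, he⟩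
    have := h3 N'
    simp only [Finset.mem_range, greenBlocks]
    omega
  · right
    refine Set.mem_iUnion₂.2 ⟨N' - greenBlocks s N' ω, ?_, rfl, fun m hm => ?_⟩
    · simp only [Finset.mem_range]; omega
    · have h4 := h3 m
      have h5 := h3 N'
      have h6 := he m hm
      simp only [greenBlocks]
      omega

lemma no_green_le_attractionTime [Countable V] (h : HasStride across v s pos)
    (hw : ∀ n, 1 ≤ n → 0 < w n) (ha : 1 ≤ a) (hb : 1 ≤ b) :
    (law across w (initial v a b)).real {ω | ∀ l, greenBlocks s l ω = 0} ≤
      (law across w (initial v a b)).real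
        {ω | attractionTime (a + b) ω = ((a + b : ℕ) : ℕ∞)} := by
  unfold Measure.real
  apply ENNReal.toReal_mono (measure_ne_top _ _)
  apply measure_mono_ae
  filter_upwards [h.ae_isTrajectory hw ha hb] with ω hω hω'
  have h1 := (h.isBlockwise a b ω hω).absorbed_of_blocks h.stride_pos (e := .green) (N := 0)
    fun m _ => (hω' m).trans (hω' 0).symm
  refine (attractionTime_eq_iff (n := 0)).2 ⟨h1, fun m hm => absurd hm (Nat.not_lt_zero m)⟩

lemma attractionTime_eq_zero [Countable V] (h : HasStride across v s pos)
    (hw : ∀ n, 1 ≤ n → 0 < w n) (ha : 1 ≤ a) (hb : 1 ≤ b) {t : ℕ} (ht : t ≠ a + b)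
    (ht' : ∀ N, t ≠ a + b + s * (N + 1)) :
    (law across w (initial v a b)).real {ω | attractionTime (a + b) ω = (t : ℕ∞)} = 0 := by
  rw [measureReal_eq_zero_iff, measure_eq_zero_iff_ae_notMem]
  filter_upwards [h.ae_isTrajectory hw ha hb] with ω hω hω'
  have h0 := le_of_attractionTime_eq hω'
  obtain ⟨n, rfl⟩ : ∃ n, t = a + b + (n + 1) := ⟨t - (a + b) - 1, by omega⟩
  obtain ⟨h1, h2⟩ := attractionTime_eq_iff.1 hω'
  obtain ⟨N, hN, -⟩ := (h.isBlockwise a b ω hω).exists_last_block h.stride_pos h1 (h2 n (by omega))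
  exact ht' N (by rw [hN])

end HasStride

/-- The number of steps between two visits to the initial position. -/
def Graph.stride : Graph → ℕ
  | .parallel => 1
  | .path => 2

lemma Graph.stride_pos (g : Graph) : 0 < g.stride := by cases g <;> decide

instance : Countable ParallelVertex := by
  have : Function.Injective fun x : ParallelVertex => match x with
    | .zero => 0
    | .one => 1 := by rintro (_ | _) (_ | _) h <;> simp_all
  exact this.countable

instance : Countable PathVertex := by
  have : Function.Injective fun x : PathVertex => match x with
    | .left => 0
    | .center => 1
    | .right => 2 := by rintro (_ | _ | _) (_ | _ | _) h <;> simp_all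
  exact this.countable

/-- The law of the time of attraction in terms of an urn. -/
structure Graph.UrnRepresentation (g : Graph) (w : ℕ → ℝ) (a b : ℕ) {Ω : Type}
    [MeasurableSpace Ω] (μ : Measure Ω) (G : ℕ → Ω → ℕ) : Prop where
  isProbabilityMeasure : IsProbabilityMeasure μ
  isUrn : IsUrn μ (fun i => w (a + g.stride * i)) (fun j => w (b + g.stride * j)) G
  sum_le : ∀ N, ∑ i ∈ Finset.range (N + 1), μ.real (IsUrn.lastGreen G N i) ≤
    g.prob w a b (a + b + g.stride * (N + 1))
  le_sum : ∀ N, g.prob w a b (a + b + g.stride * (N + 1)) ≤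
    ∑ i ∈ Finset.range (N + 1), μ.real (IsUrn.lastGreen G N i) +
      ∑ i ∈ Finset.range (N + 1), μ.real (IsUrn.lastGreen (fun n ω => n - G n ω) N i)
  no_green_le : μ.real {ω | ∀ l, G l ω = 0} ≤ g.prob w a b (a + b)
  eq_zero : ∀ t, t ≠ a + b → (∀ N, t ≠ a + b + g.stride * (N + 1)) → g.prob w a b t = 0

lemma Graph.exists_urnRepresentation (g : Graph) {w : ℕ → ℝ} {a b : ℕ}
    (hw : ∀ n, 1 ≤ n → 0 < w n) (ha : 1 ≤ a) (hb : 1 ≤ b) :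
    ∃ (Ω : Type) (_ : MeasurableSpace Ω) (μ : Measure Ω) (G : ℕ → Ω → ℕ),
      g.UrnRepresentation w a b μ G := by
  cases g
  · obtain ⟨pos, h⟩ := hasStride_parallel
    exact ⟨_, _, law parallelAcross w (initial .zero a b), greenBlocks 1,
      ⟨inferInstance, h.isUrn hw ha hb, h.sum_le_attractionTime hw ha hb,
        h.attractionTime_le_sum hw ha hb, h.no_green_le_attractionTime hw ha hb,
        fun t => h.attractionTime_eq_zero hw ha hb⟩⟩
  · obtain ⟨pos, h⟩ := hasStride_path
    exact ⟨_, _, law pathAcross w (initial .center a b), greenBlocks 2,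
      ⟨inferInstance, h.isUrn hw ha hb, h.sum_le_attractionTime hw ha hb,
        h.attractionTime_le_sum hw ha hb, h.no_green_le_attractionTime hw ha hb,
        fun t => h.attractionTime_eq_zero hw ha hb⟩⟩

lemma Graph.possible_iff (g : Graph) {a b t : ℕ} :
    g.Possible a b t ↔ t = a + b ∨ ∃ N, t = a + b + g.stride * (N + 1) := by
  cases g
  · simp only [Graph.Possible, Graph.stride, one_mul, reduceCtorEq, false_imp_iff, and_true]
    constructor
    · intro h
      by_cases h1 : t = a + b
      · exact Or.inl h1
      · exact Or.inr ⟨t - (a + b) - 1, by omega⟩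
    · rintro (h | ⟨N, h⟩) <;> omega
  · simp only [Graph.Possible, Graph.stride, true_imp_iff]
    constructor
    · rintro ⟨h, h'⟩
      by_cases h1 : t = a + b
      · exact Or.inl h1
      · exact Or.inr ⟨(t - (a + b)) / 2 - 1, by omega⟩
    · rintro (h | ⟨N, h⟩) <;> omega

end TwoEdgeWalk

/-! ### Strong weights and bounds for the last green draw. -/

/-- `∑_{l ≥ n} 1 / w l`. -/
noncomputable def tailSum (w : ℕ → ℝ) (n : ℕ) : ℝ := ∑' l, 1 / w (n + l)

/-- A positive strongly reinforcing weight that is nondecreasing from `2` on and whose successive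
ratios are at most `D`. -/
structure IsStrongWeight (w : ℕ → ℝ) (D : ℝ) : Prop where
  pos : ∀ n, 1 ≤ n → 0 < w n
  -- Monotonicity starts at `2` because the weight at `1` may be arbitrary.
  mono : ∀ n, 2 ≤ n → w n ≤ w (n + 1)
  ratio : ∀ n, 1 ≤ n → w (n + 1) ≤ D * w n
  summable : Summable fun n => 1 / w n

namespace IsStrongWeight

variable {w : ℕ → ℝ} {D : ℝ}

lemma mono_le (h : IsStrongWeight w D) {m n : ℕ} (hm : 2 ≤ m) (hmn : m ≤ n) : w m ≤ w n := by
  induction n, hmn using Nat.le_induction with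
  | base => exact le_rfl
  | succ n hn ih => exact ih.trans (h.mono n (by omega))

lemma one_le (h : IsStrongWeight w D) : 1 ≤ D := by
  have h1 := h.pos 2 (by norm_num)
  have h2 := h.mono 2 le_rfl
  have h3 := h.ratio 2 (by norm_num)
  by_contra hD
  have : D * w 2 < 1 * w 2 := mul_lt_mul_of_pos_right (not_le.1 hD) h1
  linarith

lemma ratio_add (h : IsStrongWeight w D) {n : ℕ} (hn : 1 ≤ n) (d : ℕ) :
    w (n + d) ≤ D ^ d * w n := by
  have hD := h.one_le
  induction d with
  | zero => simp
  | succ d ih =>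
    calc w (n + (d + 1)) ≤ D * w (n + d) := h.ratio (n + d) (by omega)
      _ ≤ D * (D ^ d * w n) := by gcongr
      _ = D ^ (d + 1) * w n := by ring

lemma summable_add (h : IsStrongWeight w D) (n : ℕ) : Summable fun l => 1 / w (n + l) := by
  simpa only [add_comm] using (summable_nat_add_iff n).2 h.summable

lemma summable_stride (h : IsStrongWeight w D) {s : ℕ} (hs : 0 < s) (n : ℕ) :
    Summable fun l => 1 / w (n + s * l) :=
  (h.summable_add n).comp_injective
    (i := fun l => s * l) fun _ _ h => Nat.eq_of_mul_eq_mul_left hs h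

lemma tailSum_nonneg (h : IsStrongWeight w D) {n : ℕ} (hn : 1 ≤ n) : 0 ≤ tailSum w n :=
  tsum_nonneg fun l => by have := h.pos (n + l) (by omega); positivity

lemma tailSum_stride_le (h : IsStrongWeight w D) {s n : ℕ} (hs : 0 < s) (hn : 1 ≤ n) :
    ∑' l, 1 / w (n + s * l) ≤ tailSum w n :=
  tsum_comp_le_tsum_of_inj (h.summable_add n)
    (fun l => by have := h.pos (n + l) (by omega); positivity)
    (i := fun l => s * l) fun _ _ h => Nat.eq_of_mul_eq_mul_left hs h

/-- By monotonicity, `s` consecutive terms `1 / w` sum to at most `s` times the first of them. -/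
lemma le_tailSum_stride (h : IsStrongWeight w D) {s n : ℕ} (hs : 0 < s) (hn : 2 ≤ n) :
    tailSum w n ≤ s * ∑' l, 1 / w (n + s * l) := by
  have hpos : ∀ l, 0 < w (n + l) := fun l => h.pos _ (by omega)
  apply Real.tsum_le_of_sum_range_le (fun l => by have := hpos l; positivity)
  intro M
  have h1 : ∀ M, ∑ l ∈ Finset.range (s * M), 1 / w (n + l) ≤
      s * ∑ l ∈ Finset.range M, 1 / w (n + s * l) := by
    intro M
    induction M with
    | zero => simp
    | succ M ih =>
      rw [mul_add, mul_one, Finset.sum_range_add, Finset.sum_range_succ _ M, mul_add]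
      apply add_le_add ih
      have : ∀ x ∈ Finset.range s, 1 / w (n + (s * M + x)) ≤ 1 / w (n + s * M) := by
        intro x _
        exact one_div_le_one_div_of_le (hpos _) (h.mono_le (by omega) (by omega))
      have := Finset.sum_le_card_nsmul _ _ _ this
      simpa using this
  calc ∑ l ∈ Finset.range M, 1 / w (n + l)
      ≤ ∑ l ∈ Finset.range (s * M), 1 / w (n + l) := by
        apply Finset.sum_le_sum_of_subset_of_nonneg
        · intro l hl
          rw [Finset.mem_range] at hl ⊢
          exact hl.trans_le (Nat.le_mul_of_pos_left M hs)
        · intro l _ _; have := hpos l; positivity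
    _ ≤ s * ∑ l ∈ Finset.range M, 1 / w (n + s * l) := h1 M
    _ ≤ s * ∑' l, 1 / w (n + s * l) := by
        apply mul_le_mul_of_nonneg_left _ (Nat.cast_nonneg s)
        exact (h.summable_stride hs n).sum_le_tsum _
          fun l _ => by have := hpos (s * l); positivity

lemma tailSum_anti (h : IsStrongWeight w D) {m n : ℕ} (hm : 1 ≤ m) (hmn : m ≤ n) :
    tailSum w n ≤ tailSum w m := by
  obtain ⟨d, rfl⟩ := Nat.exists_eq_add_of_le hmn
  have := tsum_comp_le_tsum_of_inj (h.summable_add m)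
    (fun l => by have := h.pos (m + l) (by omega); positivity)
    (i := fun l => d + l) fun _ _ h => Nat.add_left_cancel h
  simpa only [tailSum, Function.comp_def, add_assoc] using this

end IsStrongWeight

lemma sum_pow_half_le (F : Finset ℕ) (q : ℕ → ℕ) (hq : Set.InjOn q F) :
    ∑ i ∈ F, (1 / 2 : ℝ) ^ q i ≤ 2 := by
  rw [← Finset.sum_image (f := fun n => (1 / 2 : ℝ) ^ n) hq]
  calc _ ≤ ∑' n, (1 / 2 : ℝ) ^ n := summable_geometric_two.sum_le_tsum _ fun _ _ => by positivity
    _ = 2 := tsum_geometric_two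

namespace IsStrongWeight

variable {w : ℕ → ℝ} {D : ℝ} {Ω : Type*} [MeasurableSpace Ω] {μ : Measure Ω}
  [IsProbabilityMeasure μ] {G : ℕ → Ω → ℕ} {a b s : ℕ}

lemma exists_density_bounds (h : IsStrongWeight w D) (ha : 1 ≤ a) (hb : 1 ≤ b) (hs : 0 < s)
    (hU : IsUrn μ (fun i => w (a + s * i)) (fun j => w (b + s * j)) G) :
    ∃ c > 0, ∃ C > 0, ∀ i j,
      c ≤ IsUrn.density μ (fun i => w (a + s * i)) (fun j => w (b + s * j)) G i j ∧
      IsUrn.density μ (fun i => w (a + s * i)) (fun j => w (b + s * j)) G i j ≤ C :=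
  hU.exists_density_bounds (fun _ => h.pos _ (by omega)) (fun _ => h.pos _ (by omega))
    (h.summable_stride hs a) (h.summable_stride hs b)

/-- Lower bound for the probability that the last green draw occurs at a given time. -/
lemma exists_le_sum_lastGreen (h : IsStrongWeight w D) (ha : 1 ≤ a) (hb : 1 ≤ b) (hs : 0 < s)
    (hU : IsUrn μ (fun i => w (a + s * i)) (fun j => w (b + s * j)) G) :
    ∃ c > 0, ∀ N, c * ∑ i ∈ Finset.range (N + 1), 1 / w (b + s * (N - i)) *
        Real.exp (-(w (a + s * (i + 1)) * tailSum w (b + s * (N - i)))) ≤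
      ∑ i ∈ Finset.range (N + 1), μ.real (IsUrn.lastGreen G N i) := by
  obtain ⟨c, hc, C, -, hcC⟩ := h.exists_density_bounds ha hb hs hU
  refine ⟨c, hc, fun N => ?_⟩
  rw [Finset.mul_sum]
  apply Finset.sum_le_sum
  intro i hi
  rw [Finset.mem_range] at hi
  obtain ⟨j, rfl⟩ : ∃ j, N = i + j := ⟨N - i, by omega⟩
  rw [Nat.add_sub_cancel_left]
  have h1 := hU.le_prob_lastGreen (fun _ => h.pos _ (by omega)) (fun _ => h.pos _ (by omega))
    (h.summable_stride hs b) i j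
  refine le_trans ?_ h1
  have h2 := h.pos (b + s * j) (by omega)
  have h3 := h.pos (a + s * (i + 1)) (by omega)
  have h4 : ∑' l, 1 / w (b + s * (j + l)) ≤ tailSum w (b + s * j) := by
    have := h.tailSum_stride_le hs (show 1 ≤ b + s * j by omega)
    simpa only [mul_add, add_assoc] using this
  rw [← mul_assoc, mul_one_div]
  exact mul_le_mul ((div_le_div_iff_of_pos_right h2).2 (hcC i j).1)
    (Real.exp_le_exp.2 (neg_le_neg (mul_le_mul_of_nonneg_left h4 h3.le))) (Real.exp_pos _).le
    (div_nonneg (hc.le.trans (hcC i j).1) h2.le)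

/-- If at the last green draw the green count is much above the red one, the probability is
exponentially small. -/
lemma prob_lastGreen_le_pow (h : IsStrongWeight w D) (ha : 1 ≤ a) (hb : 1 ≤ b) (hs : 0 < s)
    (hU : IsUrn μ (fun i => w (a + s * i)) (fun j => w (b + s * j)) G) {C : ℝ} {i j : ℕ}
    (hC : IsUrn.density μ (fun i => w (a + s * i)) (fun j => w (b + s * j)) G i j ≤ C)
    (hij : j + b ≤ i) :
    μ.real (IsUrn.lastGreen G (i + j) i) ≤
      C / w (a + s * (i + 1)) * (1 / 2) ^ (i + 1 - b - j) := by
  have hu : ∀ n, 0 < w (a + s * n) := fun n => h.pos _ (by omega)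
  have hv : ∀ n, 0 < w (b + s * n) := fun n => h.pos _ (by omega)
  -- So many red draws are kept that the red weight does not yet exceed the green one: each factor
  -- but the first is then at most `1 / 2`. The first factor serves to replace `1 / w (b + s * j)`
  -- by `1 / w (a + s * (i + 1))`.
  refine (hU.prob_lastGreen_le hu hv i j (i + 1 - b - j + 1)).trans ?_
  have hx := hu (i + 1)
  have hj := hv j
  rw [Finset.prod_range_succ']
  set p : ℕ → ℝ := fun l => w (b + s * (j + l)) / (w (a + s * (i + 1)) + w (b + s * (j + l)))
  have hp : ∀ l ∈ Finset.range (i + 1 - b - j), p (l + 1) ≤ 1 / 2 := by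
    intro l hl
    rw [Finset.mem_range] at hl
    have h1 := hv (j + (l + 1))
    have h2 : w (b + s * (j + (l + 1))) ≤ w (a + s * (i + 1)) := by
      apply h.mono_le
      · have := Nat.mul_pos hs (show 0 < j + (l + 1) by omega); omega
      · have h3 : j + (l + 1) ≤ i + 1 - b := by omega
        have h4 := Nat.mul_le_mul_left s h3
        have h5 : s * (i + 1 - b) + s * b = s * (i + 1) := by
          rw [← mul_add, Nat.sub_add_cancel (by omega)]
        have h6 := Nat.le_mul_of_pos_left b hs
        omega
    simp only [p]
    rw [div_le_div_iff₀ (by positivity) (by norm_num)]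
    linarith
  have hp0 : ∀ l, 0 ≤ p l := fun l => by
    have := hv (j + l); simp only [p]; positivity
  have h1 : ∏ l ∈ Finset.range (i + 1 - b - j), p (l + 1) ≤ (1 / 2) ^ (i + 1 - b - j) := by
    have := Finset.prod_le_prod (fun l _ => hp0 (l + 1)) hp
    simpa using this
  have h2 : C / w (b + s * j) * p 0 ≤ C / w (a + s * (i + 1)) := by
    have hC0 : 0 ≤ C := le_trans (by unfold IsUrn.density; have := hu i; positivity) hC
    simp only [p, add_zero]
    rw [div_mul_div_comm, div_le_div_iff₀ (by positivity) hx]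
    have : 0 ≤ C * w (b + s * j) * w (b + s * j) := by positivity
    nlinarith
  calc _ ≤ C / w (b + s * j) * ((∏ l ∈ Finset.range (i + 1 - b - j), p (l + 1)) * p 0) := by
        apply mul_le_mul_of_nonneg_right
        · gcongr
        · exact mul_nonneg (Finset.prod_nonneg fun l _ => hp0 _) (hp0 _)
    _ = C / w (b + s * j) * p 0 * ∏ l ∈ Finset.range (i + 1 - b - j), p (l + 1) := by ring
    _ ≤ _ := by
        apply mul_le_mul h2 h1 (Finset.prod_nonneg fun l _ => hp0 _)
        have hC0 : 0 ≤ C := le_trans (by unfold IsUrn.density; have := hu i; positivity) hC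
        positivity

/-- If at the last green draw the green count is not much above the red one, the red weights
control the probability. -/
lemma prob_lastGreen_le_exp (h : IsStrongWeight w D) (ha : 1 ≤ a) (hb : 1 ≤ b) (hs : 0 < s)
    (hU : IsUrn μ (fun i => w (a + s * i)) (fun j => w (b + s * j)) G) {C : ℝ} {i j : ℕ}
    (hC : IsUrn.density μ (fun i => w (a + s * i)) (fun j => w (b + s * j)) G i j ≤ C)
    (hij : i < j + b) (hj : 1 ≤ j) :
    μ.real (IsUrn.lastGreen G (i + j) i) ≤
      C * (1 / w (b + s * j) * Real.exp (-(1 / ((1 + D ^ (a + s * b)) * s) *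
        (w (a + s * (i + 1)) * tailSum w (b + s * j))))) := by
  have hu : ∀ n, 0 < w (a + s * n) := fun n => h.pos _ (by omega)
  have hv : ∀ n, 0 < w (b + s * n) := fun n => h.pos _ (by omega)
  have hs1 : 1 ≤ s * j := Nat.mul_pos hs hj
  have hx := hu (i + 1)
  have hD := h.one_le
  -- The green count exceeds the red one by at most `a + s * b` here, so `B` bounds the quotient of
  -- the weights. Then `x / (x + v) ≥ x / ((1 + B) * v)`, which turns each factor into an
  -- exponential.
  set B := D ^ (a + s * b) with hB
  have hB1 : 1 ≤ B := one_le_pow₀ hD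
  have hxB : ∀ l, w (a + s * (i + 1)) ≤ B * w (b + s * (j + l)) := by
    intro l
    have h1 : w (b + s * j) ≤ w (b + s * (j + l)) :=
      h.mono_le (by omega) (by rw [mul_add]; omega)
    have h2 : w (a + s * (i + 1)) ≤ B * w (b + s * j) := by
      have h3 := h.ratio_add (show 1 ≤ b + s * j by omega) (a + s * b)
      refine le_trans (h.mono_le ?_ ?_) h3
      · have := Nat.mul_pos hs (show 0 < i + 1 by omega); omega
      · have h4 := Nat.mul_le_mul_left s (show i + 1 ≤ j + b by omega)
        rw [mul_add s j b] at h4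
        omega
    exact h2.trans (mul_le_mul_of_nonneg_left h1 (by linarith))
  have hC0 : 0 ≤ C := le_trans (by
    unfold IsUrn.density; have := hu i; have := hv j; positivity) hC
  have hfac : ∀ l, w (b + s * (j + l)) / (w (a + s * (i + 1)) + w (b + s * (j + l))) ≤
      Real.exp (-(w (a + s * (i + 1)) / (1 + B) * (1 / w (b + s * (j + l))))) := by
    intro l
    have hvl := hv (j + l)
    have h1 := Real.add_one_le_exp (-(w (a + s * (i + 1)) / (1 + B) * (1 / w (b + s * (j + l)))))
    refine le_trans ?_ h1
    have h2 : w (a + s * (i + 1)) / (1 + B) * (1 / w (b + s * (j + l))) ≤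
        w (a + s * (i + 1)) / (w (a + s * (i + 1)) + w (b + s * (j + l))) := by
      rw [div_mul_div_comm, mul_one]
      gcongr
      have := hxB l
      linarith
    have h3 : w (b + s * (j + l)) / (w (a + s * (i + 1)) + w (b + s * (j + l))) =
        1 - w (a + s * (i + 1)) / (w (a + s * (i + 1)) + w (b + s * (j + l))) := by
      field_simp; ring
    linarith
  have hsum : Summable fun l => 1 / w (b + s * (j + l)) := by
    have := h.summable_stride hs (b + s * j)
    simpa only [mul_add, add_assoc] using this
  have hM : ∀ M, μ.real (IsUrn.lastGreen G (i + j) i) ≤ C / w (b + s * j) *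
      Real.exp (-(w (a + s * (i + 1)) / (1 + B) *
        ∑ l ∈ Finset.range M, 1 / w (b + s * (j + l)))) := by
    intro M
    refine (hU.prob_lastGreen_le hu hv i j M).trans ?_
    have hvj := hv j
    rw [Finset.mul_sum, ← Finset.sum_neg_distrib, Real.exp_sum]
    apply mul_le_mul
    · gcongr
    · apply Finset.prod_le_prod
      · intro l _; have := hv (j + l); positivity
      · intro l _; exact hfac l
    · apply Finset.prod_nonneg
      intro l _; have := hv (j + l); positivity
    · positivity
  -- The bound holds for every `M`, hence for the full series.
  have hlim := ge_of_tendsto' (b := μ.real (IsUrn.lastGreen G (i + j) i))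
    (((((Real.continuous_exp.tendsto _).comp
      ((hsum.hasSum.tendsto_sum_nat.const_mul (w (a + s * (i + 1)) / (1 + B))).neg)).const_mul
        (C / w (b + s * j))))) hM
  refine hlim.trans ?_
  rw [← mul_assoc, mul_one_div]
  have hvj := hv j
  gcongr C / w (b + s * j) * Real.exp (-?_)
  have h1 := h.le_tailSum_stride hs (show 2 ≤ b + s * j by omega)
  have h2 : ∑' l, 1 / w (b + s * j + s * l) = ∑' l, 1 / w (b + s * (j + l)) := by
    simp only [mul_add, add_assoc]
  rw [h2] at h1
  have hs' : (0 : ℝ) < s := by exact_mod_cast hs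
  calc 1 / ((1 + B) * s) * (w (a + s * (i + 1)) * tailSum w (b + s * j))
      ≤ 1 / ((1 + B) * s) * (w (a + s * (i + 1)) * (s * ∑' l, 1 / w (b + s * (j + l)))) := by
        gcongr
    _ = _ := by field_simp

/-- Upper bound for the probability that the last green draw occurs at a given time. -/
lemma exists_sum_lastGreen_le (h : IsStrongWeight w D) (ha : 1 ≤ a) (hb : 1 ≤ b) (hs : 0 < s)
    (hU : IsUrn μ (fun i => w (a + s * i)) (fun j => w (b + s * j)) G) :
    ∃ C > 0, ∃ c > 0, ∃ c₀ : ℕ, ∀ N k, c₀ ≤ k → k + 1 = a + b + s * (N + 1) →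
      ∑ i ∈ Finset.range (N + 1), μ.real (IsUrn.lastGreen G N i) ≤
        C * (1 / w ((k + 2) / 2) + ∑ I ∈ Finset.Icc 2 ((k + 1 + c₀) / 2),
          1 / w (k + 1 - I) * Real.exp (-(c * (w I * tailSum w (k + 1 - I))))) := by
  obtain ⟨c, -, C, hC0, hC⟩ := h.exists_density_bounds ha hb hs hU
  have hD := h.one_le
  have hs' : (0 : ℝ) < s := by exact_mod_cast hs
  refine ⟨2 * C, by positivity, 1 / ((1 + D ^ (a + s * b)) * s), by positivity,
    a + 2 * b + 2 * (s * b) + s + 8, fun N k hk hkN => ?_⟩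
  -- If green leads by at least `b` draws, the probabilities decay geometrically and sum to a
  -- multiple of `1 / w ((k + 2) / 2)`. The other states are reindexed by the final green count `I =
  -- a + s * (i + 1)`, which leaves `k + 1 - I` as the final red count.
  rw [← Finset.sum_filter_add_sum_filter_not (Finset.range (N + 1)) (fun i => N - i + b ≤ i)]
  rw [mul_add]
  have hw2 : ∀ n, 1 ≤ n → 0 < 1 / w n := fun n hn => by have := h.pos n hn; positivity
  apply add_le_add
  · have h1 : ∀ i ∈ (Finset.range (N + 1)).filter (fun i => N - i + b ≤ i),
        μ.real (IsUrn.lastGreen G N i) ≤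
          C * (1 / w ((k + 2) / 2)) * (1 / 2) ^ (i + 1 - b - (N - i)) := by
      intro i hi
      rw [Finset.mem_filter, Finset.mem_range] at hi
      obtain ⟨j, rfl⟩ : ∃ j, N = i + j := ⟨N - i, by omega⟩
      rw [Nat.add_sub_cancel_left] at hi ⊢
      refine (h.prob_lastGreen_le_pow ha hb hs hU (hC i j).2 hi.2).trans ?_
      have h2 : w ((k + 2) / 2) ≤ w (a + s * (i + 1)) := by
        apply h.mono_le (by omega)
        have h3 := Nat.mul_le_mul_left s hi.2
        have h4 : s * (i + j + 1) = s * i + s * j + s := by ring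
        have h5 : s * (i + 1) = s * i + s := by ring
        have h6 : s * (j + b) = s * j + s * b := by ring
        have h7 := Nat.le_mul_of_pos_left b hs
        omega
      have h3 := h.pos ((k + 2) / 2) (by omega)
      rw [mul_one_div]
      gcongr
    refine (Finset.sum_le_sum h1).trans ?_
    rw [← Finset.mul_sum]
    have h2 := sum_pow_half_le ((Finset.range (N + 1)).filter (fun i => N - i + b ≤ i))
      (fun i => i + 1 - b - (N - i)) (by
        intro i hi j hj hij
        simp only [Finset.coe_filter, Finset.mem_range, Set.mem_ofPred_eq] at hi hj hij
        omega)
    have h3 := hw2 ((k + 2) / 2) (by omega)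
    calc _ ≤ C * (1 / w ((k + 2) / 2)) * 2 := by gcongr
      _ = _ := by ring
  · have hterm : ∀ I ∈ Finset.Icc 2 ((k + 1 + (a + 2 * b + 2 * (s * b) + s + 8)) / 2),
        0 ≤ 1 / w (k + 1 - I) * Real.exp (-(1 / ((1 + D ^ (a + s * b)) * s) *
          (w I * tailSum w (k + 1 - I)))) := by
      intro I hI
      rw [Finset.mem_Icc] at hI
      have := hw2 (k + 1 - I) (by omega)
      positivity
    have h1 : ∀ i ∈ (Finset.range (N + 1)).filter (fun i => ¬ N - i + b ≤ i),
        μ.real (IsUrn.lastGreen G N i) ≤ C * (1 / w (k + 1 - (a + s * (i + 1))) *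
          Real.exp (-(1 / ((1 + D ^ (a + s * b)) * s) *
          (w (a + s * (i + 1)) * tailSum w (k + 1 - (a + s * (i + 1))))))) := by
      intro i hi
      rw [Finset.mem_filter, Finset.mem_range] at hi
      obtain ⟨j, rfl⟩ : ∃ j, N = i + j := ⟨N - i, by omega⟩
      rw [Nat.add_sub_cancel_left] at hi
      have h4 : s * (i + j + 1) = s * i + s * j + s := by ring
      have h5 : s * (i + 1) = s * i + s := by ring
      have hj : 1 ≤ j := by
        by_contra hj
        have hj0 : j = 0 := by omega
        subst hj0
        have := Nat.mul_le_mul_left s (show i + 1 ≤ b by omega)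
        rw [mul_zero] at h4
        omega
      have h6 : k + 1 - (a + s * (i + 1)) = b + s * j := by omega
      rw [h6]
      exact h.prob_lastGreen_le_exp ha hb hs hU (hC i j).2 (by omega) hj
    refine (Finset.sum_le_sum h1).trans ?_
    rw [← Finset.mul_sum]
    have h2 : Set.InjOn (fun i => a + s * (i + 1))
        ((Finset.range (N + 1)).filter (fun i => ¬ N - i + b ≤ i)) := by
      intro i _ j _ hij
      have := Nat.eq_of_mul_eq_mul_left hs (Nat.add_left_cancel hij)
      omega
    rw [← Finset.sum_image (g := fun i => a + s * (i + 1)) (f := fun I => 1 / w (k + 1 - I) *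
      Real.exp (-(1 / ((1 + D ^ (a + s * b)) * s) * (w I * tailSum w (k + 1 - I))))) h2]
    have h3 : C * ∑ I ∈ Finset.image (fun i => a + s * (i + 1))
        ((Finset.range (N + 1)).filter (fun i => ¬ N - i + b ≤ i)), 1 / w (k + 1 - I) *
          Real.exp (-(1 / ((1 + D ^ (a + s * b)) * s) * (w I * tailSum w (k + 1 - I)))) ≤
        C * ∑ I ∈ Finset.Icc 2 ((k + 1 + (a + 2 * b + 2 * (s * b) + s + 8)) / 2),
          1 / w (k + 1 - I) *
          Real.exp (-(1 / ((1 + D ^ (a + s * b)) * s) * (w I * tailSum w (k + 1 - I)))) := by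
      apply mul_le_mul_of_nonneg_left _ hC0.le
      apply Finset.sum_le_sum_of_subset_of_nonneg _ fun I hI _ => hterm I hI
      intro I hI
      rw [Finset.mem_image] at hI
      obtain ⟨i, hi, rfl⟩ := hI
      rw [Finset.mem_filter, Finset.mem_range] at hi
      obtain ⟨j, rfl⟩ : ∃ j, N = i + j := ⟨N - i, by omega⟩
      rw [Nat.add_sub_cancel_left] at hi
      have h4 : s * (i + j + 1) = s * i + s * j + s := by ring
      have h5 : s * (i + 1) = s * i + s := by ring
      have h6 := Nat.mul_le_mul_left s (show i ≤ j + b by omega)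
      rw [mul_add s j b] at h6
      rw [Finset.mem_Icc]
      omega
    have h4 : 0 ≤ C * ∑ I ∈ Finset.Icc 2 ((k + 1 + (a + 2 * b + 2 * (s * b) + s + 8)) / 2),
          1 / w (k + 1 - I) *
          Real.exp (-(1 / ((1 + D ^ (a + s * b)) * s) * (w I * tailSum w (k + 1 - I)))) :=
      mul_nonneg hC0.le (Finset.sum_nonneg hterm)
    linarith

end IsStrongWeight

/-! ### Two-sided bounds for the law of the time of attraction. -/

namespace TwoEdgeWalk.Graph

open Filter

variable {w : ℕ → ℝ} {D : ℝ} {a b : ℕ}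

lemma exists_prob_le (g : Graph) (h : IsStrongWeight w D) (ha : 1 ≤ a) (hb : 1 ≤ b) :
    ∃ C > 0, ∃ c > 0, ∃ c₀ : ℕ, ∀ k, c₀ ≤ k → g.prob w a b (k + 1) ≤
      C * (1 / w ((k + 2) / 2) + ∑ I ∈ Finset.Icc 2 ((k + 1 + c₀) / 2),
        1 / w (k + 1 - I) * Real.exp (-(c * (w I * tailSum w (k + 1 - I))))) := by
  obtain ⟨Ω, _, μ, G, hR⟩ := g.exists_urnRepresentation h.pos ha hb
  have := hR.isProbabilityMeasure
  have hs := g.stride_pos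
  obtain ⟨C₁, hC₁, c₁, hc₁, d₁, h₁⟩ := h.exists_sum_lastGreen_le ha hb hs hR.isUrn
  obtain ⟨C₂, hC₂, c₂, hc₂, d₂, h₂⟩ := h.exists_sum_lastGreen_le hb ha hs
    (hR.isUrn.swap (fun _ => h.pos _ (by omega)) (fun _ => h.pos _ (by omega)))
  refine ⟨C₁ + C₂, by positivity, min c₁ c₂, by positivity, d₁ + d₂ + a + b, fun k hk => ?_⟩
  -- The bound increases when `c` shrinks and when the range of summation grows, so common constants
  -- serve both colours.
  have hmono : ∀ c d, min c₁ c₂ ≤ c → d ≤ d₁ + d₂ + a + b →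
      1 / w ((k + 2) / 2) + ∑ I ∈ Finset.Icc 2 ((k + 1 + d) / 2),
        1 / w (k + 1 - I) * Real.exp (-(c * (w I * tailSum w (k + 1 - I)))) ≤
      1 / w ((k + 2) / 2) + ∑ I ∈ Finset.Icc 2 ((k + 1 + (d₁ + d₂ + a + b)) / 2),
        1 / w (k + 1 - I) *
          Real.exp (-(min c₁ c₂ * (w I * tailSum w (k + 1 - I)))) := by
    intro c d hc hd
    have hpos : ∀ I ∈ Finset.Icc 2 ((k + 1 + (d₁ + d₂ + a + b)) / 2),
        0 < w (k + 1 - I) ∧ 0 < w I ∧ 0 ≤ tailSum w (k + 1 - I) := by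
      intro I hI
      rw [Finset.mem_Icc] at hI
      exact ⟨h.pos _ (by omega), h.pos _ (by omega), h.tailSum_nonneg (by omega)⟩
    apply add_le_add le_rfl
    calc _ ≤ ∑ I ∈ Finset.Icc 2 ((k + 1 + (d₁ + d₂ + a + b)) / 2),
          1 / w (k + 1 - I) * Real.exp (-(c * (w I * tailSum w (k + 1 - I)))) := by
          apply Finset.sum_le_sum_of_subset_of_nonneg
          · exact Finset.Icc_subset_Icc le_rfl (Nat.div_le_div_right (by omega))
          · intro I hI _
            have := (hpos I hI).1
            positivity
      _ ≤ _ := by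
          apply Finset.sum_le_sum
          intro I hI
          obtain ⟨h1, h2, h3⟩ := hpos I hI
          gcongr
  by_cases hN : ∃ N, k + 1 = a + b + g.stride * (N + 1)
  · obtain ⟨N, hN⟩ := hN
    have h1 := (h₁ N k (by omega) hN).trans (mul_le_mul_of_nonneg_left
      (hmono c₁ d₁ (min_le_left _ _) (by omega)) hC₁.le)
    have h2 := (h₂ N k (by omega) (by omega)).trans (mul_le_mul_of_nonneg_left
      (hmono c₂ d₂ (min_le_right _ _) (by omega)) hC₂.le)
    have h3 := hR.le_sum N
    rw [← hN] at h3
    rw [add_mul]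
    linarith
  · rw [hR.eq_zero (k + 1) (by omega) (fun N hN' => hN ⟨N, hN'⟩)]
    have h1 := h.pos ((k + 2) / 2) (by omega)
    apply mul_nonneg (by positivity)
    apply add_nonneg (by positivity)
    apply Finset.sum_nonneg
    intro I hI
    rw [Finset.mem_Icc] at hI
    have := h.pos (k + 1 - I) (by omega)
    positivity

lemma exists_le_prob (g : Graph) (h : IsStrongWeight w D) (ha : 1 ≤ a) (hb : 1 ≤ b) :
    ∃ c > 0, ∀ N, c * ∑ i ∈ Finset.range (N + 1), 1 / w (b + g.stride * (N - i)) *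
        Real.exp (-(w (a + g.stride * (i + 1)) * tailSum w (b + g.stride * (N - i)))) ≤
      g.prob w a b (a + b + g.stride * (N + 1)) := by
  obtain ⟨Ω, _, μ, G, hR⟩ := g.exists_urnRepresentation h.pos ha hb
  have := hR.isProbabilityMeasure
  obtain ⟨c, hc, h₁⟩ := h.exists_le_sum_lastGreen ha hb g.stride_pos hR.isUrn
  exact ⟨c, hc, fun N => (h₁ N).trans (hR.sum_le N)⟩

/-- Needed to extend lower bounds from large `k` to all `k`. -/
lemma prob_pos (g : Graph) (h : IsStrongWeight w D) (ha : 1 ≤ a) (hb : 1 ≤ b) {t : ℕ}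
    (ht : g.Possible a b t) : 0 < g.prob w a b t := by
  rcases g.possible_iff.1 ht with rfl | ⟨N, rfl⟩
  · obtain ⟨Ω, _, μ, G, hR⟩ := g.exists_urnRepresentation h.pos ha hb
    have := hR.isProbabilityMeasure
    exact (hR.isUrn.prob_no_green_pos (fun _ => h.pos _ (by omega)) (fun _ => h.pos _ (by omega))
      (h.summable_stride g.stride_pos b)).trans_le hR.no_green_le
  · obtain ⟨c, hc, h₁⟩ := g.exists_le_prob h ha hb
    refine lt_of_lt_of_le (mul_pos hc (Finset.sum_pos (fun i _ => ?_) (by simp))) (h₁ N)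
    have := h.pos (b + g.stride * (N - i)) (by omega)
    positivity

/-- Lower bound by the number of states in an interval of green counts. -/
lemma exists_mul_le_prob (g : Graph) (h : IsStrongWeight w D) (ha : 1 ≤ a) (hb : 1 ≤ b) :
    ∃ c > 0, ∀ (k m r : ℕ) (τ : ℝ), g.Possible a b (k + 1) → a + b ≤ k → a + 1 ≤ m →
      m + g.stride * r ≤ k + 1 - b →
      (∀ I, m ≤ I → I ≤ m + g.stride * r →
        τ ≤ 1 / w (k + 1 - I) * Real.exp (-(w I * tailSum w (k + 1 - I)))) →
      c * (τ * r) ≤ g.prob w a b (k + 1) := by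
  obtain ⟨c, hc, h₁⟩ := g.exists_le_prob h ha hb
  refine ⟨c, hc, fun k m r τ hk hab hm hmr hτ => ?_⟩
  have hs := g.stride_pos
  obtain ⟨N, hN⟩ : ∃ N, k + 1 = a + b + g.stride * (N + 1) := by
    rcases g.possible_iff.1 hk with h | h
    · omega
    · exact h
  rw [hN]
  refine le_trans ?_ (h₁ N)
  apply mul_le_mul_of_nonneg_left _ hc.le
  set s := g.stride with hs_def
  -- With this choice `a + s * (i₀ + 1)` is the first attainable green count that is at least `m`.
  set i₀ := (m - a - 1) / s with hi₀
  have e1 := Nat.div_add_mod (m - a - 1) s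
  have e2 := Nat.mod_lt (m - a - 1) hs
  rw [← hi₀] at e1
  have hI : ∀ t, t < r → m ≤ a + s * (i₀ + t + 1) ∧ a + s * (i₀ + t + 1) ≤ m + s * r := by
    intro t ht
    have e3 : s * (i₀ + t + 1) = s * i₀ + s * t + s := by ring
    have e4 : s * t + s ≤ s * r := by
      rw [← Nat.mul_succ]; exact Nat.mul_le_mul_left s ht
    omega
  have hiN : ∀ t, t < r → i₀ + t ≤ N := by
    intro t ht
    have e3 := (hI t ht).2
    have e4 : s * (i₀ + t + 1) ≤ s * (N + 1) := by omega
    have := Nat.le_of_mul_le_mul_left e4 hs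
    omega
  have hinj : Set.InjOn (fun t => i₀ + t) (Finset.range r : Finset ℕ) := fun x _ y _ h =>
    Nat.add_left_cancel h
  calc τ * r = ∑ t ∈ Finset.range r, τ := by simp [mul_comm]
    _ ≤ ∑ t ∈ Finset.range r, 1 / w (b + s * (N - (i₀ + t))) *
        Real.exp (-(w (a + s * (i₀ + t + 1)) * tailSum w (b + s * (N - (i₀ + t))))) := by
        apply Finset.sum_le_sum
        intro t ht
        rw [Finset.mem_range] at ht
        have h3 := hτ _ (hI t ht).1 (hI t ht).2
        have h4 : k + 1 - (a + s * (i₀ + t + 1)) = b + s * (N - (i₀ + t)) := by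
          obtain ⟨d, hd⟩ := Nat.exists_eq_add_of_le (hiN t ht)
          rw [hN, hd, Nat.add_sub_cancel_left]
          have : s * (i₀ + t + d + 1) = s * (i₀ + t + 1) + s * d := by ring
          omega
        rwa [h4] at h3
    _ = ∑ i ∈ (Finset.range r).image (fun t => i₀ + t), 1 / w (b + s * (N - i)) *
        Real.exp (-(w (a + s * (i + 1)) * tailSum w (b + s * (N - i)))) := by
        rw [Finset.sum_image hinj]
    _ ≤ _ := by
        apply Finset.sum_le_sum_of_subset_of_nonneg
        · intro i hi
          obtain ⟨t, ht, rfl⟩ := Finset.mem_image.1 hi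
          have := hiN t (Finset.mem_range.1 ht)
          exact Finset.mem_range.2 (by omega)
        · intro i _ _
          have := h.pos (b + s * (N - i)) (by omega)
          positivity

end TwoEdgeWalk.Graph

/-! ### Weights of regular growth. -/

lemma sum_exp_neg_le {θ : ℝ} (hθ : 0 < θ) (F : Finset ℕ) (q : ℕ → ℕ) (hq : Set.InjOn q F) :
    ∑ i ∈ F, Real.exp (-(θ * q i)) ≤ 1 + 1 / θ := by
  have h1 : Real.exp (-θ) < 1 := Real.exp_zero ▸ Real.exp_lt_exp.2 (neg_lt_zero.2 hθ)
  have h2 : ∀ n : ℕ, Real.exp (-(θ * n)) = Real.exp (-θ) ^ n := by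
    intro n
    rw [← Real.exp_nat_mul]; ring_nf
  simp only [h2]
  rw [← Finset.sum_image (f := fun n => Real.exp (-θ) ^ n) hq]
  have h3 := hasSum_geometric_of_lt_one (Real.exp_pos _).le h1
  refine (sum_le_hasSum _ (fun _ _ => by positivity) h3).trans ?_
  have h4 : Real.exp (-θ) ≤ 1 / (1 + θ) := by
    rw [Real.exp_neg, ← one_div]
    apply one_div_le_one_div_of_le (by linarith)
    have := Real.add_one_le_exp θ
    linarith
  have h5 : θ / (1 + θ) ≤ 1 - Real.exp (-θ) := by
    have : θ / (1 + θ) = 1 - 1 / (1 + θ) := by field_simp; ring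
    linarith
  calc (1 - Real.exp (-θ))⁻¹ ≤ (θ / (1 + θ))⁻¹ := inv_anti₀ (by positivity) h5
    _ = 1 + 1 / θ := by field_simp; ring

/-- A strongly reinforcing weight of regular growth. -/
structure IsRegularWeight (w : ℕ → ℝ) (D : ℝ) : Prop extends IsStrongWeight w D where
  double : ∀ n, 1 ≤ n → w (2 * n) ≤ D * w n
  superlinear : ∀ m n, 2 ≤ m → m ≤ n → w m * n ≤ w n * m

namespace IsRegularWeight

variable {w : ℕ → ℝ} {D : ℝ}

/-- Doubling compares `1 / w (m + l)` with `1 / w (2 * m + 2 * l)`, and the latter terms are a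
subseries of the tail from `2 * m ≥ k`. -/
lemma tailSum_le (h : IsRegularWeight w D) {m k : ℕ} (hm : 1 ≤ m) (hk : 1 ≤ k) (hkm : k ≤ 2 * m) :
    tailSum w m ≤ D * tailSum w k := by
  have hD := h.one_le
  have h1 := h.tailSum_stride_le two_pos (show 1 ≤ 2 * m by omega)
  have h2 := h.tailSum_anti hk hkm
  have h3 : tailSum w m ≤ D * ∑' l, 1 / w (2 * m + 2 * l) := by
    rw [← tsum_mul_left]
    apply (h.summable_add m).tsum_le_tsum _ ((h.summable_stride two_pos (2 * m)).mul_left D)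
    intro l
    have h4 := h.double (m + l) (by omega)
    have h5 := h.pos (m + l) (by omega)
    have h6 := h.pos (2 * (m + l)) (by omega)
    rw [← mul_add, mul_one_div, div_le_div_iff₀ h5 h6]
    linarith
  exact h3.trans (mul_le_mul_of_nonneg_left (h1.trans h2) (by linarith))

end IsRegularWeight

namespace TwoEdgeWalk.Graph

open Filter

variable {w : ℕ → ℝ} {D : ℝ} {a b : ℕ}

/-- In the range of summation `1 / w (k + 1 - I)` is at most a constant times `1 / w k`, and
`tailSum w (k + 1 - I)` is at least `tailSum w k`. Superlinearity makes the exponent grow at least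
linearly in `I / N k`, so the sum is dominated by a geometric series of size `N k`. -/
lemma exists_prob_le_of_regular (g : Graph) (h : IsRegularWeight w D) (ha : 1 ≤ a) (hb : 1 ≤ b)
    {N : ℕ → ℝ} {c' : ℝ} (hc' : 0 < c') (hN2 : ∀ᶠ k in atTop, 2 ≤ N k)
    (hN : ∀ᶠ k in atTop, c' ≤ w ⌈N k⌉₊ * tailSum w k) :
    ∃ C > 0, ∀ᶠ k in atTop, g.prob w a b (k + 1) ≤ C * (N k / w k) := by
  obtain ⟨C, hC, c, hc, c₀, hbd⟩ := g.exists_prob_le h.toIsStrongWeight ha hb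
  have hD := h.one_le
  refine ⟨C * (D + D ^ 2 * Real.exp (c * c') * (1 + 2 / (c * c'))), by positivity, ?_⟩
  filter_upwards [hN2, hN, eventually_ge_atTop (4 * c₀ + 8)] with k h2 h3 hk
  refine (hbd k (by omega)).trans ?_
  rw [mul_assoc]
  apply mul_le_mul_of_nonneg_left _ hC.le
  rw [add_mul]
  have hwk := h.pos k (by omega)
  have hD0 : 0 < D := by linarith
  apply add_le_add
  · have h4 : w k ≤ D * w ((k + 2) / 2) :=
      (h.mono_le (by omega) (by omega)).trans (h.double _ (by omega))
    have h5 := h.pos ((k + 2) / 2) (by omega)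
    rw [mul_div_assoc', div_le_div_iff₀ h5 hwk]
    nlinarith
  · set M := ⌈N k⌉₊ with hM
    have hM2 : 2 ≤ M := by
      have h4 := Nat.le_ceil (N k)
      have : (2 : ℝ) ≤ M := h2.trans h4
      exact_mod_cast this
    have hMr : (0 : ℝ) < M := by positivity
    have hMN : (M : ℝ) ≤ N k + 1 := (Nat.ceil_lt_add_one (by linarith)).le
    set θ := c * c' / M with hθ
    have hθ0 : 0 < θ := by positivity
    have hterm : ∀ I ∈ Finset.Icc 2 ((k + 1 + c₀) / 2),
        1 / w (k + 1 - I) * Real.exp (-(c * (w I * tailSum w (k + 1 - I)))) ≤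
          D ^ 2 * (1 / w k) * (Real.exp (c * c') * Real.exp (-(θ * I))) := by
      intro I hI
      rw [Finset.mem_Icc] at hI
      have h4 : w k ≤ D ^ 2 * w (k + 1 - I) := by
        have h5 := h.double (2 * (k + 1 - I)) (by omega)
        have h6 := h.double (k + 1 - I) (by omega)
        have h7 := h.mono_le (show 2 ≤ k by omega) (show k ≤ 2 * (2 * (k + 1 - I)) by omega)
        have := mul_le_mul_of_nonneg_left h6 hD0.le
        nlinarith
      have h5 := h.pos (k + 1 - I) (by omega)
      have h6 : 1 / w (k + 1 - I) ≤ D ^ 2 * (1 / w k) := by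
        rw [mul_one_div, div_le_div_iff₀ h5 hwk]; linarith
      have h7 := h.tailSum_anti (show 1 ≤ k + 1 - I by omega) (show k + 1 - I ≤ k by omega)
      have h8 := h.tailSum_nonneg (show 1 ≤ k by omega)
      have h9 := h.pos I (by omega)
      have h10 := h.pos M (by omega)
      -- Adding `c'` makes one linear bound valid below `M` as well, at the price of a factor `exp
      -- (c * c')`.
      have h11 : c' * I ≤ (c' + w I * tailSum w k) * M := by
        rcases le_total I M with h12 | h12
        · have : (I : ℝ) ≤ M := by exact_mod_cast h12
          have : c' * I ≤ c' * M := by gcongr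
          have : 0 ≤ w I * tailSum w k * M := by positivity
          linarith
        · have h13 := h.superlinear M I hM2 h12
          have h14 : c' * I ≤ w M * tailSum w k * I := by gcongr
          have h15 : w M * I * tailSum w k ≤ w I * M * tailSum w k := by gcongr
          have : 0 ≤ c' * M := by positivity
          linarith
      apply mul_le_mul h6 _ (Real.exp_pos _).le (by positivity)
      rw [← Real.exp_add]
      apply Real.exp_le_exp.2
      have h12 : w I * tailSum w k ≤ w I * tailSum w (k + 1 - I) := by gcongr
      have h13 : θ * I ≤ c * (c' + w I * tailSum w k) := by
        rw [hθ, div_mul_eq_mul_div, div_le_iff₀ hMr]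
        have := mul_le_mul_of_nonneg_left h11 hc.le
        linarith
      have := mul_le_mul_of_nonneg_left h12 hc.le
      linarith
    refine (Finset.sum_le_sum hterm).trans ?_
    rw [← Finset.mul_sum, ← Finset.mul_sum]
    have h4 := sum_exp_neg_le hθ0 (Finset.Icc 2 ((k + 1 + c₀) / 2)) id (Set.injOn_id _)
    simp only [id] at h4
    have h5 : 1 + 1 / θ ≤ (1 + 2 / (c * c')) * N k := by
      have : 1 / θ = M / (c * c') := by rw [hθ, one_div_div]
      rw [this, add_mul, one_mul, div_mul_eq_mul_div]
      apply add_le_add (by linarith)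
      gcongr
      linarith
    calc _ ≤ D ^ 2 * (1 / w k) * (Real.exp (c * c') * ((1 + 2 / (c * c')) * N k)) := by
          gcongr
          exact h4.trans h5
      _ = _ := by ring

/-- For final losing counts up to `N k` the exponential factor is bounded below and `1 / w (k + 1 -
I) ≥ 1 / w k`; the number of attainable counts is of order `N k`. -/
lemma exists_le_prob_of_regular (g : Graph) (h : IsRegularWeight w D) (ha : 1 ≤ a) (hb : 1 ≤ b)
    {N : ℕ → ℝ} {C' : ℝ} (hNtop : Tendsto N atTop atTop) (hNk : ∀ᶠ k in atTop, N k ≤ (k : ℝ) / 2)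
    (hN : ∀ᶠ k in atTop, w ⌊N k⌋₊ * tailSum w k ≤ C') :
    ∃ c > 0, ∀ᶠ k in atTop, g.Possible a b (k + 1) → c * (N k / w k) ≤ g.prob w a b (k + 1) := by
  obtain ⟨c, hc, hbd⟩ := g.exists_mul_le_prob h.toIsStrongWeight ha hb
  have hD := h.one_le
  have hs := g.stride_pos
  have hs' : (0 : ℝ) < g.stride := by exact_mod_cast hs
  refine ⟨c * (Real.exp (-(D * C')) * (1 / (2 * g.stride))), by positivity, ?_⟩
  filter_upwards [hNtop.eventually_ge_atTop (2 * (a + 2 + g.stride : ℝ)), hNk, hN,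
    eventually_ge_atTop (2 * b + 2 * a + 8)] with k h1 h2 h3 hk hposs
  set M := ⌊N k⌋₊ with hM
  have hN0 : 0 ≤ N k := le_trans (by positivity) h1
  have hMN : (M : ℝ) ≤ N k := Nat.floor_le hN0
  have hMN' : N k < M + 1 := Nat.lt_floor_add_one _
  have hM2k : 2 * M ≤ k := by
    have : (2 * M : ℝ) ≤ k := by linarith
    exact_mod_cast this
  have hMa : a + 1 + g.stride ≤ M := by
    have : ((a + 1 + g.stride : ℕ) : ℝ) < M + 1 := by push_cast; linarith
    exact_mod_cast Nat.lt_succ_iff.1 (by exact_mod_cast this)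
  set r := (M - (a + 1)) / g.stride with hr
  have e1 := Nat.div_add_mod (M - (a + 1)) g.stride
  have e2 := Nat.mod_lt (M - (a + 1)) hs
  rw [← hr] at e1
  have hwk := h.pos k (by omega)
  have h4 := hbd k (a + 1) r (Real.exp (-(D * C')) * (1 / w k)) hposs (by omega) le_rfl (by omega)
    (by
      intro I hI1 hI2
      have h5 := h.pos (k + 1 - I) (by omega)
      have h6 := h.mono_le (show 2 ≤ k + 1 - I by omega) (show k + 1 - I ≤ k by omega)
      have h7 := h.mono_le (show 2 ≤ I by omega) (show I ≤ M by omega)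
      have h8 := h.tailSum_le (show 1 ≤ k + 1 - I by omega) (show 1 ≤ k by omega) (by omega)
      have h9 := h.pos I (by omega)
      have h10 := h.tailSum_nonneg (show 1 ≤ k by omega)
      rw [mul_comm]
      apply mul_le_mul _ _ (Real.exp_pos _).le (by positivity)
      · exact one_div_le_one_div_of_le h5 h6
      · apply Real.exp_le_exp.2
        apply neg_le_neg
        calc w I * tailSum w (k + 1 - I) ≤ w M * (D * tailSum w k) :=
              mul_le_mul h7 h8 (h.tailSum_nonneg (by omega)) (h9.le.trans h7)
          _ = D * (w M * tailSum w k) := by ring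
          _ ≤ D * C' := by gcongr)
  refine le_trans ?_ h4
  have h5 : N k ≤ 2 * g.stride * r := by
    have e3 : (M : ℝ) < g.stride * r + a + 1 + g.stride := by
      have : M < g.stride * r + a + 1 + g.stride := by omega
      exact_mod_cast this
    linarith
  have h6 : N k * (1 / (2 * g.stride)) ≤ r := by
    rw [mul_one_div, div_le_iff₀ (by positivity)]; linarith
  calc c * (Real.exp (-(D * C')) * (1 / (2 * g.stride))) * (N k / w k)
      = c * (Real.exp (-(D * C')) * (1 / w k) * (N k * (1 / (2 * g.stride)))) := by ring
    _ ≤ _ := by gcongr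

end TwoEdgeWalk.Graph

/-- Finitely many `k` only shrink the constant, thanks to positivity of `P` wherever `p` holds. -/
lemma exists_const_le_of_eventually {P F : ℕ → ℝ} {p : ℕ → Prop} {k₀ : ℕ}
    (hF : ∀ k, k₀ ≤ k → 0 < F k) (hP : ∀ k, p k → 0 < P k)
    (h : ∃ c > 0, ∀ᶠ k in Filter.atTop, p k → c * F k ≤ P k) :
    ∃ c > 0, ∀ k, k₀ ≤ k → p k → c * F k ≤ P k := by
  obtain ⟨c, hc, h⟩ := h
  obtain ⟨K, hK⟩ := Filter.eventually_atTop.1 h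
  have key : ∀ n, ∃ c > 0, ∀ k, k₀ ≤ k → k < n → p k → c * F k ≤ P k := by
    intro n
    induction n with
    | zero => exact ⟨1, one_pos, fun k _ hk => absurd hk (Nat.not_lt_zero k)⟩
    | succ n ih =>
      obtain ⟨c, hc, ih⟩ := ih
      by_cases hn : k₀ ≤ n ∧ p n
      · have h1 := hF n hn.1
        have h2 := hP n hn.2
        refine ⟨min c (P n / F n), by positivity, fun k hk1 hk2 hk3 => ?_⟩
        have h3 := hF k hk1
        rcases Nat.lt_succ_iff_lt_or_eq.1 hk2 with h4 | rfl
        · exact (mul_le_mul_of_nonneg_right (min_le_left _ _) h3.le).trans (ih k hk1 h4 hk3)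
        · exact (mul_le_mul_of_nonneg_right (min_le_right _ _) h3.le).trans_eq
            (div_mul_cancel₀ _ h3.ne')
      · refine ⟨c, hc, fun k hk1 hk2 hk3 => ?_⟩
        rcases Nat.lt_succ_iff_lt_or_eq.1 hk2 with h4 | rfl
        · exact ih k hk1 h4 hk3
        · exact absurd ⟨hk1, hk3⟩ hn
  obtain ⟨c', hc', h'⟩ := key K
  refine ⟨min c c', by positivity, fun k hk1 hk2 => ?_⟩
  have h3 := hF k hk1
  rcases lt_or_ge k K with h4 | h4
  · exact (mul_le_mul_of_nonneg_right (min_le_right _ _) h3.le).trans (h' k hk1 h4 hk2)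
  · exact (mul_le_mul_of_nonneg_right (min_le_left _ _) h3.le).trans (hK k h4 hk2)

lemma exists_le_const_of_eventually {P F : ℕ → ℝ} {k₀ : ℕ} (hF : ∀ k, k₀ ≤ k → 0 < F k)
    (h : ∃ C > 0, ∀ᶠ k in Filter.atTop, P k ≤ C * F k) :
    ∃ C > 0, ∀ k, k₀ ≤ k → P k ≤ C * F k := by
  obtain ⟨C, hC, h⟩ := h
  obtain ⟨K, hK⟩ := Filter.eventually_atTop.1 h
  have key : ∀ n, ∃ C > 0, ∀ k, k₀ ≤ k → k < n → P k ≤ C * F k := by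
    intro n
    induction n with
    | zero => exact ⟨1, one_pos, fun k _ hk => absurd hk (Nat.not_lt_zero k)⟩
    | succ n ih =>
      obtain ⟨C, hC, ih⟩ := ih
      refine ⟨max C (P n / F n), by positivity, fun k hk1 hk2 => ?_⟩
      have h3 := hF k hk1
      rcases Nat.lt_succ_iff_lt_or_eq.1 hk2 with h4 | rfl
      · exact (ih k hk1 h4).trans (mul_le_mul_of_nonneg_right (le_max_left _ _) h3.le)
      · exact (div_mul_cancel₀ _ h3.ne').symm.le.trans
          (mul_le_mul_of_nonneg_right (le_max_right _ _) h3.le)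
  obtain ⟨C', hC', h'⟩ := key K
  refine ⟨max C C', by positivity, fun k hk1 => ?_⟩
  have h3 := hF k hk1
  rcases lt_or_ge k K with h4 | h4
  · exact (h' k hk1 h4).trans (mul_le_mul_of_nonneg_right (le_max_right _ _) h3.le)
  · exact (hK k h4).trans (mul_le_mul_of_nonneg_right (le_max_left _ _) h3.le)

open Filter Topology

/-! ### Tail sums by integration, and the weights `n ^ ρ * log ^ α n`. -/

lemma IsRegularWeight.of_superlinear {w : ℕ → ℝ} {D : ℝ} (hpos : ∀ n, 1 ≤ n → 0 < w n)
    (hsuper : ∀ m n, 2 ≤ m → m ≤ n → w m * n ≤ w n * m) (hdouble : ∀ n, 1 ≤ n → w (2 * n) ≤ D * w n)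
    (hsum : Summable fun n => 1 / w n) : IsRegularWeight w D := by
  have hmono : ∀ m n, 2 ≤ m → m ≤ n → w m ≤ w n := by
    intro m n hm hmn
    have h1 := hsuper m n hm hmn
    have h2 := hpos n (by omega)
    have h3 : (0 : ℝ) < n := by exact_mod_cast (show 0 < n by omega)
    have h4 : (m : ℝ) ≤ n := by exact_mod_cast hmn
    have h5 : w n * m ≤ w n * n := by gcongr
    exact le_of_mul_le_mul_right (h1.trans h5) h3
  refine ⟨⟨hpos, fun n hn => hmono n (n + 1) hn (by omega), fun n hn => ?_, hsum⟩, hdouble, hsuper⟩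
  rcases Nat.eq_or_lt_of_le hn with rfl | hn'
  · exact hdouble 1 le_rfl
  · exact (hmono _ _ (by omega) (by omega)).trans (hdouble n hn)

/-- Comparison of the tail sums of `1 / w` with an antiderivative. -/
lemma tailSum_bounds_of_hasDerivAt {w : ℕ → ℝ} {f H h : ℝ → ℝ} {n₀ : ℕ} {c C D : ℝ} (hc : 0 < c)
    (hC : 0 < C) (hD : 0 < D) (hf : ∀ n : ℕ, n₀ ≤ n → w n = f n) (hfpos : ∀ x, (n₀ : ℝ) ≤ x → 0 < f x)
    (hfmono : MonotoneOn f (Set.Ici (n₀ : ℝ))) (hratio : ∀ n, n₀ ≤ n → w (n + 1) ≤ D * w n)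
    (hderiv : ∀ x, (n₀ : ℝ) ≤ x → HasDerivAt H (-h x) x)
    (h1 : ∀ x, (n₀ : ℝ) ≤ x → c / f x ≤ h x) (h2 : ∀ x, (n₀ : ℝ) ≤ x → h x ≤ C / f x)
    (hlim : Tendsto (fun n : ℕ => H n) atTop (𝓝 0)) :
    Summable (fun n => 1 / w n) ∧
      ∀ n, n₀ ≤ n → tailSum w n ≤ D / c * H n ∧ 1 / C * H n ≤ tailSum w n := by
  have hw : ∀ n, n₀ ≤ n → 0 < w n := fun n hn => by
    rw [hf n hn]; exact hfpos n (by exact_mod_cast hn)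
  have hinc : ∀ n, n₀ ≤ n → 1 / w n ≤ D / c * (H n - H (n + 1 : ℕ)) ∧
      1 / C * (H n - H (n + 1 : ℕ)) ≤ 1 / w n := by
    intro n hn
    have hn' : (n₀ : ℝ) ≤ n := by exact_mod_cast hn
    -- By the mean value theorem the decrement of `H` is `h ξ` with `ξ` between `n` and `n + 1`,
    -- where `f ξ` lies between `w n` and `D * w n`. Summation then telescopes.
    obtain ⟨ξ, hξ, hξ'⟩ := exists_hasDerivAt_eq_slope H (fun x => -h x)
      (show (n : ℝ) < (n + 1 : ℕ) by push_cast; linarith)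
      (fun x hx => (hderiv x (hn'.trans hx.1)).continuousAt.continuousWithinAt)
      (fun x hx => hderiv x (hn'.trans hx.1.le))
    have e1 : H n - H (n + 1 : ℕ) = h ξ := by
      have : ((n + 1 : ℕ) : ℝ) - n = 1 := by push_cast; ring
      rw [this, div_one] at hξ'
      linarith
    have hξ0 : (n₀ : ℝ) ≤ ξ := hn'.trans hξ.1.le
    have f1 : w n ≤ f ξ := by rw [hf n hn]; exact hfmono hn' hξ0 hξ.1.le
    have f2 : f ξ ≤ D * w n := by
      refine le_trans ?_ (hratio n hn)
      rw [hf (n + 1) (by omega)]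
      exact hfmono hξ0 (by simp only [Set.mem_Ici]; push_cast; linarith) hξ.2.le
    have hwn := hw n hn
    have hfξ := hfpos ξ hξ0
    rw [e1]
    constructor
    · calc 1 / w n ≤ D / f ξ := by rw [div_le_div_iff₀ hwn hfξ]; linarith
        _ = D / c * (c / f ξ) := by field_simp
        _ ≤ _ := by gcongr; exact h1 ξ hξ0
    · calc 1 / C * h ξ ≤ 1 / C * (C / f ξ) := by gcongr; exact h2 ξ hξ0
        _ = 1 / f ξ := by field_simp
        _ ≤ 1 / w n := one_div_le_one_div_of_le hwn f1
  have htel : ∀ n M, ∑ l ∈ Finset.range M, (H (n + l : ℕ) - H (n + l + 1 : ℕ)) =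
      H n - H (n + M : ℕ) := by
    intro n M
    have := Finset.sum_range_sub' (fun l => H (n + l : ℕ)) M
    simpa only [add_zero, add_assoc] using this
  have hlim' : ∀ n : ℕ, Tendsto (fun M : ℕ => H n - H (n + M : ℕ)) atTop (𝓝 (H n)) := by
    intro n
    have h3 : Tendsto (fun M : ℕ => H (n + M : ℕ)) atTop (𝓝 0) := by
      have := (tendsto_add_atTop_iff_nat n).2 hlim
      simpa only [add_comm] using this
    simpa using h3.const_sub (H n)
  have hHnonneg : ∀ n, n₀ ≤ n → 0 ≤ H n := by
    intro n hn
    apply ge_of_tendsto' (hlim' n)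
    intro M
    rw [← htel]
    apply Finset.sum_nonneg
    intro l _
    have h3 := (hinc (n + l) (by omega)).1
    have h4 := hw (n + l) (by omega)
    have h5 : 0 < D / c * (H (n + l : ℕ) - H (n + l + 1 : ℕ)) :=
      lt_of_lt_of_le (by positivity) h3
    exact (pos_of_mul_pos_right h5 (by positivity)).le
  have hsum : ∀ n, n₀ ≤ n → ∀ M, ∑ l ∈ Finset.range M, 1 / w (n + l) ≤ D / c * H n := by
    intro n hn M
    calc ∑ l ∈ Finset.range M, 1 / w (n + l)
        ≤ ∑ l ∈ Finset.range M, D / c * (H (n + l : ℕ) - H (n + l + 1 : ℕ)) :=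
          Finset.sum_le_sum fun l _ => (hinc (n + l) (by omega)).1
      _ = D / c * (H n - H (n + M : ℕ)) := by rw [← Finset.mul_sum, htel]
      _ ≤ D / c * H n := by
          have := hHnonneg (n + M) (by omega)
          gcongr; linarith
  have hnn : ∀ n, n₀ ≤ n → ∀ l, 0 ≤ 1 / w (n + l) := fun n hn l => by
    have := hw (n + l) (by omega); positivity
  have hsummable : ∀ n, n₀ ≤ n → Summable fun l => 1 / w (n + l) := fun n hn =>
    summable_of_sum_range_le (hnn n hn) (hsum n hn)
  refine ⟨?_, fun n hn => ⟨Real.tsum_le_of_sum_range_le (hnn n hn) (hsum n hn), ?_⟩⟩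
  · have := hsummable n₀ le_rfl
    rw [← summable_nat_add_iff n₀]
    simpa only [add_comm] using this
  · apply le_of_tendsto' ((hlim' n).const_mul (1 / C))
    intro M
    calc 1 / C * (H n - H (n + M : ℕ))
        = ∑ l ∈ Finset.range M, 1 / C * (H (n + l : ℕ) - H (n + l + 1 : ℕ)) := by
          rw [← htel, Finset.mul_sum]
      _ ≤ ∑ l ∈ Finset.range M, 1 / w (n + l) :=
          Finset.sum_le_sum fun l _ => (hinc (n + l) (by omega)).2
      _ ≤ _ := (hsummable n hn).sum_le_tsum _ fun l _ => hnn n hn l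

/-- The weight `n ^ ρ * log ^ α n`, with value `w₁` at `1`. -/
noncomputable def powLogWeight (ρ α w₁ : ℝ) (n : ℕ) : ℝ :=
  if n = 1 then w₁ else (n : ℝ) ^ ρ * Real.log n ^ α

lemma monotoneOn_powLog {ρ α : ℝ} (hρ : 0 ≤ ρ) (hα : 0 ≤ α) :
    MonotoneOn (fun x : ℝ => x ^ ρ * Real.log x ^ α) (Set.Ici 1) := by
  intro x hx y hy hxy
  simp only [Set.mem_Ici] at hx hy
  have h1 := Real.log_nonneg hx
  have h2 : Real.log x ≤ Real.log y := Real.log_le_log (by linarith) hxy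
  have h3 : 0 ≤ x := by linarith
  change x ^ ρ * Real.log x ^ α ≤ y ^ ρ * Real.log y ^ α
  gcongr

/-- The derivative of `x ^ (1 - ρ) * log x ^ (-α)` is `-(ρ - 1 + α / log x)` times the reciprocal
weight. From `3` on `log x ≥ 1`, so the coefficient lies between `ρ - 1` and `ρ - 1 + α`. -/
lemma powLogWeight_tail {ρ α w₁ : ℝ} (hρ : 1 < ρ) (hα : 0 ≤ α) :
    Summable (fun n => 1 / powLogWeight ρ α w₁ n) ∧ ∃ C > 0, ∃ c > 0, ∀ n : ℕ, 3 ≤ n →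
      tailSum (powLogWeight ρ α w₁) n ≤ C * ((n : ℝ) ^ (1 - ρ) * Real.log n ^ (-α)) ∧
      c * ((n : ℝ) ^ (1 - ρ) * Real.log n ^ (-α)) ≤ tailSum (powLogWeight ρ α w₁) n := by
  have hlog : ∀ x : ℝ, (3 : ℕ) ≤ x → 1 ≤ Real.log x := by
    intro x hx
    rw [Real.le_log_iff_exp_le (by push_cast at hx; linarith)]
    have := Real.exp_one_lt_d9
    push_cast at hx; linarith
  have key := tailSum_bounds_of_hasDerivAt (w := powLogWeight ρ α w₁)
    (f := fun x => x ^ ρ * Real.log x ^ α) (H := fun x => x ^ (1 - ρ) * Real.log x ^ (-α))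
    (h := fun x => (ρ - 1 + α / Real.log x) / (x ^ ρ * Real.log x ^ α)) (n₀ := 3)
    (c := ρ - 1) (C := ρ - 1 + α) (D := 2 ^ ρ * 2 ^ α) (by linarith) (by linarith) (by positivity)
    (fun n hn => by rw [powLogWeight, if_neg (by omega)])
    (fun x hx => by
      have := hlog x hx
      push_cast at hx
      positivity)
    ((monotoneOn_powLog (by linarith) hα).mono (Set.Ici_subset_Ici.2 (by norm_num)))
    (fun n hn => by
      rw [powLogWeight, powLogWeight, if_neg (by omega), if_neg (by omega)]
      have hn' : (3 : ℝ) ≤ n := by exact_mod_cast hn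
      have h1 := hlog n (by exact_mod_cast hn)
      have h2 : Real.log (n + 1 : ℕ) ≤ 2 * Real.log n := by
        have h3 : 2 * Real.log n = Real.log (n ^ 2) := by rw [Real.log_pow]; norm_num
        rw [h3]
        apply Real.log_le_log (by positivity)
        push_cast; nlinarith
      have h3 : 0 ≤ Real.log (n + 1 : ℕ) := Real.log_natCast_nonneg _
      calc ((n + 1 : ℕ) : ℝ) ^ ρ * Real.log (n + 1 : ℕ) ^ α
          ≤ (2 * n) ^ ρ * (2 * Real.log n) ^ α := by
            gcongr
            push_cast; linarith
        _ = _ := by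
            rw [Real.mul_rpow (by norm_num) (by linarith), Real.mul_rpow (by norm_num) (by linarith)]
            ring)
    (fun x hx => by
      have hl := hlog x hx
      push_cast at hx
      have hx0 : 0 < x := by linarith
      have h1 := (Real.hasDerivAt_rpow_const (x := x) (p := 1 - ρ) (Or.inl hx0.ne')).mul
        ((Real.hasDerivAt_log hx0.ne').rpow_const (p := -α) (Or.inl (by linarith)))
      refine h1.congr_deriv ?_
      have hl0 : 0 < Real.log x := by linarith
      have e1 : x ^ (1 - ρ - 1) = (x ^ ρ)⁻¹ := by rw [← Real.rpow_neg hx0.le]; congr 1; ring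
      have e2 : x ^ (1 - ρ) = x * (x ^ ρ)⁻¹ := by
        rw [← Real.rpow_neg hx0.le, sub_eq_add_neg, Real.rpow_add hx0, Real.rpow_one]
      have e3 : Real.log x ^ (-α - 1) = (Real.log x ^ α)⁻¹ * (Real.log x)⁻¹ := by
        rw [sub_eq_add_neg, Real.rpow_add hl0, Real.rpow_neg hl0.le, Real.rpow_neg_one]
      rw [e1, e2, e3, Real.rpow_neg hl0.le]
      have : 0 < x ^ ρ := by positivity
      have : 0 < Real.log x ^ α := by positivity
      field_simp
      ring)
    (fun x hx => by
      have := hlog x hx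
      push_cast at hx
      gcongr
      have : 0 ≤ α / Real.log x := by positivity
      linarith)
    (fun x hx => by
      have := hlog x hx
      push_cast at hx
      gcongr
      exact div_le_self hα this)
    (by
      have h1 : Tendsto (fun n : ℕ => (n : ℝ) ^ (1 - ρ)) atTop (𝓝 0) := by
        have := (tendsto_rpow_neg_atTop (show 0 < ρ - 1 by linarith)).comp
          tendsto_natCast_atTop_atTop
        simpa [Function.comp_def] using this
      apply squeeze_zero' _ _ h1
      · filter_upwards [eventually_ge_atTop 3] with n hn
        have := hlog n (by exact_mod_cast hn)
        positivity
      · filter_upwards [eventually_ge_atTop 3] with n hn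
        have := hlog n (by exact_mod_cast hn)
        apply mul_le_of_le_one_right (by positivity)
        exact Real.rpow_le_one_of_one_le_of_nonpos this (by linarith))
  exact ⟨key.1, _, div_pos (by positivity) (by linarith), _, one_div_pos.2 (by linarith),
    fun n hn => key.2 n hn⟩

lemma isRegularWeight_powLog {ρ α w₁ : ℝ} (hρ : 1 < ρ) (hα : 0 ≤ α) (hw₁ : 0 < w₁) :
    ∃ D, IsRegularWeight (powLogWeight ρ α w₁) D := by
  have hw : ∀ n : ℕ, 2 ≤ n → powLogWeight ρ α w₁ n = (n : ℝ) ^ ρ * Real.log n ^ α :=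
    fun n hn => by rw [powLogWeight, if_neg (by omega)]
  have hlog : ∀ n : ℕ, 2 ≤ n → 0 < Real.log n := fun n hn =>
    Real.log_pos (by exact_mod_cast (show 1 < n by omega))
  have hpos : ∀ n, 1 ≤ n → 0 < powLogWeight ρ α w₁ n := by
    intro n hn
    by_cases h1 : n = 1
    · rw [powLogWeight, if_pos h1]; exact hw₁
    · rw [hw n (by omega)]
      have := hlog n (by omega)
      positivity
  -- The second entry handles doubling at `n = 1`, where the weight is arbitrary.
  refine ⟨max (2 ^ ρ * 2 ^ α) (powLogWeight ρ α w₁ 2 / powLogWeight ρ α w₁ 1),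
    IsRegularWeight.of_superlinear hpos ?_ ?_ (powLogWeight_tail hρ hα).1⟩
  · intro m n hm hmn
    rw [hw m hm, hw n (by omega)]
    have hm0 : (0 : ℝ) < m := by exact_mod_cast (show 0 < m by omega)
    have hmn' : (m : ℝ) ≤ n := by exact_mod_cast hmn
    have hn0 : (0 : ℝ) < n := by linarith
    have h1 := hlog m hm
    have h2 : Real.log m ≤ Real.log n := Real.log_le_log hm0 hmn'
    have e : ∀ x : ℝ, 0 < x → x ^ ρ = x ^ (ρ - 1) * x := by
      intro x hx; rw [← Real.rpow_add_one hx.ne']; congr 1; ring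
    have h3 : (m : ℝ) ^ (ρ - 1) ≤ (n : ℝ) ^ (ρ - 1) :=
      Real.rpow_le_rpow hm0.le hmn' (by linarith)
    have h4 : Real.log m ^ α ≤ Real.log n ^ α := Real.rpow_le_rpow h1.le h2 hα
    rw [e m hm0, e n hn0]
    calc (m : ℝ) ^ (ρ - 1) * m * Real.log m ^ α * n
        = (m : ℝ) ^ (ρ - 1) * Real.log m ^ α * (m * n) := by ring
      _ ≤ (n : ℝ) ^ (ρ - 1) * Real.log n ^ α * (m * n) := by gcongr
      _ = _ := by ring
  · intro n hn
    have h0 := hpos n hn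
    rcases Nat.eq_or_lt_of_le hn with rfl | hn'
    · calc powLogWeight ρ α w₁ (2 * 1) = powLogWeight ρ α w₁ 2 / powLogWeight ρ α w₁ 1 *
            powLogWeight ρ α w₁ 1 := by rw [div_mul_cancel₀ _ h0.ne']
        _ ≤ _ := mul_le_mul_of_nonneg_right (le_max_right _ _) h0.le
    · refine le_trans ?_ (mul_le_mul_of_nonneg_right (le_max_left _ _) h0.le)
      rw [hw n (by omega), hw _ (by omega)]
      have hn2 : (2 : ℝ) ≤ n := by exact_mod_cast hn'
      have hl := hlog n (by omega)
      have h1 : Real.log (2 * n : ℕ) ≤ 2 * Real.log n := by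
        have h3 : 2 * Real.log n = Real.log (n ^ 2) := by rw [Real.log_pow]; norm_num
        rw [h3]
        apply Real.log_le_log (by positivity)
        push_cast; nlinarith
      have h3 : 0 ≤ Real.log (2 * n : ℕ) := Real.log_natCast_nonneg _
      calc ((2 * n : ℕ) : ℝ) ^ ρ * Real.log (2 * n : ℕ) ^ α
          ≤ (2 * n) ^ ρ * (2 * Real.log n) ^ α := by
            gcongr
            push_cast; linarith
        _ = _ := by
            rw [Real.mul_rpow (by norm_num) (by linarith), Real.mul_rpow (by norm_num) hl.le]
            ring

namespace TwoEdgeWalk.Graph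

variable {a b : ℕ}

/-- The balance point is `N = k ^ p` with `p = (ρ - 1) / ρ`: since `log N = p * log k`, the product
of the weight formula at `N` with the order of the tail at `k` is the constant `p ^ α`. -/
lemma eventually_prob_powLog (g : Graph) (ha : 1 ≤ a) (hb : 1 ≤ b) {ρ α w₁ : ℝ} (hρ : 1 < ρ)
    (hα : 0 ≤ α) (hw₁ : 0 < w₁) :
    (∃ c > 0, ∀ᶠ k : ℕ in atTop, g.Possible a b (k + 1) →
      c * (1 / ((k : ℝ) ^ (ρ - (ρ - 1) / ρ) * Real.log k ^ α)) ≤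
        g.prob (powLogWeight ρ α w₁) a b (k + 1)) ∧
    ∃ C > 0, ∀ᶠ k : ℕ in atTop, g.prob (powLogWeight ρ α w₁) a b (k + 1) ≤
      C * (1 / ((k : ℝ) ^ (ρ - (ρ - 1) / ρ) * Real.log k ^ α)) := by
  obtain ⟨D, hD⟩ := isRegularWeight_powLog hρ hα hw₁
  obtain ⟨-, C, hC, c, hc, htail⟩ := powLogWeight_tail (w₁ := w₁) hρ hα
  set p := (ρ - 1) / ρ with hp
  have hρ0 : 0 < ρ := by linarith
  have hp0 : 0 < p := div_pos (by linarith) hρ0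
  have hp1 : p < 1 := by rw [hp, div_lt_one hρ0]; linarith
  have hpρ : p * ρ = ρ - 1 := by rw [hp]; field_simp
  have hNtop : Tendsto (fun k : ℕ => (k : ℝ) ^ p) atTop atTop :=
    (tendsto_rpow_atTop hp0).comp tendsto_natCast_atTop_atTop
  have hF : ∀ᶠ k : ℕ in atTop, (k : ℝ) ^ p / powLogWeight ρ α w₁ k =
      1 / ((k : ℝ) ^ (ρ - p) * Real.log k ^ α) := by
    filter_upwards [eventually_ge_atTop 2] with k hk
    have hk0 : (0 : ℝ) < k := by positivity
    rw [powLogWeight, if_neg (by omega), Real.rpow_sub hk0]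
    have : 0 < (k : ℝ) ^ p := by positivity
    field_simp
  have hval : ∀ᶠ k : ℕ in atTop,
      ((k : ℝ) ^ p) ^ ρ * Real.log ((k : ℝ) ^ p) ^ α *
        ((k : ℝ) ^ (1 - ρ) * Real.log k ^ (-α)) = p ^ α := by
    filter_upwards [eventually_ge_atTop 2] with k hk
    have hk0 : (0 : ℝ) < k := by positivity
    have hl : 0 < Real.log k := Real.log_pos (by exact_mod_cast (show 1 < k by omega))
    rw [Real.log_rpow hk0, Real.mul_rpow hp0.le hl.le, ← Real.rpow_mul hk0.le, hpρ,
      Real.rpow_neg hl.le, show 1 - ρ = -(ρ - 1) by ring, Real.rpow_neg hk0.le]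
    have : 0 < (k : ℝ) ^ (ρ - 1) := by positivity
    have : 0 < Real.log k ^ α := by positivity
    field_simp
  constructor
  · obtain ⟨c', hc', h⟩ := g.exists_le_prob_of_regular hD ha hb (C' := C * p ^ α) hNtop (by
      have h1 : Tendsto (fun k : ℕ => (k : ℝ) ^ (1 - p)) atTop atTop :=
        (tendsto_rpow_atTop (by linarith)).comp tendsto_natCast_atTop_atTop
      filter_upwards [h1.eventually_ge_atTop 2, eventually_ge_atTop 1] with k hk hk1
      have hk0 : (0 : ℝ) < k := by positivity
      have e : (k : ℝ) = (k : ℝ) ^ p * (k : ℝ) ^ (1 - p) := by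
        rw [← Real.rpow_add hk0]; simp
      have : 0 < (k : ℝ) ^ p := by positivity
      nlinarith) (by
      filter_upwards [hval, hNtop.eventually_ge_atTop 2, eventually_ge_atTop 3] with k hk hk2 hk3
      have h1 : 2 ≤ ⌊(k : ℝ) ^ p⌋₊ := Nat.le_floor (by exact_mod_cast hk2)
      have h2 : (⌊(k : ℝ) ^ p⌋₊ : ℝ) ≤ (k : ℝ) ^ p := Nat.floor_le (by positivity)
      have h3 : powLogWeight ρ α w₁ ⌊(k : ℝ) ^ p⌋₊ ≤
          ((k : ℝ) ^ p) ^ ρ * Real.log ((k : ℝ) ^ p) ^ α := by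
        rw [powLogWeight, if_neg (by omega)]
        refine monotoneOn_powLog hρ0.le hα ?_ ?_ h2
        · simp only [Set.mem_Ici]; exact_mod_cast (show 1 ≤ ⌊(k : ℝ) ^ p⌋₊ by omega)
        · simp only [Set.mem_Ici]; linarith
      have h4 := hD.pos ⌊(k : ℝ) ^ p⌋₊ (by omega)
      have h5 := hD.tailSum_nonneg (show 1 ≤ k by omega)
      calc _ ≤ ((k : ℝ) ^ p) ^ ρ * Real.log ((k : ℝ) ^ p) ^ α *
            (C * ((k : ℝ) ^ (1 - ρ) * Real.log k ^ (-α))) :=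
            mul_le_mul h3 (htail k hk3).1 h5 (h4.le.trans h3)
        _ = C * p ^ α := by rw [← hk]; ring)
    refine ⟨c', hc', ?_⟩
    filter_upwards [h, hF] with k hk hFk
    rwa [hFk] at hk
  · obtain ⟨C', hC', h⟩ := g.exists_prob_le_of_regular hD ha hb (N := fun k => (k : ℝ) ^ p)
      (c' := c * p ^ α) (by positivity) (hNtop.eventually_ge_atTop 2) (by
      filter_upwards [hval, hNtop.eventually_ge_atTop 2, eventually_ge_atTop 3] with k hk hk2 hk3
      have h2 : (k : ℝ) ^ p ≤ ⌈(k : ℝ) ^ p⌉₊ := Nat.le_ceil _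
      have h1 : 2 ≤ ⌈(k : ℝ) ^ p⌉₊ := by exact_mod_cast hk2.trans h2
      have h3 : ((k : ℝ) ^ p) ^ ρ * Real.log ((k : ℝ) ^ p) ^ α ≤
          powLogWeight ρ α w₁ ⌈(k : ℝ) ^ p⌉₊ := by
        rw [powLogWeight, if_neg (by omega)]
        refine monotoneOn_powLog hρ0.le hα ?_ ?_ h2
        · simp only [Set.mem_Ici]; linarith
        · simp only [Set.mem_Ici]; exact_mod_cast (show 1 ≤ ⌈(k : ℝ) ^ p⌉₊ by omega)
      have h4 := hD.pos ⌈(k : ℝ) ^ p⌉₊ (by omega)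
      have hl : 0 < Real.log k := Real.log_pos (by exact_mod_cast (show 1 < k by omega))
      calc c * p ^ α = ((k : ℝ) ^ p) ^ ρ * Real.log ((k : ℝ) ^ p) ^ α *
            (c * ((k : ℝ) ^ (1 - ρ) * Real.log k ^ (-α))) := by rw [← hk]; ring
        _ ≤ _ := mul_le_mul h3 (htail k hk3).2 (by positivity) h4.le)
    refine ⟨C', hC', ?_⟩
    filter_upwards [h, hF] with k hk hFk
    rwa [hFk] at hk

end TwoEdgeWalk.Graph

/-! ### The weights `n * exp (log ^ α n)`. -/

/-- The weight `n * exp (log ^ α n)`. -/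
noncomputable def mulExpLogWeight (α : ℝ) (n : ℕ) : ℝ := n * Real.exp (Real.log n ^ α)

/-- The logarithm of the typical final count of the losing edge, as a function of the logarithm `L`
of the time. -/
noncomputable def loserLog (α β L : ℝ) : ℝ :=
  L ^ α - (1 - α) * Real.log L - L ^ (α ^ 2) + β * L ^ (2 * α ^ 2 - α)

/-- Write `(1 - y) ^ α = (1 - y) / (1 - y) ^ (1 - α)` and apply Bernoulli's inequality to the
denominator. The remainder carries `1 / (1 - (1 - α) * y)`, which is at most `4 / 3`. -/
lemma one_sub_rpow_ge {α y : ℝ} (hα0 : 0 ≤ α) (hα1 : α ≤ 1) (hy0 : 0 ≤ y) (hy1 : y ≤ 1 / 4) :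
    1 - α * y - 4 / 3 * (α * (1 - α)) * y ^ 2 ≤ (1 - y) ^ α := by
  have h1 : (1 - y) ^ (1 - α) ≤ 1 - (1 - α) * y := by
    have := rpow_one_add_le_one_add_mul_self (s := -y) (by linarith) (p := 1 - α) (by linarith)
      (by linarith)
    rw [← sub_eq_add_neg] at this
    linarith
  have h2 : (1 - y) ^ α * (1 - y) ^ (1 - α) = 1 - y := by
    rw [← Real.rpow_add (by linarith)]; simp
  have h3 : 0 ≤ (1 - y) ^ α := by apply Real.rpow_nonneg; linarith
  have h4 : 1 - y ≤ (1 - y) ^ α * (1 - (1 - α) * y) := by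
    calc 1 - y = (1 - y) ^ α * (1 - y) ^ (1 - α) := h2.symm
      _ ≤ _ := mul_le_mul_of_nonneg_left h1 h3
  have h5 : (1 - α) * y ≤ 1 / 4 := by nlinarith
  have h6 : 0 < 1 - (1 - α) * y := by linarith
  refine le_of_mul_le_mul_right (le_trans ?_ h4) h6
  have h7 : 0 ≤ α * (1 - α) * y ^ 2 :=
    mul_nonneg (mul_nonneg hα0 (by linarith)) (sq_nonneg y)
  have h8 : α * (1 - α) * y ^ 2 * ((1 - α) * y) ≤ α * (1 - α) * y ^ 2 * (1 / 4) := by gcongr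
  nlinarith

section Asymptotics

variable {α : ℝ}

lemma tendsto_rpow_sq_sub (h0 : 0 < α) (h1 : α < 1) :
    Tendsto (fun L : ℝ => L ^ (α ^ 2 - α)) atTop (𝓝 0) := by
  have := tendsto_rpow_neg_atTop (show 0 < α - α ^ 2 by nlinarith)
  simpa using this

lemma tendsto_rpow_neg_mul_log {p : ℝ} (hp : 0 < p) :
    Tendsto (fun L : ℝ => L ^ (-p) * Real.log L) atTop (𝓝 0) := by
  refine (isLittleO_log_rpow_atTop hp).tendsto_div_nhds_zero.congr' ?_
  filter_upwards [eventually_gt_atTop 0] with L hL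
  rw [Real.rpow_neg hL.le]
  field_simp

/-- Exhibits the value as `L ^ α * (1 - y)` with `y → 0`, the form in which its power `α` can be
expanded. -/
lemma loserLog_eq {β L : ℝ} (hL : 0 < L) :
    loserLog α β L = L ^ α * (1 - (L ^ (α ^ 2 - α) + (1 - α) * (L ^ (-α) * Real.log L) -
      β * (L ^ (α ^ 2 - α)) ^ 2)) := by
  have e1 : L ^ (α ^ 2) = L ^ α * L ^ (α ^ 2 - α) := by
    rw [← Real.rpow_add hL]; congr 1; ring
  have e2 : L ^ (2 * α ^ 2 - α) = L ^ α * (L ^ (α ^ 2 - α)) ^ 2 := by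
    rw [sq (L ^ (α ^ 2 - α)), ← Real.rpow_add hL, ← Real.rpow_add hL]; congr 1; ring
  have e3 : L ^ α * L ^ (-α) = 1 := by rw [← Real.rpow_add hL]; simp
  rw [loserLog, e1, e2]
  linear_combination (1 - α) * Real.log L * e3

lemma tendsto_loserLog_correction (h0 : 0 < α) (h1 : α < 1) (β : ℝ) :
    Tendsto (fun L : ℝ => L ^ (α ^ 2 - α) + (1 - α) * (L ^ (-α) * Real.log L) -
      β * (L ^ (α ^ 2 - α)) ^ 2) atTop (𝓝 0) := by
  have hz := tendsto_rpow_sq_sub h0 h1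
  have ht := tendsto_rpow_neg_mul_log h0
  simpa using (hz.add (ht.const_mul (1 - α))).sub ((hz.pow 2).const_mul β)

lemma tendsto_loserLog (h0 : 0 < α) (h1 : α < 1) (β : ℝ) :
    Tendsto (loserLog α β) atTop atTop := by
  refine tendsto_atTop_mono' _ ?_ ((tendsto_rpow_atTop h0).atTop_mul_const (r := 1 / 2) (by norm_num))
  filter_upwards [(tendsto_loserLog_correction h0 h1 β).eventually_le_const
    (show (0 : ℝ) < 1 / 2 by norm_num), eventually_gt_atTop 0] with L h hL
  rw [loserLog_eq hL]
  have : 0 < L ^ α := by positivity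
  gcongr
  linarith

lemma eventually_loserLog_le (h0 : 0 < α) (h1 : α < 1) (β : ℝ) :
    ∀ᶠ L in atTop, loserLog α β L ≤ L - Real.log 2 := by
  filter_upwards [(tendsto_loserLog_correction h0 h1 β).eventually_const_le
    (show (-1 : ℝ) < 0 by norm_num), eventually_ge_atTop 2,
    (tendsto_rpow_atTop (show 0 < 1 - α by linarith)).eventually_ge_atTop 4] with L h hL h4
  have hL0 : 0 < L := by linarith
  rw [loserLog_eq hL0]
  have h5 : 0 < L ^ α := by positivity
  have h6 : L = L ^ α * L ^ (1 - α) := by rw [← Real.rpow_add hL0]; simp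
  have h7 : L ^ α * 4 ≤ L := by
    nth_rewrite 2 [h6]
    gcongr
  have h8 : L ^ α * (1 - (L ^ (α ^ 2 - α) + (1 - α) * (L ^ (-α) * Real.log L) -
      β * (L ^ (α ^ 2 - α)) ^ 2)) ≤ L ^ α * 2 := by
    gcongr; linarith
  have := Real.log_two_lt_d9
  linarith

/-- The defect in the equation that determines the final count of the losing edge. -/
lemma loserLog_rpow_eq {β L : ℝ} (hL : 0 < L) (hy : L ^ (α ^ 2 - α) +
      (1 - α) * (L ^ (-α) * Real.log L) - β * (L ^ (α ^ 2 - α)) ^ 2 ≤ 1) :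
    loserLog α β L ^ α - L ^ (α ^ 2) + β * L ^ (2 * α ^ 2 - α) =
      L ^ (α ^ 2) * ((1 - (L ^ (α ^ 2 - α) + (1 - α) * (L ^ (-α) * Real.log L) -
        β * (L ^ (α ^ 2 - α)) ^ 2)) ^ α - 1 + β * L ^ (α ^ 2 - α)) := by
  rw [loserLog_eq hL, Real.mul_rpow (by positivity) (by linarith), ← Real.rpow_mul hL.le]
  have e2 : L ^ (2 * α ^ 2 - α) = L ^ (α ^ 2) * L ^ (α ^ 2 - α) := by
    rw [← Real.rpow_add hL]; congr 1; ring
  rw [e2, show α * α = α ^ 2 by ring]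
  ring

/-- Bernoulli's inequality for `(1 - y) ^ α`. If `β = α` the leading term cancels and a multiple of
`L ^ (3 * α ^ 2 - 2 * α)` remains, which is bounded when `α ≤ 2 / 3`; if `β < α` the leading term is
negative and dominates. Hence the two cases of the lower bound. -/
lemma eventually_loserLog_defect_le (h0 : 0 < α) (h1 : α < 1) (β : ℝ) :
    ∀ᶠ L : ℝ in atTop, loserLog α β L ^ α - L ^ (α ^ 2) + β * L ^ (2 * α ^ 2 - α) ≤
      L ^ (α ^ 2) * L ^ (α ^ 2 - α) * (β - α + α * β * L ^ (α ^ 2 - α)) := by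
  filter_upwards [(tendsto_loserLog_correction h0 h1 β).eventually_le_const
    (show (0 : ℝ) < 1 by norm_num), eventually_ge_atTop 1] with L h hL
  have hL0 : 0 < L := by linarith
  rw [loserLog_rpow_eq hL0 h]
  set z := L ^ (α ^ 2 - α)
  have ht : 0 ≤ L ^ (-α) * Real.log L := mul_nonneg (by positivity) (Real.log_nonneg hL)
  set t := L ^ (-α) * Real.log L
  have hB := rpow_one_add_le_one_add_mul_self (s := -(z + (1 - α) * t - β * z ^ 2)) (by linarith)
    h0.le h1.le
  rw [← sub_eq_add_neg] at hB
  rw [mul_assoc]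
  apply mul_le_mul_of_nonneg_left _ (by positivity)
  have : 0 ≤ α * ((1 - α) * t) := mul_nonneg h0.le (mul_nonneg (by linarith) ht)
  nlinarith

lemma eventually_loserLog_defect_le_of_le (h0 : 0 < α) (h1 : α < 1) (hα : α ≤ 2 / 3) :
    ∀ᶠ L : ℝ in atTop, loserLog α α L ^ α - L ^ (α ^ 2) + α * L ^ (2 * α ^ 2 - α) ≤ 1 := by
  filter_upwards [eventually_loserLog_defect_le h0 h1 α, eventually_ge_atTop 1] with L h hL
  have hL0 : 0 < L := by linarith
  refine h.trans ?_
  have e : L ^ (α ^ 2) * L ^ (α ^ 2 - α) * L ^ (α ^ 2 - α) ≤ 1 := by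
    rw [← Real.rpow_add hL0, ← Real.rpow_add hL0]
    apply Real.rpow_le_one_of_one_le_of_nonpos hL
    nlinarith
  have h2 : 0 ≤ L ^ (α ^ 2) * L ^ (α ^ 2 - α) * L ^ (α ^ 2 - α) := by positivity
  have h3 : α * α ≤ 1 := by nlinarith
  calc _ = α * α * (L ^ (α ^ 2) * L ^ (α ^ 2 - α) * L ^ (α ^ 2 - α)) := by ring
    _ ≤ 1 * 1 := by gcongr
    _ = 1 := one_mul 1

lemma eventually_loserLog_defect_le_of_lt (h0 : 0 < α) (h1 : α < 1) {β : ℝ} (hβ : β < α) :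
    ∀ᶠ L : ℝ in atTop, loserLog α β L ^ α - L ^ (α ^ 2) + β * L ^ (2 * α ^ 2 - α) ≤ 1 := by
  have hz : Tendsto (fun L : ℝ => β - α + α * β * L ^ (α ^ 2 - α)) atTop (𝓝 (β - α)) := by
    simpa using ((tendsto_rpow_sq_sub h0 h1).const_mul (α * β)).const_add (β - α)
  filter_upwards [eventually_loserLog_defect_le h0 h1 β, eventually_ge_atTop 1,
    hz.eventually_le_const (show β - α < 0 by linarith)] with L h hL h2
  have hL0 : 0 < L := by linarith
  refine h.trans (le_trans ?_ zero_le_one)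
  exact mul_nonpos_of_nonneg_of_nonpos (by positivity) h2

/-- With `β = α` the lower estimate needs no restriction on `α`. The coefficient of the second-order
term is `α * (3 * α - 2)`: for `α > 2 / 3` it is positive and the term can be dropped, otherwise the
term itself is bounded. -/
lemma eventually_le_loserLog_defect (h0 : 0 < α) (h1 : α < 1) :
    ∀ᶠ L : ℝ in atTop, -4 ≤ loserLog α α L ^ α - L ^ (α ^ 2) + α * L ^ (2 * α ^ 2 - α) := by
  have hs : Tendsto (fun L : ℝ => L ^ (α ^ 2) * (L ^ (-α) * Real.log L)) atTop (𝓝 0) := by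
    refine (tendsto_rpow_neg_mul_log (show 0 < α - α ^ 2 by nlinarith)).congr' ?_
    filter_upwards [eventually_gt_atTop 0] with L hL
    rw [← mul_assoc, ← Real.rpow_add hL]
    congr 2; ring
  filter_upwards [(tendsto_loserLog_correction h0 h1 α).eventually_le_const
      (show (0 : ℝ) < 1 / 4 by norm_num), eventually_ge_atTop 1,
    (tendsto_rpow_sq_sub h0 h1).eventually_le_const (show (0 : ℝ) < 1 by norm_num),
    hs.eventually_le_const (show (0 : ℝ) < 1 / 4 by norm_num),
    (tendsto_rpow_neg_mul_log h0).eventually_le_const (show (0 : ℝ) < 1 by norm_num)]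
    with L h hL hz hs' ht'
  have hL0 : 0 < L := by linarith
  rw [loserLog_rpow_eq hL0 (by linarith)]
  have hA : 0 < L ^ (α ^ 2) := by positivity
  have hz0 : 0 < L ^ (α ^ 2 - α) := by positivity
  have e : 2 / 3 < α ∨ L ^ (α ^ 2) * (L ^ (α ^ 2 - α)) ^ 2 ≤ 1 := by
    rcases lt_or_ge (2 / 3) α with h2 | h2
    · exact Or.inl h2
    · right
      rw [sq (L ^ (α ^ 2 - α)), ← Real.rpow_add hL0, ← Real.rpow_add hL0]
      apply Real.rpow_le_one_of_one_le_of_nonpos hL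
      nlinarith
  have ht : 0 ≤ L ^ (-α) * Real.log L := mul_nonneg (by positivity) (Real.log_nonneg hL)
  set z := L ^ (α ^ 2 - α)
  set t := L ^ (-α) * Real.log L
  set A := L ^ (α ^ 2)
  set y := z + (1 - α) * t - α * z ^ 2 with hy
  have hα1 : 0 < 1 - α := by linarith
  have hzz : z ^ 2 ≤ z := by nlinarith
  have hy0 : 0 ≤ y := by
    have : α * z ^ 2 ≤ 1 * z := mul_le_mul h1.le hzz (by positivity) zero_le_one
    have : 0 ≤ (1 - α) * t := by positivity
    linarith
  have hyle : y ≤ z + t := by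
    have : (1 - α) * t ≤ 1 * t := by gcongr; linarith
    have : 0 ≤ α * z ^ 2 := by positivity
    linarith
  -- The weight `3 / 2` on `z ^ 2` cancels the `4 / 3` above to give `2`, which puts the change of
  -- sign in the coefficient exactly at `α = 2 / 3`.
  have hysq : y ^ 2 ≤ 3 / 2 * z ^ 2 + 3 * t ^ 2 := by
    have : y ^ 2 ≤ (z + t) ^ 2 := by gcongr
    nlinarith [sq_nonneg (z - 2 * t)]
  have hB := one_sub_rpow_ge h0.le h1.le hy0 h
  have hαα : 0 ≤ α * (1 - α) := by positivity
  have hαα1 : α * (1 - α) ≤ 1 := by nlinarith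
  have h3 : -(α * (1 - α)) * t + (α ^ 2 - 2 * (α * (1 - α))) * z ^ 2 - 4 * t ^ 2 ≤
      (1 - y) ^ α - 1 + α * z := by
    have h4 : 4 / 3 * (α * (1 - α)) * y ^ 2 ≤
        4 / 3 * (α * (1 - α)) * (3 / 2 * z ^ 2 + 3 * t ^ 2) := by gcongr
    have h5 : α * (1 - α) * t ^ 2 ≤ 1 * t ^ 2 := by gcongr
    have h6 : α * y = α * z + α * (1 - α) * t - α ^ 2 * z ^ 2 := by rw [hy]; ring
    linarith
  refine le_trans ?_ (mul_le_mul_of_nonneg_left h3 hA.le)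
  have h7 : α * (1 - α) * (A * t) ≤ 1 * (1 / 4) :=
    mul_le_mul hαα1 hs' (by positivity) zero_le_one
  have h8 : A * t * t ≤ 1 / 4 * 1 := mul_le_mul hs' ht' ht (by norm_num)
  have h9 : -2 ≤ (α ^ 2 - 2 * (α * (1 - α))) * (A * z ^ 2) := by
    rcases e with h10 | h10
    · have : 0 ≤ α ^ 2 - 2 * (α * (1 - α)) := by nlinarith
      have : 0 ≤ (α ^ 2 - 2 * (α * (1 - α))) * (A * z ^ 2) := by positivity
      linarith
    · have h11 : 0 ≤ A * z ^ 2 := by positivity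
      have h12 : α * (1 - α) * (A * z ^ 2) ≤ 1 * 1 := by gcongr
      have : 0 ≤ α ^ 2 * (A * z ^ 2) := by positivity
      linarith
  calc (-4 : ℝ) ≤ -(α * (1 - α) * (A * t)) + (α ^ 2 - 2 * (α * (1 - α))) * (A * z ^ 2) -
        4 * (A * t * t) := by linarith
    _ = _ := by ring

end Asymptotics

lemma monotoneOn_mulExpLog {α : ℝ} (hα : 0 ≤ α) :
    MonotoneOn (fun x : ℝ => x * Real.exp (Real.log x ^ α)) (Set.Ici 1) := by
  intro x hx y hy hxy
  simp only [Set.mem_Ici] at hx hy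
  have h1 := Real.log_nonneg hx
  have h2 : Real.log x ≤ Real.log y := Real.log_le_log (by linarith) hxy
  have h3 : 0 ≤ x := by linarith
  change x * Real.exp (Real.log x ^ α) ≤ y * Real.exp (Real.log y ^ α)
  gcongr

/-- Subadditivity of `x ↦ x ^ α`, applied to `log 2 + log n`. -/
lemma mulExpLogWeight_double {α : ℝ} (h0 : 0 ≤ α) (h1 : α ≤ 1) {n : ℕ} (hn : 1 ≤ n) :
    mulExpLogWeight α (2 * n) ≤ 2 * Real.exp (Real.log 2 ^ α) * mulExpLogWeight α n := by
  have hn0 : (0 : ℝ) < n := by exact_mod_cast hn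
  unfold mulExpLogWeight
  have h2 : Real.log (2 * n : ℕ) ^ α ≤ Real.log 2 ^ α + Real.log n ^ α := by
    rw [Nat.cast_mul, Nat.cast_ofNat, Real.log_mul (by norm_num) hn0.ne']
    exact Real.rpow_add_le_add_rpow (Real.log_nonneg (by norm_num)) (Real.log_natCast_nonneg n)
      h0 h1
  calc ((2 * n : ℕ) : ℝ) * Real.exp (Real.log (2 * n : ℕ) ^ α)
      ≤ (2 * n) * Real.exp (Real.log 2 ^ α + Real.log n ^ α) := by
        push_cast
        push_cast at h2
        gcongr
    _ = _ := by rw [Real.exp_add]; ring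

/-- Differentiating the proposed tail gives the reciprocal weight times `-(α - (1 - α) / log ^ α
x)`; `X` is taken so large that the correction is at most `α / 2`. -/
lemma mulExpLogWeight_tail {α : ℝ} (h0 : 0 < α) (h1 : α < 1) :
    Summable (fun n => 1 / mulExpLogWeight α n) ∧ ∃ C > 0, ∃ c > 0, ∀ᶠ n : ℕ in atTop,
      tailSum (mulExpLogWeight α) n ≤
        C * (Real.log n ^ (1 - α) * Real.exp (-Real.log n ^ α)) ∧
      c * (Real.log n ^ (1 - α) * Real.exp (-Real.log n ^ α)) ≤
        tailSum (mulExpLogWeight α) n := by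
  obtain ⟨X, hX⟩ := eventually_atTop.1
    ((((tendsto_rpow_atTop h0).comp Real.tendsto_log_atTop).eventually_ge_atTop
      (2 * (1 - α) / α)))
  have hX' : ∀ x, ((⌈X⌉₊ + 3 : ℕ) : ℝ) ≤ x → 3 ≤ x ∧ 1 ≤ Real.log x ∧
      0 ≤ (1 - α) * (Real.log x ^ α)⁻¹ ∧ (1 - α) * (Real.log x ^ α)⁻¹ ≤ α / 2 := by
    intro x hx
    push_cast at hx
    have h2 := Nat.le_ceil X
    have h2' : (0 : ℝ) ≤ ⌈X⌉₊ := Nat.cast_nonneg _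
    have h3 : 2 * (1 - α) / α ≤ Real.log x ^ α := hX x (by linarith)
    have h4 : 3 ≤ x := by linarith
    have h5 : 1 ≤ Real.log x := by
      rw [Real.le_log_iff_exp_le (by linarith)]
      have := Real.exp_one_lt_d9
      linarith
    have h6 : 0 < 1 - α := by linarith
    have h7 : 0 < Real.log x ^ α := by positivity
    refine ⟨h4, h5, by positivity, ?_⟩
    rw [div_le_iff₀ h0] at h3
    rw [← div_eq_mul_inv, div_le_iff₀ h7]
    linarith
  have key := tailSum_bounds_of_hasDerivAt (w := mulExpLogWeight α)
    (f := fun x => x * Real.exp (Real.log x ^ α))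
    (H := fun x => Real.log x ^ (1 - α) * Real.exp (-Real.log x ^ α))
    (h := fun x => (α - (1 - α) * (Real.log x ^ α)⁻¹) / (x * Real.exp (Real.log x ^ α)))
    (n₀ := ⌈X⌉₊ + 3) (c := α / 2) (C := α) (D := 2 * Real.exp (Real.log 2 ^ α)) (by linarith)
    h0 (by positivity) (fun n _ => rfl)
    (fun x hx => by
      have := (hX' x hx).1
      positivity)
    ((monotoneOn_mulExpLog h0.le).mono (Set.Ici_subset_Ici.2 (by
      push_cast; have : (0 : ℝ) ≤ ⌈X⌉₊ := Nat.cast_nonneg _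
      linarith)))
    (fun n hn => by
      refine le_trans ?_ (mulExpLogWeight_double h0.le h1.le (show 1 ≤ n by omega))
      refine monotoneOn_mulExpLog h0.le ?_ ?_ ?_
      · simp only [Set.mem_Ici]; exact_mod_cast (show 1 ≤ n + 1 by omega)
      · simp only [Set.mem_Ici]; exact_mod_cast (show 1 ≤ 2 * n by omega)
      · exact_mod_cast (show n + 1 ≤ 2 * n by omega))
    (fun x hx => by
      obtain ⟨hx3, hl, -, -⟩ := hX' x hx
      have hx0 : 0 < x := by linarith
      have hl0 : 0 < Real.log x := by linarith
      have hd := Real.hasDerivAt_log hx0.ne'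
      have h2 := (hd.rpow_const (p := 1 - α) (Or.inl hl0.ne')).mul
        ((hd.rpow_const (p := α) (Or.inl hl0.ne')).neg.exp)
      refine h2.congr_deriv ?_
      have e1 : Real.log x ^ (1 - α - 1) = (Real.log x ^ α)⁻¹ := by
        rw [← Real.rpow_neg hl0.le]; congr 1; ring
      have e2 : Real.log x ^ (1 - α) = Real.log x * (Real.log x ^ α)⁻¹ := by
        rw [sub_eq_add_neg, Real.rpow_add hl0, Real.rpow_one, Real.rpow_neg hl0.le]
      have e3 : Real.log x ^ (α - 1) = Real.log x ^ α * (Real.log x)⁻¹ := by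
        rw [sub_eq_add_neg, Real.rpow_add hl0, Real.rpow_neg_one]
      have h3 : 0 < Real.log x ^ α := by positivity
      simp only [Pi.neg_apply]
      rw [e1, e2, e3, Real.exp_neg]
      have h4 := Real.exp_pos (Real.log x ^ α)
      field_simp
      ring)
    (fun x hx => by
      obtain ⟨hx3, hl, -, h2⟩ := hX' x hx
      have hx0 : 0 < x := by linarith
      gcongr
      linarith)
    (fun x hx => by
      obtain ⟨hx3, hl, h2, -⟩ := hX' x hx
      have hx0 : 0 < x := by linarith
      gcongr
      linarith)
    (by
      have h2 := (tendsto_rpow_mul_exp_neg_mul_atTop_nhds_zero ((1 - α) / α) 1 one_pos).comp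
        ((tendsto_rpow_atTop h0).comp (Real.tendsto_log_atTop.comp tendsto_natCast_atTop_atTop))
      refine h2.congr' ?_
      filter_upwards [eventually_ge_atTop 1] with n hn
      have hl : 0 ≤ Real.log n := Real.log_natCast_nonneg n
      simp only [Function.comp_apply]
      rw [← Real.rpow_mul hl, mul_div_cancel₀ _ h0.ne', neg_mul, one_mul])
  refine ⟨key.1, 2 * Real.exp (Real.log 2 ^ α) / (α / 2), by positivity, 1 / α,
    one_div_pos.2 h0, ?_⟩
  filter_upwards [eventually_ge_atTop (⌈X⌉₊ + 3)] with n hn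
  exact key.2 n hn

lemma isRegularWeight_mulExpLog {α : ℝ} (h0 : 0 < α) (h1 : α < 1) :
    IsRegularWeight (mulExpLogWeight α) (2 * Real.exp (Real.log 2 ^ α)) := by
  refine IsRegularWeight.of_superlinear (fun n hn => ?_) (fun m n hm hmn => ?_)
    (fun n hn => mulExpLogWeight_double h0.le h1.le hn) (mulExpLogWeight_tail h0 h1).1
  · have : (0 : ℝ) < n := by exact_mod_cast hn
    unfold mulExpLogWeight
    positivity
  · unfold mulExpLogWeight
    have hm0 : (0 : ℝ) < m := by exact_mod_cast (show 0 < m by omega)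
    have hmn' : (m : ℝ) ≤ n := by exact_mod_cast hmn
    have h2 : Real.log m ≤ Real.log n := Real.log_le_log hm0 hmn'
    have h3 : 0 ≤ Real.log m := Real.log_natCast_nonneg m
    calc (m : ℝ) * Real.exp (Real.log m ^ α) * n = (m * n) * Real.exp (Real.log m ^ α) := by ring
      _ ≤ (m * n) * Real.exp (Real.log n ^ α) := by gcongr
      _ = _ := by ring

namespace TwoEdgeWalk.Graph

variable {a b : ℕ} {α : ℝ}

lemma exp_loserLog_div {β : ℝ} {k : ℕ} (hk : 2 ≤ k) :
    Real.exp (loserLog α β (Real.log k)) / mulExpLogWeight α k =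
      1 / ((k : ℝ) * Real.log k ^ (1 - α) *
        Real.exp (Real.log k ^ (α ^ 2) - β * Real.log k ^ (2 * α ^ 2 - α))) := by
  have hk0 : (0 : ℝ) < k := by exact_mod_cast (show 0 < k by omega)
  have hl : 0 < Real.log k := Real.log_pos (by exact_mod_cast (show 1 < k by omega))
  have e1 : Real.log k ^ (1 - α) = Real.exp ((1 - α) * Real.log (Real.log k)) := by
    rw [Real.rpow_def_of_pos hl, mul_comm]
  rw [mulExpLogWeight, e1, div_eq_div_iff (by positivity) (by positivity), one_mul]
  rw [show Real.exp (loserLog α β (Real.log k)) * ((k : ℝ) *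
      Real.exp ((1 - α) * Real.log (Real.log k)) *
      Real.exp (Real.log k ^ (α ^ 2) - β * Real.log k ^ (2 * α ^ 2 - α))) = k *
      (Real.exp (loserLog α β (Real.log k)) * Real.exp ((1 - α) * Real.log (Real.log k)) *
      Real.exp (Real.log k ^ (α ^ 2) - β * Real.log k ^ (2 * α ^ 2 - α))) by ring,
    ← Real.exp_add, ← Real.exp_add]
  congr 2
  rw [loserLog]; ring

/-- For `N = exp (loserLog α β (log k))` the left side is, up to constants, `w N * tailSum w k`. The
balance equation thus holds up to a bounded factor when the defect is bounded. -/
lemma exp_loserLog_mul {β : ℝ} {k : ℕ} (hk : 2 ≤ k) :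
    Real.exp (loserLog α β (Real.log k)) * Real.exp (loserLog α β (Real.log k) ^ α) *
      (Real.log k ^ (1 - α) * Real.exp (-Real.log k ^ α)) =
    Real.exp (loserLog α β (Real.log k) ^ α - Real.log k ^ (α ^ 2) +
      β * Real.log k ^ (2 * α ^ 2 - α)) := by
  have hl : 0 < Real.log k := Real.log_pos (by exact_mod_cast (show 1 < k by omega))
  have e1 : Real.log k ^ (1 - α) = Real.exp ((1 - α) * Real.log (Real.log k)) := by
    rw [Real.rpow_def_of_pos hl, mul_comm]
  rw [e1, ← Real.exp_add, ← Real.exp_add, ← Real.exp_add]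
  congr 1
  nth_rewrite 1 [loserLog]
  ring

lemma tendsto_log_natCast : Tendsto (fun k : ℕ => Real.log k) atTop atTop :=
  Real.tendsto_log_atTop.comp tendsto_natCast_atTop_atTop

lemma eventually_le_prob_mulExpLog (g : Graph) (ha : 1 ≤ a) (hb : 1 ≤ b) (h0 : 0 < α)
    (h1 : α < 1) {β : ℝ} (hβ : ∀ᶠ L : ℝ in atTop,
      loserLog α β L ^ α - L ^ (α ^ 2) + β * L ^ (2 * α ^ 2 - α) ≤ 1) :
    ∃ c > 0, ∀ᶠ k : ℕ in atTop, g.Possible a b (k + 1) →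
      c * (1 / ((k : ℝ) * Real.log k ^ (1 - α) *
        Real.exp (Real.log k ^ (α ^ 2) - β * Real.log k ^ (2 * α ^ 2 - α)))) ≤
      g.prob (mulExpLogWeight α) a b (k + 1) := by
  have hreg := isRegularWeight_mulExpLog h0 h1
  obtain ⟨-, C, hC, c₁, -, htail⟩ := mulExpLogWeight_tail h0 h1
  have hNtop : Tendsto (fun k : ℕ => Real.exp (loserLog α β (Real.log k))) atTop atTop :=
    Real.tendsto_exp_atTop.comp ((tendsto_loserLog h0 h1 β).comp tendsto_log_natCast)
  obtain ⟨c, hc, h⟩ := g.exists_le_prob_of_regular hreg ha hb (C' := C * Real.exp 1) hNtop (by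
    filter_upwards [tendsto_log_natCast.eventually (eventually_loserLog_le h0 h1 β),
      eventually_ge_atTop 1] with k hk hk1
    have hk0 : (0 : ℝ) < k := by exact_mod_cast hk1
    have := Real.exp_le_exp.2 hk
    rwa [Real.exp_sub, Real.exp_log hk0, Real.exp_log two_pos] at this) (by
    filter_upwards [tendsto_log_natCast.eventually hβ, htail, eventually_ge_atTop 2,
      hNtop.eventually_ge_atTop 1] with k hk htk hk2 hN1
    set N := Real.exp (loserLog α β (Real.log k)) with hN
    have h2 : mulExpLogWeight α ⌊N⌋₊ ≤ N * Real.exp (loserLog α β (Real.log k) ^ α) := by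
      have h3 := monotoneOn_mulExpLog h0.le (a := (⌊N⌋₊ : ℝ)) (b := N)
        (by simp only [Set.mem_Ici]; exact_mod_cast Nat.le_floor (by exact_mod_cast hN1))
        hN1 (Nat.floor_le (by linarith))
      simp only [hN, Real.log_exp] at h3
      exact h3
    have h4 := hreg.tailSum_nonneg (show 1 ≤ k by omega)
    calc _ ≤ N * Real.exp (loserLog α β (Real.log k) ^ α) *
          (C * (Real.log k ^ (1 - α) * Real.exp (-Real.log k ^ α))) :=
          mul_le_mul h2 htk.1 h4 (by positivity)
      _ = C * (N * Real.exp (loserLog α β (Real.log k) ^ α) *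
          (Real.log k ^ (1 - α) * Real.exp (-Real.log k ^ α))) := by ring
      _ ≤ C * Real.exp 1 := by
          rw [hN, exp_loserLog_mul hk2]
          gcongr)
  refine ⟨c, hc, ?_⟩
  filter_upwards [h, eventually_ge_atTop 2] with k hk hk2
  rwa [exp_loserLog_div hk2] at hk

lemma eventually_prob_mulExpLog_le (g : Graph) (ha : 1 ≤ a) (hb : 1 ≤ b) (h0 : 0 < α)
    (h1 : α < 1) :
    ∃ C > 0, ∀ᶠ k : ℕ in atTop, g.prob (mulExpLogWeight α) a b (k + 1) ≤
      C * (1 / ((k : ℝ) * Real.log k ^ (1 - α) *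
        Real.exp (Real.log k ^ (α ^ 2) - α * Real.log k ^ (2 * α ^ 2 - α)))) := by
  have hreg := isRegularWeight_mulExpLog h0 h1
  obtain ⟨-, C₁, -, c, hc, htail⟩ := mulExpLogWeight_tail h0 h1
  have hNtop : Tendsto (fun k : ℕ => Real.exp (loserLog α α (Real.log k))) atTop atTop :=
    Real.tendsto_exp_atTop.comp ((tendsto_loserLog h0 h1 α).comp tendsto_log_natCast)
  obtain ⟨C, hC, h⟩ := g.exists_prob_le_of_regular hreg ha hb
    (N := fun k => Real.exp (loserLog α α (Real.log k))) (c' := c * Real.exp (-4))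
    (by positivity) (hNtop.eventually_ge_atTop 2) (by
    filter_upwards [tendsto_log_natCast.eventually (eventually_le_loserLog_defect h0 h1), htail,
      eventually_ge_atTop 2, hNtop.eventually_ge_atTop 1] with k hk htk hk2 hN1
    set N := Real.exp (loserLog α α (Real.log k)) with hN
    have hle := Nat.le_ceil N
    have h2 : N * Real.exp (loserLog α α (Real.log k) ^ α) ≤ mulExpLogWeight α ⌈N⌉₊ := by
      have h3 := monotoneOn_mulExpLog h0.le (a := N) (b := (⌈N⌉₊ : ℝ)) hN1
        (by simp only [Set.mem_Ici]; linarith) hle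
      simp only [hN, Real.log_exp] at h3
      exact h3
    have hl : 0 < Real.log k := Real.log_pos (by exact_mod_cast (show 1 < k by omega))
    calc c * Real.exp (-4) ≤ c * (N * Real.exp (loserLog α α (Real.log k) ^ α) *
          (Real.log k ^ (1 - α) * Real.exp (-Real.log k ^ α))) := by
          rw [hN, exp_loserLog_mul hk2]
          gcongr
      _ = N * Real.exp (loserLog α α (Real.log k) ^ α) *
          (c * (Real.log k ^ (1 - α) * Real.exp (-Real.log k ^ α))) := by ring
      _ ≤ _ := mul_le_mul h2 htk.2 (by positivity) (le_trans (by positivity) h2))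
  refine ⟨C, hC, ?_⟩
  filter_upwards [h, eventually_ge_atTop 2] with k hk hk2
  rwa [exp_loserLog_div hk2] at hk

end TwoEdgeWalk.Graph

/-! ### The weights `exp (α * n ^ ε)`. -/

/-- The weight `exp (α * n ^ ε)`. -/
noncomputable def stretchedExpWeight (α ε : ℝ) (n : ℕ) : ℝ := Real.exp (α * (n : ℝ) ^ ε)

/-- The typical final count of the losing edge at time `k` for the weight `exp (α * n ^ ε)`. -/
noncomputable def loserCount (α ε k : ℝ) : ℝ :=
  k / 2 - (1 - ε) / (α * ε * 2 ^ (2 - ε)) * k ^ (1 - ε) * Real.log k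

lemma rpow_le_tangent {ε x y : ℝ} (h0 : 0 ≤ ε) (h1 : ε ≤ 1) (hx : 0 < x) (hy : 0 ≤ y) :
    y ^ ε ≤ x ^ ε + ε * x ^ (ε - 1) * (y - x) := by
  have h2 := rpow_one_add_le_one_add_mul_self (s := (y - x) / x)
    (by rw [le_div_iff₀ hx]; linarith) h0 h1
  have e1 : y = x * (1 + (y - x) / x) := by field_simp; ring
  have h3 : 0 ≤ 1 + (y - x) / x := by
    have : 1 + (y - x) / x = y / x := by field_simp; ring
    rw [this]; positivity
  calc y ^ ε = x ^ ε * (1 + (y - x) / x) ^ ε := by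
        conv_lhs => rw [e1]
        rw [Real.mul_rpow hx.le h3]
    _ ≤ x ^ ε * (1 + ε * ((y - x) / x)) := by gcongr
    _ = _ := by
        rw [Real.rpow_sub_one hx.ne']
        field_simp

/-- Concavity, through the tangents at `x` and at `x * (1 ± y)`: the difference is the first-order
term up to a relative error of order `y`. -/
lemma rpow_sub_rpow_bounds {ε x y : ℝ} (h0 : 0 ≤ ε) (h1 : ε ≤ 1) (hx0 : 0 < x) (hy0 : 0 ≤ y)
    (h2 : y ≤ 1 / 2) :
    ε * x ^ (ε - 1) * (x * y) * (2 - y) ≤ (x * (1 + y)) ^ ε - (x * (1 - y)) ^ ε ∧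
      (x * (1 + y)) ^ ε - (x * (1 - y)) ^ ε ≤ ε * x ^ (ε - 1) * (x * y) * (2 + 2 * y) := by
  have hA0 : 0 < x * (1 + y) := by positivity
  have hB0 : 0 < x * (1 - y) := mul_pos hx0 (by linarith)
  have t1 := rpow_le_tangent h0 h1 hx0 hA0.le
  have t2 := rpow_le_tangent h0 h1 hx0 hB0.le
  have t3 := rpow_le_tangent h0 h1 hA0 hx0.le
  have t4 := rpow_le_tangent h0 h1 hB0 hx0.le
  have p0 : 0 < x ^ (ε - 1) := by positivity
  have p1 : x ^ (ε - 1) * (1 - y) ≤ (x * (1 + y)) ^ (ε - 1) := by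
    rw [Real.mul_rpow hx0.le (by linarith)]
    gcongr
    calc 1 - y ≤ (1 + y) ^ (-1 : ℝ) := by
          rw [Real.rpow_neg_one, ← one_div, le_div_iff₀ (by linarith)]
          nlinarith
      _ ≤ _ := Real.rpow_le_rpow_of_exponent_le (by linarith) (by linarith)
  have p2 : (x * (1 - y)) ^ (ε - 1) ≤ x ^ (ε - 1) * (1 + 2 * y) := by
    rw [Real.mul_rpow hx0.le (by linarith)]
    gcongr
    calc (1 - y) ^ (ε - 1) ≤ (1 - y) ^ (-1 : ℝ) :=
          Real.rpow_le_rpow_of_exponent_ge (by linarith) (by linarith) (by linarith)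
      _ ≤ 1 + 2 * y := by
          rw [Real.rpow_neg_one, ← one_div, div_le_iff₀ (by linarith)]
          nlinarith
  set S := ε * x ^ (ε - 1) * (x * y) with hS
  have q1 : S * (1 - y) ≤ ε * (x * (1 + y)) ^ (ε - 1) * (x * y) := by
    calc S * (1 - y) = ε * (x ^ (ε - 1) * (1 - y)) * (x * y) := by rw [hS]; ring
      _ ≤ _ := by gcongr
  have q2 : ε * (x * (1 - y)) ^ (ε - 1) * (x * y) ≤ S * (1 + 2 * y) := by
    calc _ ≤ ε * (x ^ (ε - 1) * (1 + 2 * y)) * (x * y) := by gcongr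
      _ = _ := by rw [hS]; ring
  have u1 : (x * (1 + y)) ^ ε ≤ x ^ ε + S := by
    calc _ ≤ _ := t1
      _ = _ := by rw [hS]; ring
  have u2 : (x * (1 - y)) ^ ε ≤ x ^ ε - S := by
    calc _ ≤ _ := t2
      _ = _ := by rw [hS]; ring
  have u3 : x ^ ε + S * (1 - y) ≤ (x * (1 + y)) ^ ε := by
    have : x ^ ε ≤ (x * (1 + y)) ^ ε - ε * (x * (1 + y)) ^ (ε - 1) * (x * y) := by
      calc _ ≤ _ := t3
        _ = _ := by ring
    linarith
  have u4 : x ^ ε - S * (1 + 2 * y) ≤ (x * (1 - y)) ^ ε := by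
    have : x ^ ε ≤ (x * (1 - y)) ^ ε + ε * (x * (1 - y)) ^ (ε - 1) * (x * y) := by
      calc _ ≤ _ := t4
        _ = _ := by ring
    linarith
  exact ⟨by linarith, by linarith⟩

section

variable {α ε : ℝ}

lemma monotoneOn_stretchedExp (hα : 0 < α) (h0 : 0 < ε) :
    MonotoneOn (fun x : ℝ => Real.exp (α * x ^ ε)) (Set.Ici 0) := by
  intro x hx y hy hxy
  simp only [Set.mem_Ici] at hx hy
  change Real.exp (α * x ^ ε) ≤ Real.exp (α * y ^ ε)
  gcongr

lemma stretchedExpWeight_succ_le (hα : 0 < α) (h0 : 0 < ε) (h1 : ε ≤ 1) (n : ℕ) :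
    stretchedExpWeight α ε (n + 1) ≤ Real.exp α * stretchedExpWeight α ε n := by
  unfold stretchedExpWeight
  rw [← Real.exp_add]
  apply Real.exp_le_exp.2
  have h2 := Real.rpow_add_le_add_rpow (Nat.cast_nonneg n) zero_le_one h0.le h1
  rw [Real.one_rpow] at h2
  have := mul_le_mul_of_nonneg_left h2 hα.le
  push_cast
  linarith

lemma stretchedExpWeight_tail (hα : 0 < α) (h0 : 0 < ε) (h1 : ε ≤ 1) :
    Summable (fun n => 1 / stretchedExpWeight α ε n) ∧
      ∃ C > 0, ∃ c > 0, ∃ n₀ : ℕ, ∀ n : ℕ, n₀ ≤ n →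
        tailSum (stretchedExpWeight α ε) n ≤
          C * ((n : ℝ) ^ (1 - ε) * Real.exp (-(α * (n : ℝ) ^ ε))) ∧
        c * ((n : ℝ) ^ (1 - ε) * Real.exp (-(α * (n : ℝ) ^ ε))) ≤
          tailSum (stretchedExpWeight α ε) n := by
  obtain ⟨X, hX⟩ := eventually_atTop.1
    ((tendsto_rpow_atTop h0).eventually_ge_atTop (2 * (1 - ε) / (α * ε)))
  have hX' : ∀ x : ℝ, ((⌈X⌉₊ + 1 : ℕ) : ℝ) ≤ x → 1 ≤ x ∧
      0 ≤ (1 - ε) * (x ^ ε)⁻¹ ∧ (1 - ε) * (x ^ ε)⁻¹ ≤ α * ε / 2 := by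
    intro x hx
    push_cast at hx
    have h2 := Nat.le_ceil X
    have h2' : (0 : ℝ) ≤ ⌈X⌉₊ := Nat.cast_nonneg _
    have h3 := hX x (by linarith)
    have h4 : 1 ≤ x := by linarith
    have h6 : 0 ≤ 1 - ε := by linarith
    have h7 : 0 < x ^ ε := by positivity
    refine ⟨h4, by positivity, ?_⟩
    rw [div_le_iff₀ (by positivity)] at h3
    rw [← div_eq_mul_inv, div_le_iff₀ h7]
    linarith
  have hαε : 0 < α * ε := by positivity
  have key := tailSum_bounds_of_hasDerivAt (w := stretchedExpWeight α ε)
    (f := fun x => Real.exp (α * x ^ ε))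
    (H := fun x => x ^ (1 - ε) * Real.exp (-(α * x ^ ε)))
    (h := fun x => (α * ε - (1 - ε) * (x ^ ε)⁻¹) / Real.exp (α * x ^ ε))
    (n₀ := ⌈X⌉₊ + 1) (c := α * ε / 2) (C := α * ε) (D := Real.exp α) (by positivity)
    hαε (by positivity) (fun n _ => rfl) (fun x _ => Real.exp_pos _)
    ((monotoneOn_stretchedExp hα h0).mono (Set.Ici_subset_Ici.2 (Nat.cast_nonneg _)))
    (fun n _ => stretchedExpWeight_succ_le hα h0 h1 n)
    (fun x hx => by
      obtain ⟨hx1, -, -⟩ := hX' x hx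
      have hx0 : 0 < x := by linarith
      have h2 := (Real.hasDerivAt_rpow_const (x := x) (p := 1 - ε) (Or.inl hx0.ne')).mul
        (((Real.hasDerivAt_rpow_const (x := x) (p := ε) (Or.inl hx0.ne')).const_mul α).neg.exp)
      refine h2.congr_deriv ?_
      have e1 : x ^ (1 - ε - 1) = (x ^ ε)⁻¹ := by
        rw [← Real.rpow_neg hx0.le]; congr 1; ring
      have e2 : x ^ (1 - ε) = x * (x ^ ε)⁻¹ := by
        rw [sub_eq_add_neg, Real.rpow_add hx0, Real.rpow_one, Real.rpow_neg hx0.le]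
      have e3 : x ^ (ε - 1) = x ^ ε * x⁻¹ := by
        rw [sub_eq_add_neg, Real.rpow_add hx0, Real.rpow_neg_one]
      have h3 : 0 < x ^ ε := by positivity
      simp only [Pi.neg_apply]
      rw [e1, e2, e3, Real.exp_neg]
      have h4 := Real.exp_pos (α * x ^ ε)
      field_simp
      ring)
    (fun x hx => by
      obtain ⟨-, -, h2⟩ := hX' x hx
      gcongr
      linarith)
    (fun x hx => by
      obtain ⟨-, h2, -⟩ := hX' x hx
      gcongr
      linarith)
    (by
      have h2 := (tendsto_rpow_mul_exp_neg_mul_atTop_nhds_zero ((1 - ε) / ε) α hα).comp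
        ((tendsto_rpow_atTop h0).comp tendsto_natCast_atTop_atTop)
      refine h2.congr fun n => ?_
      simp only [Function.comp_apply]
      rw [← Real.rpow_mul (Nat.cast_nonneg n), mul_div_cancel₀ _ h0.ne', neg_mul])
  exact ⟨key.1, Real.exp α / (α * ε / 2), by positivity, 1 / (α * ε), by positivity, _, key.2⟩

lemma isStrongWeight_stretchedExp (hα : 0 < α) (h0 : 0 < ε) (h1 : ε ≤ 1) :
    IsStrongWeight (stretchedExpWeight α ε) (Real.exp α) :=
  ⟨fun _ _ => Real.exp_pos _,
    fun n _ => monotoneOn_stretchedExp hα h0 (Set.mem_Ici.2 (Nat.cast_nonneg n))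
      (Set.mem_Ici.2 (Nat.cast_nonneg (n + 1))) (by exact_mod_cast n.le_succ),
    fun n _ => stretchedExpWeight_succ_le hα h0 h1 n, (stretchedExpWeight_tail hα h0 h1).1⟩

lemma tendsto_rpow_neg_mul_log_sq {p : ℝ} (hp : 0 < p) :
    Tendsto (fun k : ℝ => k ^ (-p) * Real.log k ^ 2) atTop (𝓝 0) := by
  have h1 := (tendsto_rpow_neg_mul_log (show 0 < p / 2 by linarith)).pow 2
  rw [zero_pow two_ne_zero] at h1
  refine h1.congr' ?_
  filter_upwards [eventually_gt_atTop 0] with k hk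
  rw [mul_pow, ← Real.rpow_natCast, ← Real.rpow_mul hk.le]
  congr 2; push_cast; ring

/-- Up to a bounded error, `loserCount` balances the weight of the losing edge with the tail sum of
the winning edge. -/
lemma eventually_loserCount (hα : 0 < α) (h0 : 0 < ε) (h1 : ε ≤ 1) :
    ∀ᶠ k : ℝ in atTop, k / 4 ≤ loserCount α ε k ∧ loserCount α ε k ≤ k / 2 ∧
      (1 - ε) * Real.log k - 1 ≤
        α * ((k - loserCount α ε k) ^ ε - loserCount α ε k ^ ε) ∧
      α * ((k - loserCount α ε k) ^ ε - loserCount α ε k ^ ε) ≤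
        (1 - ε) * Real.log k + 1 := by
  set c := (1 - ε) / (α * ε * 2 ^ (2 - ε)) with hc
  have hε : 0 ≤ 1 - ε := by linarith
  have hc0 : 0 ≤ c := by positivity
  have hy1 : Tendsto (fun k : ℝ => 2 * c * (k ^ (-ε) * Real.log k)) atTop (𝓝 0) := by
    simpa using (tendsto_rpow_neg_mul_log h0).const_mul (2 * c)
  -- The error in the balance is of order `y * log k`, which is why the square of the logarithm
  -- appears.
  have hy2 : Tendsto (fun k : ℝ => 2 * c * (k ^ (-ε) * Real.log k ^ 2)) atTop (𝓝 0) := by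
    simpa using (tendsto_rpow_neg_mul_log_sq h0).const_mul (2 * c)
  filter_upwards [hy1.eventually_le_const (show (0 : ℝ) < 1 / 2 by norm_num),
    hy2.eventually_le_const (show (0 : ℝ) < 1 by norm_num), eventually_ge_atTop 1]
    with k h2 h3 hk
  have hk0 : 0 < k := by linarith
  have hl : 0 ≤ Real.log k := Real.log_nonneg hk
  set y := 2 * c * (k ^ (-ε) * Real.log k) with hy
  have hy0 : 0 ≤ y := by positivity
  have hyl : y * Real.log k ≤ 1 := by
    calc y * Real.log k = 2 * c * (k ^ (-ε) * Real.log k ^ 2) := by rw [hy]; ring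
      _ ≤ 1 := h3
  set x := k / 2 with hx
  have hx0 : 0 < x := by positivity
  have hB : loserCount α ε k = x * (1 - y) := by
    have : k ^ (1 - ε) = k * k ^ (-ε) := by rw [sub_eq_add_neg, Real.rpow_add hk0, Real.rpow_one]
    rw [loserCount, ← hc, this, hy, hx]; ring
  have hA : k - loserCount α ε k = x * (1 + y) := by rw [hB, hx]; ring
  rw [hA, hB]
  -- The coefficient in `loserCount` is chosen so that the first-order difference is exactly `(1 -
  -- ε) * log k`, the logarithm of the prefactor of the tail sum.
  have hxy : ε * x ^ (ε - 1) * (x * y) * α * 2 = (1 - ε) * Real.log k := by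
    have e1 : x ^ (ε - 1) * x = k ^ ε * (2 ^ ε)⁻¹ := by
      rw [← Real.rpow_add_one hx0.ne', sub_add_cancel, hx, Real.div_rpow hk0.le (by norm_num)]
      rfl
    have e2 : (2 : ℝ) ^ (2 - ε) = 4 * (2 ^ ε)⁻¹ := by
      rw [sub_eq_add_neg, Real.rpow_add (by norm_num), Real.rpow_neg (by norm_num)]
      norm_num
    have e3 : k ^ (-ε) = (k ^ ε)⁻¹ := Real.rpow_neg hk0.le _
    calc ε * x ^ (ε - 1) * (x * y) * α * 2 = 2 * ε * α * y * (x ^ (ε - 1) * x) := by ring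
      _ = _ := by
        rw [e1, hy, hc, e2, e3]
        have : 0 < k ^ ε := by positivity
        have : (0 : ℝ) < 2 ^ ε := by positivity
        field_simp
        ring
  set S := ε * x ^ (ε - 1) * (x * y) with hS
  have hS0 : 0 ≤ S := by positivity
  obtain ⟨d1, d2⟩ := rpow_sub_rpow_bounds h0.le h1 hx0 hy0 h2
  rw [← hS] at d1 d2
  have hSy : S * α * 2 * y ≤ 1 := by
    rw [hxy]
    calc (1 - ε) * Real.log k * y ≤ 1 * Real.log k * y := by gcongr; linarith
      _ ≤ 1 := by linarith
  refine ⟨?_, ?_, ?_, ?_⟩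
  · have : x * (1 / 2) ≤ x * (1 - y) := by gcongr; linarith
    linarith
  · have : 0 ≤ x * y := by positivity
    linarith
  · have := mul_le_mul_of_nonneg_left d1 hα.le
    have : 0 ≤ S * α * y := by positivity
    linarith
  · have := mul_le_mul_of_nonneg_left d2 hα.le
    linarith

end

namespace TwoEdgeWalk.Graph

variable {a b : ℕ} {α ε : ℝ}

lemma stretchedExpWeight_le_of_le (hα : 0 < α) (h0 : 0 < ε) {n : ℕ} {x : ℝ} (h : (n : ℝ) ≤ x) :
    stretchedExpWeight α ε n ≤ Real.exp (α * x ^ ε) :=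
  monotoneOn_stretchedExp hα h0 (Set.mem_Ici.2 (Nat.cast_nonneg n))
    (Set.mem_Ici.2 ((Nat.cast_nonneg n).trans h)) h

lemma le_stretchedExpWeight_of_le (hα : 0 < α) (h0 : 0 < ε) {n : ℕ} {x : ℝ} (hx : 0 ≤ x)
    (h : x ≤ (n : ℝ)) : Real.exp (α * x ^ ε) ≤ stretchedExpWeight α ε n :=
  monotoneOn_stretchedExp hα h0 (Set.mem_Ici.2 hx) (Set.mem_Ici.2 (Nat.cast_nonneg n)) h

lemma exp_one_sub_mul_log {k : ℝ} (hk : 0 < k) :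
    Real.exp ((1 - ε) * Real.log k) = k ^ (1 - ε) := by
  rw [Real.rpow_def_of_pos hk, mul_comm]

/-- For losing counts within order `σ = k ^ (1 - ε)` below the balance point `B`, the winning weight
changes only by a bounded factor and the exponent stays bounded. There are of order `σ` such counts.
-/
lemma eventually_le_prob_stretchedExp (g : Graph) (ha : 1 ≤ a) (hb : 1 ≤ b) (hα : 0 < α)
    (h0 : 0 < ε) (h1 : ε ≤ 1) :
    ∃ c > 0, ∀ᶠ k : ℕ in atTop, g.Possible a b (k + 1) →
      c * ((k : ℝ) ^ (1 - ε) * Real.exp (-(α * ((k : ℝ) - loserCount α ε k) ^ ε))) ≤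
        g.prob (stretchedExpWeight α ε) a b (k + 1) := by
  have hw := isStrongWeight_stretchedExp hα h0 h1
  obtain ⟨-, C, hC, c₁, -, n₀, htail⟩ := stretchedExpWeight_tail hα h0 h1
  obtain ⟨c, hc, hbd⟩ := g.exists_mul_le_prob hw ha hb
  have hs := g.stride_pos
  have hs2 : g.stride ≤ 2 := by cases g <;> simp [Graph.stride]
  have hε : 0 ≤ 1 - ε := by linarith
  refine ⟨c * (Real.exp (-(α * (2 * ε * 4))) * Real.exp (-(C * Real.exp 1)) * (1 / 2)),
    by positivity, ?_⟩
  have hkε : Tendsto (fun k : ℕ => (k : ℝ) ^ ε) atTop atTop :=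
    (tendsto_rpow_atTop h0).comp tendsto_natCast_atTop_atTop
  filter_upwards [tendsto_natCast_atTop_atTop.eventually (eventually_loserCount hα h0 h1),
    hkε.eventually_ge_atTop 16, eventually_ge_atTop (2 * n₀ + 16 * a + 4 * b + 32)]
    with k ⟨hB1, hB2, hAB, _⟩ hk16 hk hposs
  have hk0 : (0 : ℝ) < k := by exact_mod_cast (show 0 < k by omega)
  have hk1 : (1 : ℝ) ≤ k := by exact_mod_cast (show 1 ≤ k by omega)
  set B := loserCount α ε k with hB
  set A := (k : ℝ) - B with hA
  set σ := (k : ℝ) ^ (1 - ε) with hσ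
  have hσ1 : 1 ≤ σ := Real.one_le_rpow hk1 hε
  have hσk : 16 * σ ≤ k := by
    have e : (k : ℝ) = (k : ℝ) ^ ε * σ := by rw [hσ, ← Real.rpow_add hk0]; simp
    calc 16 * σ ≤ (k : ℝ) ^ ε * σ := by gcongr
      _ = k := e.symm
  have hB0 : 0 ≤ B := by linarith
  have hA0 : 0 < A := by linarith
  set r := ⌊σ⌋₊ with hr
  have hrσ : (r : ℝ) ≤ σ := Nat.floor_le (by linarith)
  have hr1 : 1 ≤ r := Nat.le_floor (by exact_mod_cast hσ1)
  have hrσ' : σ / 2 ≤ r := by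
    have h2 := Nat.lt_floor_add_one σ
    have h3 : (1 : ℝ) ≤ r := by exact_mod_cast hr1
    linarith
  set M := ⌊B⌋₊ with hM
  have hMB : (M : ℝ) ≤ B := Nat.floor_le hB0
  have hMB' : B < M + 1 := Nat.lt_floor_add_one B
  have hsr : g.stride * r ≤ 2 * r := Nat.mul_le_mul_right r hs2
  have hsrM : a + 1 + g.stride * r ≤ M := by
    have h2 : ((a + 1 + 2 * r : ℕ) : ℝ) ≤ M + 1 - 1 := by
      push_cast
      have h3 : ((16 * a + 32 : ℕ) : ℝ) ≤ k := by exact_mod_cast (show 16 * a + 32 ≤ k by omega)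
      push_cast at h3
      linarith
    have h3 : ((a + 1 + 2 * r : ℕ) : ℝ) ≤ M := by linarith
    have h4 : a + 1 + 2 * r ≤ M := by exact_mod_cast h3
    omega
  have hMk : 2 * M ≤ k := by
    have : (2 * M : ℝ) ≤ k := by linarith
    exact_mod_cast this
  have hmr : M - g.stride * r + g.stride * r = M := by omega
  have key := hbd k (M - g.stride * r) r
    (Real.exp (-(α * (2 * ε * 4))) * Real.exp (-(α * A ^ ε)) * Real.exp (-(C * Real.exp 1))) hposs
    (by omega) (by omega) (by omega) (by
      intro I hI1 hI2
      rw [hmr] at hI2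
      have hJk : k + 1 - I ≤ k := by omega
      have hJ : ((k + 1 - I : ℕ) : ℝ) = k + 1 - I := by
        rw [Nat.cast_sub (by omega)]; push_cast; ring
      have hIM : (I : ℝ) ≤ M := by exact_mod_cast hI2
      have hIm : (M : ℝ) - 2 * r ≤ I := by
        have : M ≤ I + 2 * r := by omega
        have : (M : ℝ) ≤ I + 2 * r := by exact_mod_cast this
        linarith
      have hJA : A ≤ ((k + 1 - I : ℕ) : ℝ) := by rw [hJ]; linarith
      -- `I` is at least `B - 1 - 2 * σ`, and `σ ≥ 1` absorbs the additive constants.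
      have hJA' : ((k + 1 - I : ℕ) : ℝ) ≤ A + 4 * σ := by rw [hJ]; linarith
      have hwJ : stretchedExpWeight α ε (k + 1 - I) ≤
          Real.exp (α * A ^ ε) * Real.exp (α * (2 * ε * 4)) := by
        refine (stretchedExpWeight_le_of_le hα h0 hJA').trans ?_
        rw [← Real.exp_add]
        apply Real.exp_le_exp.2
        rw [← mul_add]
        apply mul_le_mul_of_nonneg_left _ hα.le
        have h2 := rpow_le_tangent h0.le h1 hA0 (show 0 ≤ A + 4 * σ by linarith)
        refine h2.trans ?_
        rw [add_sub_cancel_left]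
        have h3 : A ^ (ε - 1) * σ ≤ 2 := by
          have h4 : A ^ (ε - 1) ≤ ((k : ℝ) / 2) ^ (ε - 1) :=
            Real.rpow_le_rpow_of_nonpos (by positivity) (by linarith) (by linarith)
          have h5 : ((k : ℝ) / 2) ^ (ε - 1) * σ = 2 ^ (1 - ε) := by
            rw [Real.div_rpow hk0.le (by norm_num), hσ, div_mul_eq_mul_div, ← Real.rpow_add hk0,
              show ε - 1 = -(1 - ε) by ring, Real.rpow_neg (by norm_num : (0 : ℝ) ≤ 2)]
            simp
          have h6 : (2 : ℝ) ^ (1 - ε) ≤ 2 ^ (1 : ℝ) :=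
            Real.rpow_le_rpow_of_exponent_le (by norm_num) (by linarith)
          rw [Real.rpow_one] at h6
          calc _ ≤ ((k : ℝ) / 2) ^ (ε - 1) * σ := by gcongr
            _ ≤ 2 := by rw [h5]; exact h6
        have h4 : ε * 4 * (A ^ (ε - 1) * σ) ≤ ε * 4 * 2 := by gcongr
        linarith
      have hwI : stretchedExpWeight α ε I ≤ Real.exp (α * B ^ ε) :=
        stretchedExpWeight_le_of_le hα h0 (hIM.trans hMB)
      have hW : tailSum (stretchedExpWeight α ε) (k + 1 - I) ≤
          C * (σ * Real.exp (-(α * A ^ ε))) := by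
        refine (htail (k + 1 - I) (by omega)).1.trans ?_
        have h3 : ((k + 1 - I : ℕ) : ℝ) ≤ k := by exact_mod_cast hJk
        have h4 := Real.rpow_le_rpow (Nat.cast_nonneg _) h3 hε
        gcongr
      have hprod : stretchedExpWeight α ε I * tailSum (stretchedExpWeight α ε) (k + 1 - I) ≤
          C * Real.exp 1 := by
        calc _ ≤ Real.exp (α * B ^ ε) * (C * (σ * Real.exp (-(α * A ^ ε)))) :=
              mul_le_mul hwI hW (hw.tailSum_nonneg (by omega)) (Real.exp_pos _).le
          _ = C * (Real.exp (α * B ^ ε) * (Real.exp ((1 - ε) * Real.log k) *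
              Real.exp (-(α * A ^ ε)))) := by rw [exp_one_sub_mul_log hk0]; ring
          _ ≤ C * Real.exp 1 := by
              rw [← Real.exp_add, ← Real.exp_add]
              gcongr
              linarith
      have hwJ0 := hw.pos (k + 1 - I) (by omega)
      apply mul_le_mul
      · rw [← Real.exp_add, ← one_div_one_div (Real.exp _), one_div (Real.exp _), ← Real.exp_neg]
        apply one_div_le_one_div_of_le hwJ0
        refine hwJ.trans_eq ?_
        rw [← Real.exp_add]; congr 1; ring
      · exact Real.exp_le_exp.2 (neg_le_neg hprod)
      · exact (Real.exp_pos _).le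
      · positivity)
  refine le_trans ?_ key
  calc c * (Real.exp (-(α * (2 * ε * 4))) * Real.exp (-(C * Real.exp 1)) * (1 / 2)) *
        (σ * Real.exp (-(α * A ^ ε)))
      = c * (Real.exp (-(α * (2 * ε * 4))) * Real.exp (-(α * A ^ ε)) *
          Real.exp (-(C * Real.exp 1)) * (σ / 2)) := by ring
    _ ≤ _ := by gcongr

/-- Since `exp φ ≥ φ ^ 2 / 2`, completing the square shows that the exponential loss bounds any
linear gain. -/
lemma mul_sub_mul_exp_le {p c φ : ℝ} (hc : 0 < c) (hφ : 0 ≤ φ) :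
    p * φ - c * Real.exp φ ≤ p ^ 2 / (2 * c) := by
  have h1 := Real.quadratic_le_exp_of_nonneg hφ
  have h2 : c * (φ ^ 2 / 2) ≤ c * Real.exp φ := by gcongr; linarith
  have h3 : p ^ 2 / (2 * c) = (c * φ - p) ^ 2 / (2 * c) + (p * φ - c * (φ ^ 2 / 2)) := by
    field_simp; ring
  have h4 : 0 ≤ (c * φ - p) ^ 2 / (2 * c) := by positivity
  linarith

lemma eventually_prob_stretchedExp_le (g : Graph) (ha : 1 ≤ a) (hb : 1 ≤ b) (hα : 0 < α)
    (h0 : 0 < ε) (h1 : ε ≤ 1) :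
    ∃ C > 0, ∀ᶠ k : ℕ in atTop, g.prob (stretchedExpWeight α ε) a b (k + 1) ≤
      C * ((k : ℝ) ^ (1 - ε) * Real.exp (-(α * ((k : ℝ) - loserCount α ε k) ^ ε))) := by
  have hw := isStrongWeight_stretchedExp hα h0 h1
  obtain ⟨-, C₁, -, c₁, hc₁, n₀, htail⟩ := stretchedExpWeight_tail hα h0 h1
  obtain ⟨C, hC, c, hc, c₀, hbd⟩ := g.exists_prob_le hw ha hb
  have hε : 0 ≤ 1 - ε := by linarith
  set c₂ := c * (c₁ * (1 / 2) * Real.exp (-α) * Real.exp (-1)) with hc₂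
  have hc₂0 : 0 < c₂ := by positivity
  -- In terms of `φ = α * ε * θ * r`, the reciprocal winning weight gains at most `(4 / ε) * φ`
  -- above the balance point; the additional `φ` provides geometric decay.
  set K := (4 / ε + 1) ^ 2 / (2 * c₂) with hK
  have hK0 : 0 ≤ K := by positivity
  have hαε : 0 < α * ε := by positivity
  refine ⟨C * (Real.exp 1 + 2 * (Real.exp K * (1 + 1 / (α * ε)))), by positivity, ?_⟩
  filter_upwards [tendsto_natCast_atTop_atTop.eventually (eventually_loserCount hα h0 h1),
    eventually_ge_atTop (2 * n₀ + 4 * c₀ + 32)]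
    with k ⟨hB1, hB2, _, hAB⟩ hk
  have hk0 : (0 : ℝ) < k := by exact_mod_cast (show 0 < k by omega)
  have hk1 : (1 : ℝ) ≤ k := by exact_mod_cast (show 1 ≤ k by omega)
  refine (hbd k (by omega)).trans ?_
  rw [mul_assoc]
  apply mul_le_mul_of_nonneg_left _ hC.le
  set B := loserCount α ε k with hB
  set A := (k : ℝ) - B with hA
  set σ := (k : ℝ) ^ (1 - ε) with hσ
  set θ := (k : ℝ) ^ (ε - 1) with hθ
  have hσ1 : 1 ≤ σ := Real.one_le_rpow hk1 hε
  have hθ0 : 0 < θ := by positivity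
  have hσθ : 1 / θ = σ := by
    rw [hθ, hσ, one_div, ← Real.rpow_neg hk0.le]; congr 1; ring
  have hB0 : 0 < B := by linarith
  have hA0 : 0 < A := by linarith
  have hgeo : ∀ (F : Finset ℕ) (q : ℕ → ℕ), Set.InjOn q F →
      ∑ I ∈ F, Real.exp (-(α * ε * θ * q I)) ≤ (1 + 1 / (α * ε)) * σ := by
    intro F q hq
    refine (sum_exp_neg_le (by positivity) F q hq).trans ?_
    have : 1 / (α * ε * θ) = 1 / (α * ε) * σ := by rw [← hσθ, div_mul_div_comm, one_mul]
    rw [this, add_mul]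
    linarith
  rw [add_mul]
  apply add_le_add
  · have h2 : Real.exp (α * B ^ ε) ≤ stretchedExpWeight α ε ((k + 2) / 2) := by
      apply le_stretchedExpWeight_of_le hα h0 hB0.le
      have : k ≤ 2 * ((k + 2) / 2) := by omega
      have : (k : ℝ) ≤ 2 * ((k + 2) / 2 : ℕ) := by exact_mod_cast this
      linarith
    calc 1 / stretchedExpWeight α ε ((k + 2) / 2) ≤ 1 / Real.exp (α * B ^ ε) :=
          one_div_le_one_div_of_le (Real.exp_pos _) h2
      _ = Real.exp (-(α * B ^ ε)) := by rw [one_div, Real.exp_neg]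
      _ ≤ Real.exp (1 + ((1 - ε) * Real.log k + -(α * A ^ ε))) := by
          apply Real.exp_le_exp.2
          linarith
      _ = _ := by rw [Real.exp_add, Real.exp_add, exp_one_sub_mul_log hk0]
  · set b₀ := ⌊B⌋₊ with hb₀
    have hbB : (b₀ : ℝ) ≤ B := Nat.floor_le hB0.le
    have hbB' : B < b₀ + 1 := Nat.lt_floor_add_one B
    have h2b : 2 * b₀ ≤ k := by
      have : (2 * b₀ : ℝ) ≤ k := by linarith
      exact_mod_cast this
    rw [← Finset.sum_filter_add_sum_filter_not _ (fun I => I ≤ b₀)]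
    -- Below the balance point the exponential factor is bounded by `1`, and `1 / w (k + 1 - I)`
    -- already decays at rate `α * ε * θ`; the geometric sum has order `1 / θ = σ`.
    have hlow : ∀ I ∈ (Finset.Icc 2 ((k + 1 + c₀) / 2)).filter (fun I => I ≤ b₀),
        1 / stretchedExpWeight α ε (k + 1 - I) * Real.exp (-(c * (stretchedExpWeight α ε I *
          tailSum (stretchedExpWeight α ε) (k + 1 - I)))) ≤
        Real.exp (-(α * A ^ ε)) * (Real.exp K * Real.exp (-(α * ε * θ * ((b₀ - I : ℕ) : ℝ)))) := by
      intro I hI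
      rw [Finset.mem_filter, Finset.mem_Icc] at hI
      have hJ : ((k + 1 - I : ℕ) : ℝ) = k + 1 - I := by
        rw [Nat.cast_sub (by omega)]; push_cast; ring
      have hr : ((b₀ - I : ℕ) : ℝ) = b₀ - I := Nat.cast_sub hI.2
      have hJk : ((k + 1 - I : ℕ) : ℝ) ≤ k := by exact_mod_cast (show k + 1 - I ≤ k by omega)
      have hJ0 : (0 : ℝ) < ((k + 1 - I : ℕ) : ℝ) := by
        exact_mod_cast (show 0 < k + 1 - I by omega)
      have h2 : A ^ ε + ε * θ * ((b₀ - I : ℕ) : ℝ) ≤ ((k + 1 - I : ℕ) : ℝ) ^ ε := by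
        have h3 := rpow_le_tangent h0.le h1 hJ0 hA0.le
        have h4 : θ ≤ ((k + 1 - I : ℕ) : ℝ) ^ (ε - 1) :=
          Real.rpow_le_rpow_of_nonpos hJ0 hJk (by linarith)
        have h5 : ((b₀ - I : ℕ) : ℝ) ≤ ((k + 1 - I : ℕ) : ℝ) - A := by rw [hJ, hr]; linarith
        have h6 : ε * θ * ((b₀ - I : ℕ) : ℝ) ≤
            ε * ((k + 1 - I : ℕ) : ℝ) ^ (ε - 1) * (((k + 1 - I : ℕ) : ℝ) - A) := by gcongr
        linarith
      have h3 : Real.exp (-(c * (stretchedExpWeight α ε I *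
          tailSum (stretchedExpWeight α ε) (k + 1 - I)))) ≤ 1 := by
        apply Real.exp_le_one_iff.2
        have := hw.pos I (by omega)
        have := hw.tailSum_nonneg (show 1 ≤ k + 1 - I by omega)
        have : 0 ≤ c * (stretchedExpWeight α ε I *
          tailSum (stretchedExpWeight α ε) (k + 1 - I)) := by positivity
        linarith
      have h4 : (1 : ℝ) ≤ Real.exp K := Real.one_le_exp hK0
      have h5 : 1 / stretchedExpWeight α ε (k + 1 - I) ≤
          Real.exp (-(α * A ^ ε)) * Real.exp (-(α * ε * θ * ((b₀ - I : ℕ) : ℝ))) := by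
        rw [stretchedExpWeight, one_div, ← Real.exp_neg, ← Real.exp_add]
        apply Real.exp_le_exp.2
        have := mul_le_mul_of_nonneg_left h2 hα.le
        linarith
      calc _ ≤ Real.exp (-(α * A ^ ε)) * Real.exp (-(α * ε * θ * ((b₀ - I : ℕ) : ℝ))) * 1 :=
            mul_le_mul h5 h3 (Real.exp_pos _).le (by positivity)
        _ = Real.exp (-(α * A ^ ε)) *
            (1 * Real.exp (-(α * ε * θ * ((b₀ - I : ℕ) : ℝ)))) := by ring
        _ ≤ _ := by gcongr
    -- Above the balance point `1 / w (k + 1 - I)` grows, but the product in the exponent is itself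
    -- at least a multiple of `exp φ`, and this wins.
    have hhigh : ∀ I ∈ (Finset.Icc 2 ((k + 1 + c₀) / 2)).filter (fun I => ¬ I ≤ b₀),
        1 / stretchedExpWeight α ε (k + 1 - I) * Real.exp (-(c * (stretchedExpWeight α ε I *
          tailSum (stretchedExpWeight α ε) (k + 1 - I)))) ≤
        Real.exp (-(α * A ^ ε)) *
          (Real.exp K * Real.exp (-(α * ε * θ * ((I - b₀ - 1 : ℕ) : ℝ)))) := by
      intro I hI
      rw [Finset.mem_filter, Finset.mem_Icc] at hI
      have hJ : ((k + 1 - I : ℕ) : ℝ) = k + 1 - I := by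
        rw [Nat.cast_sub (by omega)]; push_cast; ring
      have hq : ((I - b₀ - 1 : ℕ) : ℝ) = I - b₀ - 1 := by
        rw [Nat.sub_sub, Nat.cast_sub (by omega)]; push_cast; ring
      have hIb : (b₀ : ℝ) + 1 ≤ I := by exact_mod_cast (show b₀ + 1 ≤ I by omega)
      have hIk : (I : ℝ) ≤ k := by exact_mod_cast (show I ≤ k by omega)
      have hI0 : (0 : ℝ) < I := by exact_mod_cast (show 0 < I by omega)
      set r : ℝ := I - B with hr
      have hr0 : 0 ≤ r := by linarith
      have hrq : ((I - b₀ - 1 : ℕ) : ℝ) ≤ r := by rw [hq]; linarith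
      have hJ4 : (k : ℝ) / 4 ≤ ((k + 1 - I : ℕ) : ℝ) := by
        have : k ≤ 4 * (k + 1 - I) := by omega
        have : (k : ℝ) ≤ 4 * ((k + 1 - I : ℕ) : ℝ) := by exact_mod_cast this
        linarith
      have hJ0 : (0 : ℝ) < ((k + 1 - I : ℕ) : ℝ) := by linarith
      have hθJ : ((k + 1 - I : ℕ) : ℝ) ^ (ε - 1) ≤ 4 * θ := by
        calc ((k + 1 - I : ℕ) : ℝ) ^ (ε - 1) ≤ ((k : ℝ) / 4) ^ (ε - 1) :=
              Real.rpow_le_rpow_of_nonpos (by positivity) hJ4 (by linarith)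
          _ = 4 ^ (1 - ε) * θ := by
              rw [Real.div_rpow hk0.le (by norm_num), show ε - 1 = -(1 - ε) by ring,
                Real.rpow_neg (by norm_num : (0 : ℝ) ≤ 4), hθ, show ε - 1 = -(1 - ε) by ring]
              field_simp
          _ ≤ 4 ^ (1 : ℝ) * θ := by
              gcongr
              · norm_num
              · linarith
          _ = 4 * θ := by rw [Real.rpow_one]
      have h2 : A ^ ε ≤ ((k + 1 - I : ℕ) : ℝ) ^ ε + 4 * θ * r := by
        have h3 := rpow_le_tangent h0.le h1 hJ0 (show 0 ≤ ((k + 1 - I : ℕ) : ℝ) + r by linarith)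
        have h4 : A ^ ε ≤ (((k + 1 - I : ℕ) : ℝ) + r) ^ ε := by
          apply Real.rpow_le_rpow hA0.le _ h0.le
          rw [hJ]; linarith
        rw [add_sub_cancel_left] at h3
        have h5 : ε * ((k + 1 - I : ℕ) : ℝ) ^ (ε - 1) * r ≤ 1 * (4 * θ) * r := by gcongr
        linarith
      have h3 : B ^ ε + ε * θ * r ≤ (I : ℝ) ^ ε := by
        have h4 := rpow_le_tangent h0.le h1 hI0 hB0.le
        have h5 : θ ≤ (I : ℝ) ^ (ε - 1) := Real.rpow_le_rpow_of_nonpos hI0 hIk (by linarith)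
        have h6 : ε * θ * r ≤ ε * (I : ℝ) ^ (ε - 1) * r := by gcongr
        have h7 : ε * (I : ℝ) ^ (ε - 1) * (B - I) = -(ε * (I : ℝ) ^ (ε - 1) * r) := by
          rw [hr]; ring
        linarith
      have hW : c₁ * (1 / 2) * Real.exp (-α) * (σ * Real.exp (-(α * A ^ ε))) ≤
          tailSum (stretchedExpWeight α ε) (k + 1 - I) := by
        -- The tail is compared with that from `k - b₀ ≤ A + 1`, at the cost of a factor `exp (-α)`.
        refine le_trans ?_ (hw.tailSum_anti (show 1 ≤ k + 1 - I by omega)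
          (show k + 1 - I ≤ k - b₀ by omega))
        refine le_trans ?_ (htail (k - b₀) (by omega)).2
        have hj : ((k - b₀ : ℕ) : ℝ) = k - b₀ := Nat.cast_sub (by omega)
        have hjA : ((k - b₀ : ℕ) : ℝ) ≤ A + 1 := by rw [hj]; linarith
        have hjk : (k : ℝ) / 2 ≤ ((k - b₀ : ℕ) : ℝ) := by rw [hj]; linarith
        have h4 : 1 / 2 * σ ≤ ((k - b₀ : ℕ) : ℝ) ^ (1 - ε) := by
          calc 1 / 2 * σ ≤ (1 / 2) ^ (1 - ε) * σ := by
                gcongr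
                nth_rewrite 1 [← Real.rpow_one (1 / 2 : ℝ)]
                exact Real.rpow_le_rpow_of_exponent_ge (by norm_num) (by norm_num) (by linarith)
            _ = ((k : ℝ) / 2) ^ (1 - ε) := by
                rw [hσ, ← Real.mul_rpow (by norm_num) hk0.le]; congr 1; ring
            _ ≤ _ := Real.rpow_le_rpow (by positivity) hjk hε
        have h5 : -α + -(α * A ^ ε) ≤ -(α * ((k - b₀ : ℕ) : ℝ) ^ ε) := by
          have h6 := Real.rpow_le_rpow (by positivity) hjA h0.le
          have h7 := Real.rpow_add_le_add_rpow hA0.le zero_le_one h0.le h1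
          rw [Real.one_rpow] at h7
          have := mul_le_mul_of_nonneg_left (h6.trans h7) hα.le
          linarith
        calc c₁ * (1 / 2) * Real.exp (-α) * (σ * Real.exp (-(α * A ^ ε)))
            = c₁ * (1 / 2 * σ * Real.exp (-α + -(α * A ^ ε))) := by rw [Real.exp_add]; ring
          _ ≤ _ := by gcongr
      have hprod : c₂ * Real.exp (α * ε * θ * r) ≤ c * (stretchedExpWeight α ε I *
          tailSum (stretchedExpWeight α ε) (k + 1 - I)) := by
        have h4 : Real.exp (α * B ^ ε + α * ε * θ * r) ≤ stretchedExpWeight α ε I := by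
          apply Real.exp_le_exp.2
          have := mul_le_mul_of_nonneg_left h3 hα.le
          linarith
        calc c₂ * Real.exp (α * ε * θ * r)
            = c * ((c₁ * (1 / 2) * Real.exp (-α)) * Real.exp (-1 + α * ε * θ * r)) := by
              rw [hc₂, Real.exp_add]; ring
          _ ≤ c * ((c₁ * (1 / 2) * Real.exp (-α)) * Real.exp ((α * B ^ ε + α * ε * θ * r) +
              ((1 - ε) * Real.log k + -(α * A ^ ε)))) := by
              have h5 : -1 + α * ε * θ * r ≤ (α * B ^ ε + α * ε * θ * r) +
                ((1 - ε) * Real.log k + -(α * A ^ ε)) := by linarith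
              gcongr _ * (_ * Real.exp ?_)
          _ = c * (Real.exp (α * B ^ ε + α * ε * θ * r) *
              (c₁ * (1 / 2) * Real.exp (-α) * (σ * Real.exp (-(α * A ^ ε))))) := by
              rw [Real.exp_add, Real.exp_add _ (-(α * A ^ ε)), exp_one_sub_mul_log hk0]; ring
          _ ≤ _ := by
              have h5 := (hw.pos I (by omega)).le
              gcongr
      have hφ := mul_sub_mul_exp_le (p := 4 / ε + 1) hc₂0
        (show 0 ≤ α * ε * θ * r by positivity)
      rw [← hK] at hφ
      rw [stretchedExpWeight, one_div, ← Real.exp_neg, ← Real.exp_add, ← Real.exp_add,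
        ← Real.exp_add]
      apply Real.exp_le_exp.2
      have h4 := mul_le_mul_of_nonneg_left h2 hα.le
      have h5 : (4 / ε + 1) * (α * ε * θ * r) = 4 * α * θ * r + α * ε * θ * r := by field_simp
      have h6 : α * ε * θ * ((I - b₀ - 1 : ℕ) : ℝ) ≤ α * ε * θ * r := by gcongr
      linarith
    have hlow' := Finset.sum_le_sum hlow
    have hhigh' := Finset.sum_le_sum hhigh
    rw [← Finset.mul_sum, ← Finset.mul_sum] at hlow' hhigh'
    have g1 := hgeo ((Finset.Icc 2 ((k + 1 + c₀) / 2)).filter (fun I => I ≤ b₀))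
      (fun I => b₀ - I) (by
        intro i hi j hj hij
        simp only [Finset.coe_filter, Finset.mem_Icc, Set.mem_ofPred_eq] at hi hj hij
        omega)
    have g2 := hgeo ((Finset.Icc 2 ((k + 1 + c₀) / 2)).filter (fun I => ¬ I ≤ b₀))
      (fun I => I - b₀ - 1) (by
        intro i hi j hj hij
        simp only [Finset.coe_filter, Finset.mem_Icc, Set.mem_ofPred_eq] at hi hj hij
        omega)
    have g3 := mul_le_mul_of_nonneg_left (mul_le_mul_of_nonneg_left g1 (Real.exp_pos K).le)
      (Real.exp_pos (-(α * A ^ ε))).le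
    have g4 := mul_le_mul_of_nonneg_left (mul_le_mul_of_nonneg_left g2 (Real.exp_pos K).le)
      (Real.exp_pos (-(α * A ^ ε))).le
    refine (add_le_add (hlow'.trans g3) (hhigh'.trans g4)).trans_eq ?_
    ring

end TwoEdgeWalk.Graph

/-! ### Bounds for all `k`, and the theorem. -/

namespace TwoEdgeWalk.Graph

open Filter

variable {w : ℕ → ℝ} {D : ℝ} {a b : ℕ}

lemma exists_const_prob_bounds (g : Graph) (h : IsStrongWeight w D) (ha : 1 ≤ a) (hb : 1 ≤ b)
    {F : ℕ → ℝ} {k₀ : ℕ} (hF : ∀ k, k₀ ≤ k → 0 < F k)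
    (hlow : ∃ c > 0, ∀ᶠ k : ℕ in atTop, g.Possible a b (k + 1) → c * F k ≤ g.prob w a b (k + 1))
    (hup : ∃ C > 0, ∀ᶠ k : ℕ in atTop, g.prob w a b (k + 1) ≤ C * F k) :
    ∃ c₁ > (0 : ℝ), ∃ c₂ > (0 : ℝ), ∀ k : ℕ, k₀ ≤ k →
      (g.Possible a b (k + 1) → c₁ * F k ≤ g.prob w a b (k + 1)) ∧
        g.prob w a b (k + 1) ≤ c₂ * F k := by
  obtain ⟨c, hc, hlow⟩ := exists_const_le_of_eventually (P := fun k => g.prob w a b (k + 1))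
    (p := fun k => g.Possible a b (k + 1)) hF (fun k hk => g.prob_pos h ha hb hk) hlow
  obtain ⟨C, hC, hup⟩ := exists_le_const_of_eventually (P := fun k => g.prob w a b (k + 1)) hF hup
  exact ⟨c, hc, C, hC, fun k hk => ⟨hlow k hk, hup k hk⟩⟩

lemma prob_powLog_bounds (g : Graph) (ha : 1 ≤ a) (hb : 1 ≤ b) {ρ α w₁ : ℝ} (hρ : 1 < ρ)
    (hα : 0 ≤ α) (hw₁ : 0 < w₁) {k₀ : ℕ} (hk₀ : 1 ≤ k₀)
    (hlog : ∀ k : ℕ, k₀ ≤ k → 0 < Real.log k ^ α) :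
    ∃ c₁ > (0 : ℝ), ∃ c₂ > (0 : ℝ), ∀ k : ℕ, k₀ ≤ k →
      (g.Possible a b (k + 1) → c₁ / ((k : ℝ) ^ (ρ - (ρ - 1) / ρ) * Real.log k ^ α) ≤
        g.prob (powLogWeight ρ α w₁) a b (k + 1)) ∧
      g.prob (powLogWeight ρ α w₁) a b (k + 1) ≤
        c₂ / ((k : ℝ) ^ (ρ - (ρ - 1) / ρ) * Real.log k ^ α) := by
  obtain ⟨D, hD⟩ := isRegularWeight_powLog hρ hα hw₁
  obtain ⟨hlow, hup⟩ := g.eventually_prob_powLog ha hb hρ hα hw₁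
  obtain ⟨c₁, hc₁, c₂, hc₂, h⟩ := g.exists_const_prob_bounds (k₀ := k₀) hD.toIsStrongWeight ha hb
    (fun k hk => by
      have : (0 : ℝ) < k := by exact_mod_cast (show 0 < k by omega)
      have := hlog k hk
      positivity) hlow hup
  refine ⟨c₁, hc₁, c₂, hc₂, fun k hk => ?_⟩
  rw [div_eq_mul_one_div c₁, div_eq_mul_one_div c₂]
  exact h k hk

lemma prob_stretchedExp_bounds (g : Graph) (ha : 1 ≤ a) (hb : 1 ≤ b) {α ε : ℝ} (hα : 0 < α)
    (h0 : 0 < ε) (h1 : ε ≤ 1) :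
    ∃ c₁ > (0 : ℝ), ∃ c₂ > (0 : ℝ), ∀ k : ℕ, 1 ≤ k →
      (g.Possible a b (k + 1) →
        c₁ * ((k : ℝ) ^ (1 - ε) * Real.exp (-(α * ((k : ℝ) - loserCount α ε k) ^ ε))) ≤
          g.prob (stretchedExpWeight α ε) a b (k + 1)) ∧
      g.prob (stretchedExpWeight α ε) a b (k + 1) ≤
        c₂ * ((k : ℝ) ^ (1 - ε) * Real.exp (-(α * ((k : ℝ) - loserCount α ε k) ^ ε))) := by
  refine g.exists_const_prob_bounds (isStrongWeight_stretchedExp hα h0 h1) ha hb (fun k hk => ?_)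
    (g.eventually_le_prob_stretchedExp ha hb hα h0 h1)
    (g.eventually_prob_stretchedExp_le ha hb hα h0 h1)
  have : (0 : ℝ) < k := by exact_mod_cast (show 0 < k by omega)
  positivity

lemma mulExpLog_rate_pos (α β : ℝ) {k : ℕ} (hk : 2 ≤ k) :
    0 < 1 / ((k : ℝ) * Real.log k ^ (1 - α) *
      Real.exp (Real.log k ^ (α ^ 2) - β * Real.log k ^ (2 * α ^ 2 - α))) := by
  have h1 : (1 : ℝ) < k := by exact_mod_cast (show 1 < k by omega)
  have := Real.log_pos h1
  have : (0 : ℝ) < k := by linarith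
  positivity

lemma le_prob_mulExpLog (g : Graph) (ha : 1 ≤ a) (hb : 1 ≤ b) {α β : ℝ} (h0 : 0 < α) (h1 : α < 1)
    (hβ : ∀ᶠ L in atTop, loserLog α β L ^ α - L ^ (α ^ 2) + β * L ^ (2 * α ^ 2 - α) ≤ 1) :
    ∃ c > (0 : ℝ), ∀ k : ℕ, 2 ≤ k → g.Possible a b (k + 1) →
      c / ((k : ℝ) * Real.log k ^ (1 - α) *
          Real.exp (Real.log k ^ (α ^ 2) - β * Real.log k ^ (2 * α ^ 2 - α))) ≤
        g.prob (mulExpLogWeight α) a b (k + 1) := by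
  have hD := isRegularWeight_mulExpLog h0 h1
  obtain ⟨c, hc, h⟩ := exists_const_le_of_eventually
    (P := fun k => g.prob (mulExpLogWeight α) a b (k + 1))
    (p := fun k => g.Possible a b (k + 1)) (fun k hk => mulExpLog_rate_pos α β hk)
    (fun k hk => g.prob_pos hD.toIsStrongWeight ha hb hk)
    (g.eventually_le_prob_mulExpLog ha hb h0 h1 hβ)
  refine ⟨c, hc, fun k hk hp => ?_⟩
  rw [div_eq_mul_one_div]
  exact h k hk hp

lemma prob_mulExpLog_le (g : Graph) (ha : 1 ≤ a) (hb : 1 ≤ b) {α : ℝ} (h0 : 0 < α) (h1 : α < 1) :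
    ∃ C > (0 : ℝ), ∀ k : ℕ, 2 ≤ k →
      g.prob (mulExpLogWeight α) a b (k + 1) ≤ C / ((k : ℝ) * Real.log k ^ (1 - α) *
        Real.exp (Real.log k ^ (α ^ 2) - α * Real.log k ^ (2 * α ^ 2 - α))) := by
  obtain ⟨C, hC, h⟩ := exists_le_const_of_eventually
    (P := fun k => g.prob (mulExpLogWeight α) a b (k + 1))
    (fun k hk => mulExpLog_rate_pos α α hk) (g.eventually_prob_mulExpLog_le ha hb h0 h1)
  refine ⟨C, hC, fun k hk => ?_⟩
  rw [div_eq_mul_one_div]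
  exact h k hk

lemma div_rate_le_div_rate {A B x y C : ℝ} (hA : 0 < A) (hC : 0 ≤ C) (h : y ≤ x) :
    C / (A * Real.exp (B - y)) ≤ C / (A * Real.exp (B - x)) := by
  gcongr

/-- Here `2 * α ^ 2 - α ≤ 0`, so the correction in the exponent is at most its value at `k = 2` and
goes into the constant. -/
lemma prob_mulExpLog_bounds_of_le_half (g : Graph) (ha : 1 ≤ a) (hb : 1 ≤ b) {α : ℝ} (h0 : 0 < α)
    (h2 : α ≤ 1 / 2) :
    ∃ c₁ > (0 : ℝ), ∃ c₂ > (0 : ℝ), ∀ k : ℕ, 2 ≤ k →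
      (g.Possible a b (k + 1) →
        c₁ / ((k : ℝ) * Real.log k ^ (1 - α) * Real.exp (Real.log k ^ (α ^ 2))) ≤
          g.prob (mulExpLogWeight α) a b (k + 1)) ∧
      g.prob (mulExpLogWeight α) a b (k + 1) ≤
        c₂ / ((k : ℝ) * Real.log k ^ (1 - α) * Real.exp (Real.log k ^ (α ^ 2))) := by
  have h1 : α < 1 := by linarith
  obtain ⟨c, hc, hlow⟩ := g.le_prob_mulExpLog ha hb h0 h1
    (eventually_loserLog_defect_le_of_le h0 h1 (by linarith))
  obtain ⟨C, hC, hup⟩ := g.prob_mulExpLog_le ha hb h0 h1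
  refine ⟨c, hc, C * Real.exp (α * Real.log 2 ^ (2 * α ^ 2 - α)), by positivity, fun k hk => ?_⟩
  have hk1 : (1 : ℝ) < k := by exact_mod_cast (show 1 < k by omega)
  have hk0 : (0 : ℝ) < k := by linarith
  have hL := Real.log_pos hk1
  have hA : 0 < (k : ℝ) * Real.log k ^ (1 - α) := by positivity
  refine ⟨fun hp => le_trans ?_ (hlow k hk hp), (hup k hk).trans ?_⟩
  · have := div_rate_le_div_rate (B := Real.log k ^ (α ^ 2)) hA hc.le
      (show 0 ≤ α * Real.log k ^ (2 * α ^ 2 - α) by positivity)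
    rwa [sub_zero] at this
  · have h3 : Real.log k ^ (2 * α ^ 2 - α) ≤ Real.log 2 ^ (2 * α ^ 2 - α) := by
      apply Real.rpow_le_rpow_of_nonpos (Real.log_pos (by norm_num))
      · exact Real.log_le_log (by norm_num) (by exact_mod_cast hk)
      · nlinarith
    refine (div_rate_le_div_rate hA hC.le (mul_le_mul_of_nonneg_left h3 h0.le)).trans_eq ?_
    rw [Real.exp_sub, ← mul_div_assoc, div_div_eq_mul_div]

end TwoEdgeWalk.Graph

lemma exp_neg_log_rpow_bounds {p : ℝ} (hp : p ≤ 0) :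
    ∃ c₁ > (0 : ℝ), ∃ c₂ > (0 : ℝ), ∀ k : ℕ, 2 ≤ k →
      c₁ ≤ Real.exp (-Real.log k ^ p) ∧ Real.exp (-Real.log k ^ p) ≤ c₂ := by
  refine ⟨Real.exp (-Real.log 2 ^ p), Real.exp_pos _, 1, one_pos, fun k hk => ⟨?_, ?_⟩⟩
  · apply Real.exp_le_exp.2 (neg_le_neg _)
    apply Real.rpow_le_rpow_of_nonpos (Real.log_pos (by norm_num)) _ hp
    exact Real.log_le_log (by norm_num) (by exact_mod_cast hk)
  · apply Real.exp_le_one_iff.2 (neg_nonpos.2 _)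
    exact Real.rpow_nonneg (Real.log_natCast_nonneg k) _

theorem theorem10 (g : TwoEdgeWalk.Graph) (a b : ℕ) (ha : 1 ≤ a) (hb : 1 ≤ b) :
    -- (a)
    (∀ ρ : ℝ, 1 < ρ → ∃ c₁ > (0 : ℝ), ∃ c₂ > (0 : ℝ), ∀ k : ℕ, 1 ≤ k →
      (g.Possible a b (k + 1) →
        c₁ / (k : ℝ) ^ (ρ - (ρ - 1) / ρ) ≤ g.prob (fun n => (n : ℝ) ^ ρ) a b (k + 1)) ∧
      g.prob (fun n => (n : ℝ) ^ ρ) a b (k + 1) ≤ c₂ / (k : ℝ) ^ (ρ - (ρ - 1) / ρ)) ∧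
    -- (b); the formula for the weight vanishes at `1`, where the weight is an arbitrary `w₁ > 0`
    (∀ ρ α w₁ : ℝ, 1 < ρ → 1 < α → 0 < w₁ →
      ∃ c₁ > (0 : ℝ), ∃ c₂ > (0 : ℝ), ∀ k : ℕ, 2 ≤ k →
      (g.Possible a b (k + 1) →
        c₁ / ((k : ℝ) ^ (ρ - (ρ - 1) / ρ) * Real.log k ^ α) ≤
          g.prob (fun n => if n = 1 then w₁ else (n : ℝ) ^ ρ * Real.log n ^ α) a b (k + 1)) ∧
      g.prob (fun n => if n = 1 then w₁ else (n : ℝ) ^ ρ * Real.log n ^ α) a b (k + 1) ≤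
        c₂ / ((k : ℝ) ^ (ρ - (ρ - 1) / ρ) * Real.log k ^ α)) ∧
    -- (c)
    (∀ α : ℝ, 0 < α → α < 1 →
      -- lower bound, `β = α`
      (α ≤ 2 / 3 → ∃ c₁ > (0 : ℝ), ∀ k : ℕ, 2 ≤ k → g.Possible a b (k + 1) →
        c₁ / ((k : ℝ) * Real.log k ^ (1 - α) *
            Real.exp (Real.log k ^ (α ^ 2) - α * Real.log k ^ (2 * α ^ 2 - α))) ≤
          g.prob (fun n => (n : ℝ) * Real.exp (Real.log n ^ α)) a b (k + 1)) ∧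
      -- lower bound, `β = α - ε`
      (2 / 3 < α → ∀ ε : ℝ, 0 < ε →
        ∃ c₁ > (0 : ℝ), ∀ k : ℕ, 2 ≤ k → g.Possible a b (k + 1) →
        c₁ / ((k : ℝ) * Real.log k ^ (1 - α) *
            Real.exp (Real.log k ^ (α ^ 2) - (α - ε) * Real.log k ^ (2 * α ^ 2 - α))) ≤
          g.prob (fun n => (n : ℝ) * Real.exp (Real.log n ^ α)) a b (k + 1)) ∧
      -- upper bound
      (∃ c₂ > (0 : ℝ), ∀ ε : ℝ, 0 < ε → ∀ k : ℕ, 2 ≤ k →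
        g.prob (fun n => (n : ℝ) * Real.exp (Real.log n ^ α)) a b (k + 1) ≤
          c₂ / ((k : ℝ) * Real.log k ^ (1 - α) *
            Real.exp (Real.log k ^ (α ^ 2) - (α + ε) * Real.log k ^ (2 * α ^ 2 - α)))) ∧
      -- the case `α ≤ 1 / 2`
      (α ≤ 1 / 2 →
        (∃ c₁ > (0 : ℝ), ∃ c₂ > (0 : ℝ), ∀ k : ℕ, 2 ≤ k →
          c₁ ≤ Real.exp (-Real.log k ^ (2 * α ^ 2 - α)) ∧
          Real.exp (-Real.log k ^ (2 * α ^ 2 - α)) ≤ c₂) ∧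
        (∃ c₁ > (0 : ℝ), ∃ c₂ > (0 : ℝ), ∀ k : ℕ, 2 ≤ k →
          (g.Possible a b (k + 1) →
            c₁ / ((k : ℝ) * Real.log k ^ (1 - α) * Real.exp (Real.log k ^ (α ^ 2))) ≤
              g.prob (fun n => (n : ℝ) * Real.exp (Real.log n ^ α)) a b (k + 1)) ∧
          g.prob (fun n => (n : ℝ) * Real.exp (Real.log n ^ α)) a b (k + 1) ≤
            c₂ / ((k : ℝ) * Real.log k ^ (1 - α) * Real.exp (Real.log k ^ (α ^ 2)))))) ∧
    -- (d)
    (∀ ε : ℝ, 0 < ε → ε ≤ 1 → ∃ c₁ > (0 : ℝ), ∃ c₂ > (0 : ℝ), ∀ k : ℕ, 1 ≤ k →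
      ∀ kstar : ℝ,
        kstar = (k : ℝ) / 2 - (1 - ε) / (ε * (2 : ℝ) ^ (2 - ε)) * (k : ℝ) ^ (1 - ε) * Real.log k →
      (g.Possible a b (k + 1) →
        c₁ * (k : ℝ) ^ (1 - ε) / Real.exp (((k : ℝ) - kstar) ^ ε) ≤
          g.prob (fun n => Real.exp ((n : ℝ) ^ ε)) a b (k + 1)) ∧
      g.prob (fun n => Real.exp ((n : ℝ) ^ ε)) a b (k + 1) ≤
        c₂ * (k : ℝ) ^ (1 - ε) / Real.exp (((k : ℝ) - kstar) ^ ε)) ∧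
    -- (e)
    (∀ α : ℝ, 0 < α → ∃ c₁ > (0 : ℝ), ∃ c₂ > (0 : ℝ), ∀ k : ℕ, 1 ≤ k →
      (g.Possible a b (k + 1) →
        c₁ * Real.exp (-α * k / 2) ≤ g.prob (fun n => Real.exp (α * n)) a b (k + 1)) ∧
      g.prob (fun n => Real.exp (α * n)) a b (k + 1) ≤ c₂ * Real.exp (-α * k / 2)) := by
  refine ⟨fun ρ hρ => ?_, fun ρ α w₁ hρ hα hw₁ => ?_, fun α h0 h1 => ⟨fun hα => ?_,
    fun hα ε hε => ?_, ?_, fun hα => ⟨?_, ?_⟩⟩, fun ε h0 h1 => ?_, fun α hα => ?_⟩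
  -- Pure powers are the case of logarithmic exponent `0`.
  · have hw : (fun n : ℕ => (n : ℝ) ^ ρ) = powLogWeight ρ 0 1 := by
      funext n
      unfold powLogWeight
      split_ifs with hn <;> simp [hn]
    rw [hw]
    simpa using g.prob_powLog_bounds ha hb hρ le_rfl one_pos le_rfl (fun k _ => by simp)
  · refine g.prob_powLog_bounds ha hb hρ (by linarith) hw₁ one_le_two (fun k hk => ?_)
    exact Real.rpow_pos_of_pos (Real.log_pos (by exact_mod_cast (show 1 < k by omega))) _
  · exact g.le_prob_mulExpLog ha hb h0 h1 (eventually_loserLog_defect_le_of_le h0 h1 hα)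
  · exact g.le_prob_mulExpLog ha hb h0 h1 (eventually_loserLog_defect_le_of_lt h0 h1 (by linarith))
  -- The bound with `α` in place of `α + ε` is stronger, so the constant does not depend on `ε`.
  · obtain ⟨C, hC, h⟩ := g.prob_mulExpLog_le ha hb h0 h1
    refine ⟨C, hC, fun ε hε k hk => (h k hk).trans ?_⟩
    have hk1 : (1 : ℝ) < k := by exact_mod_cast (show 1 < k by omega)
    have hk0 : (0 : ℝ) < k := by linarith
    have hL := Real.log_pos hk1
    refine TwoEdgeWalk.Graph.div_rate_le_div_rate (by positivity) hC.le ?_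
    gcongr
    linarith
  · exact exp_neg_log_rpow_bounds (by nlinarith)
  · exact g.prob_mulExpLog_bounds_of_le_half ha hb h0 hα
  · have hw : (fun n : ℕ => Real.exp ((n : ℝ) ^ ε)) = stretchedExpWeight 1 ε := by
      funext n; rw [stretchedExpWeight, one_mul]
    rw [hw]
    obtain ⟨c₁, hc₁, c₂, hc₂, h⟩ := g.prob_stretchedExp_bounds ha hb one_pos h0 h1
    refine ⟨c₁, hc₁, c₂, hc₂, fun k hk kstar hkstar => ?_⟩
    have h2 := h k hk
    rwa [loserCount, one_mul, one_mul, ← hkstar, Real.exp_neg, ← mul_assoc, ← div_eq_mul_inv,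
      ← mul_assoc, ← div_eq_mul_inv] at h2
  -- For exponent `1` the logarithmic correction vanishes and the balance point is `k / 2`.
  · have hw : (fun n : ℕ => Real.exp (α * n)) = stretchedExpWeight α 1 := by
      funext n; rw [stretchedExpWeight, Real.rpow_one]
    rw [hw]
    obtain ⟨c₁, hc₁, c₂, hc₂, h⟩ := g.prob_stretchedExp_bounds ha hb hα one_pos le_rfl
    refine ⟨c₁, hc₁, c₂, hc₂, fun k hk => ?_⟩
    have h2 := h k hk
    have e : (k : ℝ) ^ (1 - 1 : ℝ) * Real.exp (-(α * ((k : ℝ) - loserCount α 1 k) ^ (1 : ℝ))) =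
        Real.exp (-α * k / 2) := by
      rw [loserCount, Real.rpow_one, sub_self, Real.rpow_zero, one_mul]
      congr 1
      ring
    rwa [e] at h2
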